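/- **Setting (contextual dynamic pricing with one product).** A seller has $B\in\mathbb N$ identical items and $T$ rounds. In each round a context $x$ is drawn independently from a distribution $D_X$ on a measurable space $X$ ($D_X$ is known to the seller); the seller posts a price $p\in[0,1]$, or skips the round (null action), and a sale at a posted price $p$ occurs with probability $S(p\mid x)$ (measurable in $x$; unknown to the seller), independently of the past. The seller observes the context and whether a sale occurred. Skipping never sells. The process stops at the first round in which total sales exceed $B$; the total reward is the revenue from the rounds strictly before that one (among the $T$ rounds). Demands are $L$-Lipschitz: $|S(p\mid x)-S(p'\mid x)|\le L|p-p'|$ for all $x,p,p'$. A policy is a measurable map $X\to[0,1]$, and $\Pi$ is a finite set of policies. $\mathrm{OPT}(\Pi)$ is the supremum of the expected total reward over all (possibly randomized) rules, which may depend on $D_X$ and $S$, that before each round choose a policy $\pi\in\Pi$ from the past observations and then post $\pi(x)$. For $\varepsilon>0$ let $\pi_\varepsilon(x)$ be $\pi(x)$ rounded down to a multiple of $\varepsilon$ and $\Pi_\varepsilon=\{\pi_\varepsilon:\pi\in\Pi\}$. **Algorithm CBalance** on $\Pi_\varepsilon$. Let $A$ consist of the multiples of $\varepsilon$ in $[0,1]$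 and the null action, $K=|A|$; let $\Pi'$ be $\Pi_\varepsilon$ together with the policy that always skips; $\ell=\log(2KT|\Pi'|)$, $q_0=\min\{\tfrac12,\sqrt{K\ell/T}\}$. For a distribution $P$ on $\Pi'$ put $P'(a\mid x)=(1-q_0)\sum_{\pi:\pi(x)=a}P(\pi)+q_0/K$, $a\in A$. The algorithm chooses in each round $i$ a distribution $P_i$ on $\Pi'$ and draws its action from $P_i'(\cdot\mid x_i)$. After $s\ge1$ rounds let $\hat r_s(\pi)$ and $\hat c_s(\pi)$ be the averages over $i\le s$ of $\frac{\mathbf 1\{a_i=\pi(x_i)\}}{P_i'(a_i\mid x_i)}$ times the revenue, respectively the number of items sold, of round $i$; let $V_s(\pi)=\frac1s\sum_{i\le s}\mathbb E_{x\sim D_X}[1/P_i'(\pi(x)\mid x)]$ and $\mathrm{rad}_s(\pi)=\sqrt{\kappa\ell V_s(\pi)/s}+\kappa\ell K/(q_0s)$. The confidence region consists of all tuples $(r(\pi),c(\pi))_{\pi\in\Pi'}\in([0,1]^2)^{\Pi'}$, equal to $(0,0)$ at the skipping policy, with $|\hat r_s(\pi)-r(\pi)|\le\mathrm{rad}_s(\pi)$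 and $|\hat c_s(\pi)-c(\pi)|\le\mathrm{rad}_s(\pi)$ for all $\pi$ and all past $s$. Let $\Delta$ be the set of distributions $P$ on $\Pi'$ that, for some tuple of the region, maximize $\sum_\pi P(\pi)r(\pi)$ subject to $\sum_\pi P(\pi)c(\pi)\le B/T$. The next distribution is any (measurably chosen) $P\in\mathrm{conv}(\Delta)$ with $\mathbb E_{x\sim D_X}\big[\sum_{\pi}Q(\pi)/P'(\pi(x)\mid x)\big]\le 2K$ for all $Q\in\mathrm{conv}(\Delta)$ (an arbitrary one if $\Delta=\emptyset$). **Theorem.** There are an absolute constant $\kappa>0$ and a choice of $\varepsilon>0$ as a function of $(B,T,L,|\Pi|)$ such that, for every $L_0>0$, there is a constant $C$ depending only on $L_0$ with the following property. For all $X$, $D_X$, $B$, $T$, all $L\ge L_0$ and all finite $\Pi$ with $T|\Pi|\ge 2$, the choices that CBalance makes on $\Pi_\varepsilon$ are possible, and, however ties are broken, for all $L$-Lipschitz demands its expected total reward satisfies $$\mathrm{Rew}\ \ge\ \mathrm{OPT}(\Pi)-C\,T^{3/5}B^{1/5}\,\bigl(L\log(T|\Pi|)\bigr)^{1/5}.$$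 -/

import Mathlib

open MeasureTheory

noncomputable section

namespace Pricing

/-! ### The selling process -/

/-- An action: post a price in `[0,1]` (`Sum.inl p`), or skip the round (`Sum.inr ()`, the null
action). -/
abbrev Act : Type := unitInterval ⊕ Unit

/-- The posted price; skipping yields no revenue. -/
def price : Act → ℝ := Sum.elim (fun p => (p : ℝ)) (fun _ => 0)

/-- Demand: `S x p` is the probability that the customer with context `x` buys at price `p`. -/
abbrev Demand (X : Type*) : Type _ := X → unitInterval → unitInterval

/-- `S` is `L`-Lipschitz in the price, uniformly over contexts. -/
def LipschitzDemand {X : Type*} (S : Demand X) (L : ℝ) : Prop :=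
  ∀ (x : X) (p q : unitInterval), |(S x p : ℝ) - (S x q : ℝ)| ≤ L * |(p : ℝ) - (q : ℝ)|

/-- The probability of a sale, given the context and the action; skipping never sells. -/
def saleProb {X : Type*} (S : Demand X) (x : X) : Act → ℝ :=
  Sum.elim (fun p => (S x p : ℝ)) (fun _ => 0)

/-- What is observed in one round: the context, the action, and whether an item was sold. -/
abbrev Round (X : Type*) : Type _ := X × Act × Bool

/-- The observations of the first `t` rounds. -/
abbrev History (X : Type*) (t : ℕ) : Type _ := Fin t → Round X

/-- The first `s` rounds of a history. -/
def History.take {X : Type*} {t : ℕ} (h : History X t) (s : ℕ) (hs : s ≤ t) : History X s :=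
  fun i => h (Fin.castLE hs i)

/-- A (randomized, non-anticipating) way to sell: given the past rounds and the current context,
a distribution over actions. -/
abbrev Strategy (X : Type*) : Type _ := (t : ℕ) → History X t → X → Measure Act

variable {X : Type*} [MeasurableSpace X]

/-- The law of the next round: the context is drawn from `μ`, the action from the strategy, and
the item is sold with the probability given by the demand. -/
def roundLaw (μ : Measure X) (S : Demand X) (σ : X → Measure Act) : Measure (Round X) :=
  μ.bind fun x => (σ x).bind fun a =>
    ENNReal.ofReal (saleProb S x a) • Measure.dirac (x, a, true) +
      ENNReal.ofReal (1 - saleProb S x a) • Measure.dirac (x, a, false)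

/-- The law of the history of the first `t` rounds. -/
def historyLaw (μ : Measure X) (S : Demand X) (σ : Strategy X) : (t : ℕ) → Measure (History X t)
  | 0 => Measure.dirac Fin.elim0
  | t + 1 => (historyLaw μ S σ t).bind fun h =>
      (roundLaw μ S (σ t h)).map fun o => (Fin.snoc h o : History X (t + 1))

/-- Number of sales in rounds `0, …, i`. -/
def salesUpTo {X : Type*} {t : ℕ} (h : History X t) (i : Fin t) : ℕ :=
  (Finset.univ.filter fun j : Fin t => j ≤ i ∧ (h j).2.2 = true).card

/-- Total reward under the hard supply constraint: the revenue collected strictly before the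
first round in which total sales exceed the supply `B`. -/
def totalReward {X : Type*} (B : ℕ) {t : ℕ} (h : History X t) : ℝ :=
  ∑ i : Fin t, if (h i).2.2 = true ∧ salesUpTo h i ≤ B then price (h i).2.1 else 0

/-- Expected total reward over time horizon `T` with supply `B`. -/
def expectedReward (μ : Measure X) (S : Demand X) (B T : ℕ) (σ : Strategy X) : ℝ :=
  ∫ h, totalReward B h ∂(historyLaw μ S σ T)

/-! ### The benchmark -/

/-- A benchmark rule for `Π`: before each round it chooses, from the past, a distribution over the
policies in `Π`. (It may be tailored to the demand and to the context distribution.) -/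
structure BenchmarkRule (Pol : Finset (X → unitInterval)) where
  weights : (t : ℕ) → History X t → Pol → ℝ
  measurable_weights : ∀ t, Measurable (weights t)
  mem_stdSimplex : ∀ t h, weights t h ∈ stdSimplex ℝ Pol

/-- Draw a policy of `Π` from the chosen distribution, then post its price for the current
context. -/
def BenchmarkRule.strategy {Pol : Finset (X → unitInterval)} (β : BenchmarkRule Pol) :
    Strategy X :=
  fun t h x => ∑ π : Pol, ENNReal.ofReal (β.weights t h π) • Measure.dirac (Sum.inl (π.1 x))

/-- `OPT(Π)`: the optimal expected total reward over all benchmark rules. -/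
def OPT (μ : Measure X) (S : Demand X) (B T : ℕ) (Pol : Finset (X → unitInterval)) : ℝ :=
  ⨆ β : BenchmarkRule Pol, expectedReward μ S B T β.strategy

/-! ### Discretization -/

/-- Round a price down to the nearest multiple of `ε`. -/
def roundDown (ε : ℝ) (p : unitInterval) : unitInterval :=
  Set.projIcc 0 1 zero_le_one (ε * (⌊(p : ℝ) / ε⌋ : ℝ))

/-- For `ε > 0` the projection in `roundDown` does nothing. -/
theorem coe_roundDown {ε : ℝ} (hε : 0 < ε) (p : unitInterval) :
    (roundDown ε p : ℝ) = ε * (⌊(p : ℝ) / ε⌋ : ℝ) := by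
  have h0 : (0 : ℝ) ≤ ε * (⌊(p : ℝ) / ε⌋ : ℝ) :=
    mul_nonneg hε.le (by exact_mod_cast Int.floor_nonneg.mpr (div_nonneg p.2.1 hε.le))
  have h1 : ε * (⌊(p : ℝ) / ε⌋ : ℝ) ≤ 1 := by
    calc ε * (⌊(p : ℝ) / ε⌋ : ℝ) ≤ ε * ((p : ℝ) / ε) :=
          mul_le_mul_of_nonneg_left (Int.floor_le _) hε.le
      _ = p := by field_simp
      _ ≤ 1 := p.2.2
  simp [roundDown, Set.projIcc, h0, h1]

open Classical in
/-- The discretized policy set `Π_ε`. -/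
def discretize (ε : ℝ) (Pol : Finset (X → unitInterval)) : Finset (X → unitInterval) :=
  Pol.image fun π x => roundDown ε (π x)

/-- All multiples of `ε` in `[0,1]`. -/
def priceGrid (ε : ℝ) : Finset unitInterval :=
  open Classical in
  (Finset.range (⌊1 / ε⌋₊ + 1)).image fun k : ℕ => Set.projIcc 0 1 zero_le_one ((k : ℝ) * ε)

/-! ### The algorithm CBalance -/

/-- The input of the algorithm: supply, time horizon, a finite set of prices, a finite set of
policies with these prices, the (known) context distribution, and the constant in the confidence
radius. -/
structure Input (X : Type*) [MeasurableSpace X] where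
  B : ℕ
  T : ℕ
  prices : Finset unitInterval
  policies : Finset (X → unitInterval)
  contextLaw : Measure X
  radConst : ℝ

namespace Input

variable (I : Input X)

open Classical in
/-- The actions: all given prices and the null action. -/
def acts : Finset Act := insert (Sum.inr ()) (I.prices.image Sum.inl)

open Classical in
/-- The policies: the given ones and the null policy, which always skips. -/
def cands : Finset (X → Act) :=
  insert (fun _ => Sum.inr ()) (I.policies.image fun π x => Sum.inl (π x))

/-- The number `K` of actions. -/
def numActs : ℝ := I.acts.card

/-- `log (d K T |Π|)`, with `d = 2` resources (items and time). -/
def logTerm : ℝ := Real.log (2 * I.numActs * I.T * I.cands.card)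

/-- The noise probability `q₀`. -/
def noise : ℝ := min (1 / 2) (√(I.numActs * I.logTerm / I.T))

/-- `P'(a|x)`: the noisy version of the mixture of policies `P`. With probability `1 - q₀` a policy
drawn from `P` is followed, with probability `q₀` a uniformly random action is taken. -/
def noisy (P : I.cands → ℝ) (x : X) (a : Act) : ℝ :=
  open Classical in
  (1 - I.noise) * (∑ π : I.cands, if π.1 x = a then P π else 0) + I.noise / I.numActs

/-- A mixture rule: from the past, a mixture of policies (before the noise is added). -/
abbrev MixtureRule : Type _ := (t : ℕ) → History X t → I.cands → ℝ

variable {I}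

/-- The strategy that plays, in each round, the noisy version of the chosen mixture. -/
def MixtureRule.strategy (ρ : I.MixtureRule) : Strategy X :=
  fun t h x => ∑ a ∈ I.acts, ENNReal.ofReal (I.noisy (ρ t h) x a) • Measure.dirac a

/-- The weight `1{a_i = π(x_i)} / P'_i(a_i | x_i)` of round `i` in the estimates for `π`. -/
def ipsWeight (ρ : I.MixtureRule) {s : ℕ} (h : History X s) (i : Fin s) (π : I.cands) : ℝ :=
  open Classical in
  if (h i).2.1 = π.1 (h i).1 then
    1 / I.noisy (ρ i (h.take i i.2.le)) (h i).1 (h i).2.1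
  else 0

/-- The inverse-propensity estimate of the expected per-round reward of `π` from `s` rounds. -/
def estReward (ρ : I.MixtureRule) {s : ℕ} (h : History X s) (π : I.cands) : ℝ :=
  (∑ i : Fin s, ipsWeight ρ h i π * (if (h i).2.2 = true then price (h i).2.1 else 0)) / s

/-- The inverse-propensity estimate of the expected per-round consumption of `π`. -/
def estSales (ρ : I.MixtureRule) {s : ℕ} (h : History X s) (π : I.cands) : ℝ :=
  (∑ i : Fin s, ipsWeight ρ h i π * (if (h i).2.2 = true then 1 else 0)) / s

/-- The variance proxy: the average over the `s` rounds of `E_x [1 / P'_i(π(x) | x)]`. -/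
def varProxy (ρ : I.MixtureRule) {s : ℕ} (h : History X s) (π : I.cands) : ℝ :=
  (∑ i : Fin s, ∫ x, 1 / I.noisy (ρ i (h.take i i.2.le)) x (π.1 x) ∂I.contextLaw) / s

/-- The confidence radius for `π` after `s` rounds. -/
def radius (ρ : I.MixtureRule) {s : ℕ} (h : History X s) (π : I.cands) : ℝ :=
  √(I.radConst * I.logTerm * varProxy ρ h π / s) +
    I.radConst * I.logTerm * I.numActs / (I.noise * s)

variable (I) in
/-- A tuple of hypothetical expected per-round outcomes of all policies. -/
structure Outcomes where
  reward : I.cands → ℝ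
  sales : I.cands → ℝ

/-- Feasibility: values in `[0,1]`, and the null policy yields and consumes nothing. -/
def Outcomes.Feasible (m : I.Outcomes) : Prop :=
  ∀ π : I.cands, m.reward π ∈ Set.Icc 0 1 ∧ m.sales π ∈ Set.Icc 0 1 ∧
    (π.1 = (fun _ => Sum.inr ()) → m.reward π = 0 ∧ m.sales π = 0)

/-- The confidence region after the history `h`: all feasible tuples that have been within the
confidence radius of the estimates in every round so far. -/
def confRegion (ρ : I.MixtureRule) {t : ℕ} (h : History X t) : Set I.Outcomes :=
  {m | m.Feasible ∧ ∀ (s : ℕ) (hs : s ≤ t), 0 < s → ∀ π : I.cands,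
    |estReward ρ (h.take s hs) π - m.reward π| ≤ radius ρ (h.take s hs) π ∧
    |estSales ρ (h.take s hs) π - m.sales π| ≤ radius ρ (h.take s hs) π}

/-- The distributions over policies that respect the supply rate `B / T` in expectation. -/
def Outcomes.lpFeasible (m : I.Outcomes) : Set (I.cands → ℝ) :=
  {P | P ∈ stdSimplex ℝ I.cands ∧ ∑ π, P π * m.sales π ≤ (I.B : ℝ) / I.T}

/-- `P` is LP-perfect for the tuple `m`: it maximizes the expected per-round reward subject to the
supply rate. -/
def Outcomes.LPPerfect (m : I.Outcomes) (P : I.cands → ℝ) : Prop :=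
  P ∈ m.lpFeasible ∧ ∀ Q ∈ m.lpFeasible, ∑ π, Q π * m.reward π ≤ ∑ π, P π * m.reward π

/-- The potentially perfect distributions: LP-perfect for some tuple in the confidence region. -/
def potentiallyPerfect (ρ : I.MixtureRule) {t : ℕ} (h : History X t) : Set (I.cands → ℝ) :=
  {P | ∃ m ∈ confRegion ρ h, m.LPPerfect P}

variable (I) in
/-- `P` is balanced with respect to `D`: its noisy version explores every `Q ∈ D` sufficiently,
`E_x E_{π ∼ Q} [1 / P'(π(x) | x)] ≤ 2 K`. -/
def Balanced (D : Set (I.cands → ℝ)) (P : I.cands → ℝ) : Prop :=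
  ∀ Q ∈ D, ∫ x, ∑ π : I.cands, Q π / I.noisy P x (π.1 x) ∂I.contextLaw ≤ 2 * I.numActs

/-- `ρ` is a version of CBalance: in every round it chooses a balanced distribution from the convex
hull of the potentially perfect ones, ties being broken (measurably) in any way. If the
confidence region has become empty, the choice is arbitrary. -/
structure IsCBalance (ρ : I.MixtureRule) : Prop where
  measurable : ∀ t, Measurable (ρ t)
  mem_stdSimplex : ∀ t h, ρ t h ∈ stdSimplex ℝ I.cands
  mem_convexHull : ∀ t (h : History X t), (potentiallyPerfect ρ h).Nonempty →
    ρ t h ∈ convexHull ℝ (potentiallyPerfect ρ h)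
  balanced : ∀ t (h : History X t), (potentiallyPerfect ρ h).Nonempty →
    I.Balanced (convexHull ℝ (potentiallyPerfect ρ h)) (ρ t h)

end Input

/-- The input of CBalance for the discretized problem. -/
def discretizedInput (B T : ℕ) (ε : ℝ) (Pol : Finset (X → unitInterval)) (μ : Measure X)
    (κ : ℝ) : Input X where
  B := B
  T := T
  prices := priceGrid ε
  policies := discretize ε Pol
  contextLaw := μ
  radConst := κ

end Pricing

end

/-!
The benchmark and the algorithm are both compared with the linear program that maximizes the
expected per-round reward of a distribution over the candidate policies, subject to the supply
rate `B / T`.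

*Upper bound on the benchmark.* The expected numbers of rounds in which a benchmark rule chooses
each policy while supply is left, divided by `T`, form a subdistribution that respects the supply
rate (`BenchmarkRule.expectedReward_le`). Rounding prices down by at most `ε` lowers revenues by
at most `(L + 1) ε` and raises sales by at most `L ε`, and mixing with the null policy restores
feasibility, so `OPT ≤ T (LP + (2 L + 1) ε)` (`OPT_le`).

*Lower bound on the algorithm.* The inverse propensity scores are unbiased, so Freedman's
inequality, applied at the tilts `1 / n` for polynomially many integers `n` and combined with a
union bound, keeps the true outcomes in the confidence region with probability `1 - 1 / T`
(`Input.Proper.trueOutcomes_mem_confRegion`). A distribution that is potentially perfect now was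
so in all earlier rounds; as the distributions played then were balanced, its average variance
proxy is at most `2 K`, and all tuples of the confidence region nearly agree on it. Hence the
distribution played in round `t` is optimal and feasible for the true outcomes up to a multiple of
`√(K ℓ / t) + K ℓ / (q₀ t)` (`Input.Proper.near_optimal`). Since a sale beyond the supply costs at
most one unit of revenue, summing these losses bounds the regret against the linear program by a
multiple of `T (K ℓ / T)^(1/3)` (`Input.Proper.expectedReward_ge`, `Input.Proper.regret_le`).

*Parameters.* Put `v = (L log (T |Π|) / T)^(1/4)`. With `ε = v / L` both errors are of order
`T v`, which is below the claimed bound when `v ≤ 1` and `B ≥ T v`; otherwise the claimed bound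
exceeds the trivial bound `min B T` on the benchmark.

*The algorithm's choices are possible.* A maximizer of a strictly concave perturbation of
`P ↦ E ∑ₐ log P'(a | x)` over the convex hull of the potentially perfect distributions is balanced: this
is the first-order condition, in which the contribution of the exploration noise absorbs that of
the perturbation, and `K / (1 - q₀) ≤ 2 K` (`Input.Proper.balanced_of_maximizer`). For `B > 0`,
being potentially perfect is a closed condition on the distribution and on the estimates and radii
seen so far, because LP-perfection is (`Input.Outcomes.lpPerfect_iff`); so is membership in the
convex hull, by Carathéodory's theorem. The unique maximizer is therefore a Borel function of
these statistics (`exists_measurable_argmax`), and the rule is built by recursion on the rounds.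
For `B = 0` the grid is chosen so wide that the price zero alone is left, and a direct choice
works.
-/

namespace Pricing

variable {X : Type*} [MeasurableSpace X]

/-! ### The law of the history -/

theorem integrable_of_measurable_of_abs_le {α : Type*} [MeasurableSpace α] {m : Measure α}
    [IsFiniteMeasure m] {f : α → ℝ} (hf : Measurable f) {C : ℝ} (hC : ∀ a, |f a| ≤ C) :
    Integrable f m :=
  Integrable.of_bound hf.aestronglyMeasurable C (Filter.Eventually.of_forall hC)

theorem abs_integral_le_of_abs_le {α : Type*} [MeasurableSpace α] {m : Measure α}
    [IsProbabilityMeasure m] {f : α → ℝ} {C : ℝ} (hC : ∀ a, |f a| ≤ C) :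
    |∫ a, f a ∂m| ≤ C := by
  have := norm_integral_le_of_norm_le_const (μ := m) (f := f) (C := C)
    (Filter.Eventually.of_forall hC)
  simpa using this

theorem isProbabilityMeasure_bind {α β : Type*} [MeasurableSpace α] [MeasurableSpace β]
    {m : Measure α} [IsProbabilityMeasure m] {k : α → Measure β} (hk : Measurable k)
    (hp : ∀ a, IsProbabilityMeasure (k a)) : IsProbabilityMeasure (m.bind k) :=
  ⟨by rw [Measure.bind_apply MeasurableSet.univ hk.aemeasurable]; simp⟩

theorem integral_bind_of_abs_le {α β : Type*} [MeasurableSpace α] [MeasurableSpace β]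
    {m : Measure α} [IsProbabilityMeasure m] {k : α → Measure β} (hk : Measurable k)
    (hp : ∀ a, IsProbabilityMeasure (k a)) {F : β → ℝ} (hF : Measurable F) {C : ℝ}
    (hC : ∀ b, |F b| ≤ C) : ∫ b, F b ∂(m.bind k) = ∫ a, ∫ b, F b ∂(k a) ∂m := by
  have := isProbabilityMeasure_bind (m := m) hk hp
  let K : ProbabilityTheory.Kernel α β := ⟨k, hk⟩
  have h := ProbabilityTheory.Kernel.integral_comp (η := K)
    (κ := ProbabilityTheory.Kernel.const Unit m) (a := ()) (f := F) (by
      rw [ProbabilityTheory.Kernel.comp_apply]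
      exact integrable_of_measurable_of_abs_le (m := m.bind k) hF hC)
  rw [ProbabilityTheory.Kernel.comp_apply] at h
  exact h

theorem measurable_integral_of_abs_le {α β : Type*} [MeasurableSpace α] [MeasurableSpace β]
    {k : α → Measure β} (hk : Measurable k) (hp : ∀ a, IsProbabilityMeasure (k a))
    {F : α → β → ℝ} (hF : Measurable (Function.uncurry F)) :
    Measurable fun a => ∫ b, F a b ∂(k a) := by
  let K : ProbabilityTheory.Kernel α β := ⟨k, hk⟩
  have : ProbabilityTheory.IsMarkovKernel K := ⟨hp⟩
  exact (hF.stronglyMeasurable.integral_kernel_prod_right (κ := K)).measurable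

/-- A strategy for which the law of the next round is a probability measure that depends measurably
on the past. -/
structure Regular (μ : Measure X) (S : Demand X) (σ : Strategy X) : Prop where
  measurable_roundLaw : ∀ t, Measurable fun h : History X t => roundLaw μ S (σ t h)
  isProbabilityMeasure : ∀ t h, IsProbabilityMeasure (roundLaw μ S (σ t h))

theorem measurable_snoc (t : ℕ) :
    Measurable fun p : History X t × Round X => (Fin.snoc p.1 p.2 : History X (t + 1)) := by
  refine measurable_pi_lambda _ fun i => ?_
  refine Fin.lastCases ?_ (fun j => ?_) i
  · simpa using measurable_snd
  · simp only [Fin.snoc_castSucc]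
    exact (measurable_pi_apply j).comp measurable_fst

theorem measurable_snoc_right {t : ℕ} (h : History X t) :
    Measurable fun o : Round X => (Fin.snoc h o : History X (t + 1)) :=
  (measurable_snoc t).comp (f := fun o => (h, o)) measurable_prodMk_left

theorem measurable_take {t : ℕ} (s : ℕ) (hs : s ≤ t) :
    Measurable fun h : History X t => h.take s hs :=
  measurable_pi_lambda _ fun _ => measurable_pi_apply _

theorem take_self {X : Type*} {t : ℕ} (h : History X t) : h.take t le_rfl = h := rfl

theorem snoc_take {X : Type*} {t : ℕ} (h : History X t) (o : Round X) {s : ℕ} (hs : s ≤ t) :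
    History.take (Fin.snoc h o : History X (t + 1)) s (hs.trans t.le_succ) = h.take s hs := by
  funext i
  exact Fin.snoc_castSucc (α := fun _ => Round X) o h (Fin.castLE hs i)

section Law

variable {μ : Measure X} {S : Demand X} {σ : Strategy X}

theorem Regular.measurable_step (hσ : Regular μ S σ) (t : ℕ) :
    Measurable fun h : History X t =>
      (roundLaw μ S (σ t h)).map fun o => (Fin.snoc h o : History X (t + 1)) := by
  have := hσ.isProbabilityMeasure t
  refine Measure.measurable_of_measurable_coe _ fun A hA => ?_
  let K : ProbabilityTheory.Kernel (History X t) (Round X) := ⟨_, hσ.measurable_roundLaw t⟩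
  have : ProbabilityTheory.IsMarkovKernel K := ⟨hσ.isProbabilityMeasure t⟩
  have h1 : ∀ h : History X t, ((roundLaw μ S (σ t h)).map
      fun o => (Fin.snoc h o : History X (t + 1))) A =
      K h (Prod.mk h ⁻¹' ((fun p : History X t × Round X =>
        (Fin.snoc p.1 p.2 : History X (t + 1))) ⁻¹' A)) := fun h => by
    rw [Measure.map_apply (measurable_snoc_right h) hA]
    rfl
  simp only [h1]
  exact ProbabilityTheory.Kernel.measurable_kernel_prodMk_left (measurable_snoc t hA)

theorem Regular.isProbabilityMeasure_step (hσ : Regular μ S σ) (t : ℕ) (h : History X t) :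
    IsProbabilityMeasure
      ((roundLaw μ S (σ t h)).map fun o => (Fin.snoc h o : History X (t + 1))) := by
  have := hσ.isProbabilityMeasure t h
  exact Measure.isProbabilityMeasure_map (measurable_snoc_right h).aemeasurable

theorem Regular.isProbabilityMeasure_historyLaw (hσ : Regular μ S σ) (t : ℕ) :
    IsProbabilityMeasure (historyLaw μ S σ t) := by
  induction t with
  | zero => exact Measure.dirac.isProbabilityMeasure
  | succ t ih =>
    exact isProbabilityMeasure_bind (hσ.measurable_step t) (hσ.isProbabilityMeasure_step t)

theorem Regular.integral_historyLaw_succ (hσ : Regular μ S σ) {t : ℕ}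
    {F : History X (t + 1) → ℝ} (hF : Measurable F) {C : ℝ} (hC : ∀ h, |F h| ≤ C) :
    ∫ h, F h ∂(historyLaw μ S σ (t + 1)) =
      ∫ h, ∫ o, F (Fin.snoc h o) ∂(roundLaw μ S (σ t h)) ∂(historyLaw μ S σ t) := by
  have := hσ.isProbabilityMeasure_historyLaw t
  rw [historyLaw, integral_bind_of_abs_le (hσ.measurable_step t)
    (hσ.isProbabilityMeasure_step t) hF hC]
  congr 1
  funext h
  rw [integral_map (measurable_snoc_right h).aemeasurable
    hF.aestronglyMeasurable]

theorem Regular.map_take_succ (hσ : Regular μ S σ) (t : ℕ) :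
    (historyLaw μ S σ (t + 1)).map (fun h => h.take t t.le_succ) = historyLaw μ S σ t := by
  ext A hA
  rw [Measure.map_apply (measurable_take _ _) hA, historyLaw,
    Measure.bind_apply (measurable_take _ _ hA) (hσ.measurable_step t).aemeasurable]
  have : ∀ h : History X t, ((roundLaw μ S (σ t h)).map
      fun o => (Fin.snoc h o : History X (t + 1)))
      ((fun h : History X (t + 1) => h.take t t.le_succ) ⁻¹' A) = A.indicator 1 h := by
    intro h
    have := hσ.isProbabilityMeasure t h
    rw [Measure.map_apply (measurable_snoc_right h)
      (measurable_take _ _ hA)]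
    have h2 : ∀ o, History.take (Fin.snoc h o : History X (t + 1)) t t.le_succ = h := fun o => by
      rw [snoc_take h o le_rfl, take_self]
    by_cases hh : h ∈ A <;> simp [Set.preimage, h2, hh]
  simp only [this]
  rw [lintegral_indicator_one hA]

/-- The first `s` rounds of a `t`-round history are distributed as an `s`-round history. -/
theorem Regular.map_take (hσ : Regular μ S σ) {s t : ℕ} (hs : s ≤ t) :
    (historyLaw μ S σ t).map (fun h => h.take s hs) = historyLaw μ S σ s := by
  induction t, hs using Nat.le_induction with
  | base => exact Measure.map_id
  | succ t hs ih =>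
    rw [← ih, ← hσ.map_take_succ t, Measure.map_map (measurable_take _ _) (measurable_take _ _)]
    rfl

end Law

/-! ### Sums along the history -/

/-- The sum over the rounds of a quantity that depends on the round and on the rounds before it. -/
def pathSum (G : (i : ℕ) → History X i → Round X → ℝ) {t : ℕ} (h : History X t) : ℝ :=
  ∑ i : Fin t, G i (h.take i i.2.le) (h i)

theorem pathSum_snoc {X : Type*} (G : (i : ℕ) → History X i → Round X → ℝ) {t : ℕ} (h : History X t)
    (o : Round X) :
    pathSum G (Fin.snoc h o : History X (t + 1)) = pathSum G h + G t h o := by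
  unfold pathSum
  rw [Fin.sum_univ_castSucc]
  congr 1
  · refine Finset.sum_congr rfl fun i _ => ?_
    have h1 := snoc_take h o i.2.le
    have h2 : (Fin.snoc h o : History X (t + 1)) i.castSucc = h i :=
      Fin.snoc_castSucc (α := fun _ => Round X) o h i
    rw [h2]
    exact congrArg (fun g => G i g (h i)) h1
  · have h1 := snoc_take h o (le_refl t)
    have h2 : (Fin.snoc h o : History X (t + 1)) (Fin.last t) = o :=
      Fin.snoc_last (α := fun _ => Round X) o h
    rw [h2]
    exact congrArg (fun g => G t g o) h1

theorem measurable_pathSum {G : (i : ℕ) → History X i → Round X → ℝ}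
    (hG : ∀ i, Measurable (Function.uncurry (G i))) (t : ℕ) :
    Measurable fun h : History X t => pathSum G h :=
  Finset.measurable_sum _ fun i _ =>
    (hG i).comp ((measurable_take _ i.2.le).prodMk (measurable_pi_apply i))

theorem abs_pathSum_le {X : Type*} {G : (i : ℕ) → History X i → Round X → ℝ} {C : ℝ}
    (hC : ∀ i h o, |G i h o| ≤ C) {t : ℕ} (h : History X t) : |pathSum G h| ≤ t * C := by
  refine (Finset.abs_sum_le_sum_abs _ _).trans ?_
  refine (Finset.sum_le_sum fun i _ => hC _ _ _).trans ?_
  simp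

section Martingale

variable {μ : Measure X} {S : Demand X} {σ : Strategy X}

/-- The expectation of a sum along the history is the expected sum of the conditional
expectations given the past. -/
theorem Regular.integral_pathSum (hσ : Regular μ S σ)
    {G : (i : ℕ) → History X i → Round X → ℝ} (hG : ∀ i, Measurable (Function.uncurry (G i)))
    {C : ℝ} (hC : ∀ i h o, |G i h o| ≤ C) (t : ℕ) :
    ∫ h, pathSum G h ∂(historyLaw μ S σ t) =
      ∫ h, pathSum (fun i g _ => ∫ o, G i g o ∂(roundLaw μ S (σ i g))) h
        ∂(historyLaw μ S σ t) := by
  have hP := hσ.isProbabilityMeasure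
  have hm : ∀ i, Measurable fun g : History X i => ∫ o, G i g o ∂(roundLaw μ S (σ i g)) :=
    fun i => measurable_integral_of_abs_le (hσ.measurable_roundLaw i) (hP i) (hG i)
  have hm' : ∀ i, Measurable (Function.uncurry fun (g : History X i) (_ : Round X) =>
      ∫ o, G i g o ∂(roundLaw μ S (σ i g))) := fun i => (hm i).comp measurable_fst
  have hb : ∀ i (g : History X i), |∫ o, G i g o ∂(roundLaw μ S (σ i g))| ≤ C := fun i g => by
    have := hP i g
    exact abs_integral_le_of_abs_le (hC i g)
  induction t with
  | zero => simp [pathSum]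
  | succ t ih =>
    have hPt := hσ.isProbabilityMeasure_historyLaw t
    rw [hσ.integral_historyLaw_succ (measurable_pathSum hG _) (abs_pathSum_le hC),
      hσ.integral_historyLaw_succ (measurable_pathSum hm' _)
        (abs_pathSum_le fun i h _ => hb i h)]
    simp only [pathSum_snoc]
    have e1 : ∀ h : History X t, ∫ o, (pathSum G h + G t h o) ∂(roundLaw μ S (σ t h)) =
        pathSum G h + ∫ o, G t h o ∂(roundLaw μ S (σ t h)) := fun h => by
      have := hP t h
      rw [integral_add (integrable_const _) (integrable_of_measurable_of_abs_le
        (hG t).of_uncurry_left (hC t h))]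
      simp
    have e2 : ∀ h : History X t, ∫ _o, (pathSum (fun i g _ => ∫ o, G i g o ∂(roundLaw μ S (σ i g))) h
        + ∫ o, G t h o ∂(roundLaw μ S (σ t h))) ∂(roundLaw μ S (σ t h)) =
        pathSum (fun i g _ => ∫ o, G i g o ∂(roundLaw μ S (σ i g))) h +
          ∫ o, G t h o ∂(roundLaw μ S (σ t h)) := fun h => by
      have := hP t h
      simp
    simp only [e1, e2]
    rw [integral_add (integrable_of_measurable_of_abs_le (measurable_pathSum hG t)
        (abs_pathSum_le hC)) (integrable_of_measurable_of_abs_le (hm t) (hb t)),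
      integral_add (integrable_of_measurable_of_abs_le (measurable_pathSum hm' t)
        (abs_pathSum_le fun i h _ => hb i h)) (integrable_of_measurable_of_abs_le (hm t) (hb t)),
      ih]

/-- Sums of martingale differences in `[-1,1]` over `t` rounds have variance at most `t`. -/
theorem Regular.integral_sq_pathSum_le (hσ : Regular μ S σ)
    {G : (i : ℕ) → History X i → Round X → ℝ} (hG : ∀ i, Measurable (Function.uncurry (G i)))
    (hC : ∀ i h o, |G i h o| ≤ 1)
    (h0 : ∀ i h, ∫ o, G i h o ∂(roundLaw μ S (σ i h)) = 0) (t : ℕ) :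
    ∫ h, (pathSum G h) ^ 2 ∂(historyLaw μ S σ t) ≤ t := by
  have hP := hσ.isProbabilityMeasure
  have hsq : ∀ (t : ℕ) (h : History X t), |pathSum G h ^ 2| ≤ (t * 1 : ℝ) ^ 2 := fun t h => by
    rw [abs_pow]; exact pow_le_pow_left₀ (abs_nonneg _) (abs_pathSum_le hC h) 2
  induction t with
  | zero => simp [pathSum]
  | succ t ih =>
    have hPt := hσ.isProbabilityMeasure_historyLaw t
    rw [hσ.integral_historyLaw_succ ((measurable_pathSum hG _).pow_const 2) (hsq _)]
    simp only [pathSum_snoc]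
    have e1 : ∀ h : History X t, ∫ o, (pathSum G h + G t h o) ^ 2 ∂(roundLaw μ S (σ t h)) ≤
        pathSum G h ^ 2 + 1 := fun h => by
      have := hP t h
      have hi := integrable_of_measurable_of_abs_le (m := roundLaw μ S (σ t h))
        (hG t).of_uncurry_left (hC t h)
      have hi2 : Integrable (fun o => G t h o ^ 2) (roundLaw μ S (σ t h)) :=
        integrable_of_measurable_of_abs_le ((hG t).of_uncurry_left.pow_const 2)
          (C := 1) fun o => by
            rw [abs_pow]; exact pow_le_one₀ (abs_nonneg _) (hC t h o)
      calc ∫ o, (pathSum G h + G t h o) ^ 2 ∂(roundLaw μ S (σ t h))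
          ≤ ∫ o, (pathSum G h ^ 2 + 1 + 2 * pathSum G h * G t h o) ∂(roundLaw μ S (σ t h)) := by
            refine integral_mono ?_ ?_ fun o => ?_
            · have : (fun o => (pathSum G h + G t h o) ^ 2) =
                  fun o => pathSum G h ^ 2 + 2 * pathSum G h * G t h o + G t h o ^ 2 := by
                funext o; ring
              rw [this]
              exact ((integrable_const _).add (hi.const_mul _)).add hi2
            · exact (integrable_const _).add (hi.const_mul _)
            · have := (sq_le_one_iff_abs_le_one _).2 (hC t h o)
              simp only
              nlinarith
        _ = pathSum G h ^ 2 + 1 := by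
            rw [integral_add (integrable_const _) (hi.const_mul _), integral_const_mul, h0]
            simp
    have hm : Measurable fun h : History X t =>
        ∫ o, (pathSum G h + G t h o) ^ 2 ∂(roundLaw μ S (σ t h)) := by
      refine measurable_integral_of_abs_le (hσ.measurable_roundLaw t) (hP t) ?_
      exact ((((measurable_pathSum hG t).comp measurable_fst).add (hG t)).pow_const 2)
    have hisq := integrable_of_measurable_of_abs_le (m := historyLaw μ S σ t)
      ((measurable_pathSum hG t).pow_const 2) (hsq t)
    calc _ ≤ ∫ h, (pathSum G h ^ 2 + 1) ∂(historyLaw μ S σ t) := by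
          refine integral_mono_of_nonneg (Filter.Eventually.of_forall fun h =>
            integral_nonneg fun o => sq_nonneg _) (hisq.add (integrable_const _))
            (Filter.Eventually.of_forall e1)
      _ ≤ _ := by
          rw [integral_add hisq (integrable_const _)]
          simp only [integral_const, smul_eq_mul, mul_one, probReal_univ]
          push_cast
          linarith

/-- First absolute moment of a sum of bounded martingale differences. -/
theorem Regular.integral_abs_pathSum_le (hσ : Regular μ S σ)
    {G : (i : ℕ) → History X i → Round X → ℝ} (hG : ∀ i, Measurable (Function.uncurry (G i)))
    (hC : ∀ i h o, |G i h o| ≤ 1)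
    (h0 : ∀ i h, ∫ o, G i h o ∂(roundLaw μ S (σ i h)) = 0) (t : ℕ) :
    ∫ h, |pathSum G h| ∂(historyLaw μ S σ t) ≤ √t := by
  have hPt := hσ.isProbabilityMeasure_historyLaw t
  rcases t.eq_zero_or_pos with rfl | ht
  · simp [pathSum]
  have hs : 0 < √(t : ℝ) := Real.sqrt_pos.2 (by exact_mod_cast ht)
  have hss : √(t : ℝ) ^ 2 = t := Real.sq_sqrt (Nat.cast_nonneg t)
  have hsq : Integrable (fun h => pathSum G h ^ 2) (historyLaw μ S σ t) :=
    integrable_of_measurable_of_abs_le ((measurable_pathSum hG t).pow_const 2)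
      (C := (t * 1 : ℝ) ^ 2) fun h => by
        rw [abs_pow]; exact pow_le_pow_left₀ (abs_nonneg _) (abs_pathSum_le hC h) 2
  have hle : ∀ h : History X t, |pathSum G h| ≤ (pathSum G h ^ 2 / √t + √t) / 2 := fun h => by
    rw [div_add' _ _ _ hs.ne', div_div, le_div_iff₀ (by positivity)]
    nlinarith [sq_nonneg (|pathSum G h| - √t), sq_abs (pathSum G h)]
  calc ∫ h, |pathSum G h| ∂(historyLaw μ S σ t)
      ≤ ∫ h, (pathSum G h ^ 2 / √t + √t) / 2 ∂(historyLaw μ S σ t) :=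
        integral_mono (integrable_of_measurable_of_abs_le (measurable_pathSum hG t).abs
          (C := t * 1) fun h => by rw [abs_abs]; exact abs_pathSum_le hC h)
          (((hsq.div_const _).add (integrable_const _)).div_const _) hle
    _ = ((∫ h, pathSum G h ^ 2 ∂(historyLaw μ S σ t)) / √t + √t) / 2 := by
        rw [integral_div, integral_add (hsq.div_const _) (integrable_const _), integral_div]
        simp
    _ ≤ (t / √t + √t) / 2 := by
        gcongr
        exact hσ.integral_sq_pathSum_le hG hC h0 t
    _ = √t := by
        rw [div_eq_iff two_ne_zero, div_add' _ _ _ hs.ne', div_eq_iff hs.ne']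
        nlinarith

theorem integral_exp_mul_le {α : Type*} [MeasurableSpace α] {ν : Measure α}
    [IsProbabilityMeasure ν] {D : α → ℝ} (hD : Measurable D) {M V l : ℝ} (hM : ∀ o, |D o| ≤ M)
    (h0 : ∫ o, D o ∂ν = 0) (h2 : ∫ o, D o ^ 2 ∂ν ≤ V) (hl : 0 ≤ l) (hlM : l * M ≤ 1) :
    ∫ o, Real.exp (l * D o) ∂ν ≤ Real.exp (l ^ 2 * V) := by
  have hi : Integrable D ν := integrable_of_measurable_of_abs_le hD hM
  have hi2 : Integrable (fun o => D o ^ 2) ν :=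
    integrable_of_measurable_of_abs_le (hD.pow_const 2) (C := M ^ 2) fun o => by
      rw [abs_pow]; exact pow_le_pow_left₀ (abs_nonneg _) (hM o) 2
  have hia : Integrable (fun o => 1 + l * D o) ν := (integrable_const _).add (hi.const_mul l)
  have hib : Integrable (fun o => l ^ 2 * D o ^ 2) ν := hi2.const_mul (l ^ 2)
  have hpt : ∀ o, Real.exp (l * D o) ≤ 1 + l * D o + l ^ 2 * D o ^ 2 := fun o => by
    have hx : |l * D o| ≤ 1 := by
      rw [abs_mul, abs_of_nonneg hl]
      exact (mul_le_mul_of_nonneg_left (hM o) hl).trans hlM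
    have := (abs_le.1 (Real.abs_exp_sub_one_sub_id_le hx)).2
    rw [mul_pow] at this
    linarith
  have hint : ∫ o, Real.exp (l * D o) ∂ν ≤ ∫ o, (1 + l * D o + l ^ 2 * D o ^ 2) ∂ν :=
    integral_mono_of_nonneg (Filter.Eventually.of_forall fun o => (Real.exp_pos _).le)
      (hia.add hib) (Filter.Eventually.of_forall hpt)
  have hval : ∫ o, (1 + l * D o + l ^ 2 * D o ^ 2) ∂ν = 1 + l ^ 2 * ∫ o, D o ^ 2 ∂ν := by
    rw [integral_add hia hib, integral_add (integrable_const _) (hi.const_mul l),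
      integral_const_mul, integral_const_mul, h0]
    simp
  have hVl : l ^ 2 * ∫ o, D o ^ 2 ∂ν ≤ l ^ 2 * V := mul_le_mul_of_nonneg_left h2 (sq_nonneg l)
  linarith [Real.add_one_le_exp (l ^ 2 * V)]

/-- Freedman's exponential supermartingale: for martingale differences `D` with conditional variance
at most `V`, the compensator of `exp (l D)` is at most `exp (l² V)` as long as `l |D| ≤ 1`. -/
theorem Regular.integral_exp_pathSum_le (hσ : Regular μ S σ)
    {D : (i : ℕ) → History X i → Round X → ℝ} (hD : ∀ i, Measurable (Function.uncurry (D i)))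
    {V : (i : ℕ) → History X i → ℝ} (hV : ∀ i, Measurable (V i))
    {M l : ℝ} (hM : ∀ i h o, |D i h o| ≤ M) (hVM : ∀ i h, |V i h| ≤ M)
    (h0 : ∀ i h, ∫ o, D i h o ∂(roundLaw μ S (σ i h)) = 0)
    (h2 : ∀ i h, ∫ o, D i h o ^ 2 ∂(roundLaw μ S (σ i h)) ≤ V i h)
    (hl : 0 ≤ l) (hlM : l * M ≤ 1) (t : ℕ) :
    ∫ h, Real.exp (pathSum (fun i g o => l * D i g o - l ^ 2 * V i g) h)
      ∂(historyLaw μ S σ t) ≤ 1 := by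
  have hP := hσ.isProbabilityMeasure
  set G : (i : ℕ) → History X i → Round X → ℝ := fun i g o => l * D i g o - l ^ 2 * V i g
    with hGdef
  have hG : ∀ i, Measurable (Function.uncurry (G i)) := fun i =>
    ((hD i).const_mul l).sub (((hV i).comp measurable_fst).const_mul (l ^ 2))
  have hC : ∀ i h o, |G i h o| ≤ l * M + l ^ 2 * M := fun i h o => by
    refine (abs_sub _ _).trans ?_
    rw [abs_mul, abs_mul, abs_of_nonneg hl, abs_of_nonneg (sq_nonneg l)]
    gcongr
    · exact hM i h o
    · exact hVM i h
  set C := l * M + l ^ 2 * M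
  have hexp : ∀ (t : ℕ) (h : History X t), |Real.exp (pathSum G h)| ≤ Real.exp (t * C) :=
    fun t h => by
      rw [abs_of_pos (Real.exp_pos _)]
      exact Real.exp_le_exp.2 ((le_abs_self _).trans (abs_pathSum_le hC h))
  induction t with
  | zero =>
    have := hσ.isProbabilityMeasure_historyLaw 0
    simp [pathSum]
  | succ t ih =>
    have hPt := hσ.isProbabilityMeasure_historyLaw t
    rw [hσ.integral_historyLaw_succ (measurable_pathSum hG _).exp (hexp _)]
    refine le_trans ?_ ih
    refine integral_mono_of_nonneg (Filter.Eventually.of_forall fun h =>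
      integral_nonneg fun o => (Real.exp_pos _).le)
      (integrable_of_measurable_of_abs_le (measurable_pathSum hG t).exp (hexp t))
      (Filter.Eventually.of_forall fun h => ?_)
    have := hP t h
    have hstep := integral_exp_mul_le (ν := roundLaw μ S (σ t h)) (hD t).of_uncurry_left
      (hM t h) (h0 t h) (h2 t h) hl hlM
    have hrw : ∀ o, Real.exp (pathSum G (Fin.snoc h o : History X (t + 1))) =
        Real.exp (pathSum G h - l ^ 2 * V t h) * Real.exp (l * D t h o) := fun o => by
      rw [pathSum_snoc, ← Real.exp_add]
      congr 1
      simp only [hGdef]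
      ring
    simp only [hrw]
    rw [integral_const_mul]
    refine (mul_le_mul_of_nonneg_left hstep (Real.exp_pos _).le).trans_eq ?_
    rw [← Real.exp_add, sub_add_cancel]

/-- Freedman's inequality at a fixed tilt `l`. The bound involves the random sum of the `V i`, so no
a priori bound on the total variance is needed. -/
theorem Regular.measureReal_pathSum_le (hσ : Regular μ S σ)
    {D : (i : ℕ) → History X i → Round X → ℝ} (hD : ∀ i, Measurable (Function.uncurry (D i)))
    {V : (i : ℕ) → History X i → ℝ} (hV : ∀ i, Measurable (V i))
    {M l : ℝ} (hM : ∀ i h o, |D i h o| ≤ M) (hVM : ∀ i h, |V i h| ≤ M)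
    (h0 : ∀ i h, ∫ o, D i h o ∂(roundLaw μ S (σ i h)) = 0)
    (h2 : ∀ i h, ∫ o, D i h o ^ 2 ∂(roundLaw μ S (σ i h)) ≤ V i h)
    (hl : 0 < l) (hlM : l * M ≤ 1) (a : ℝ) (t : ℕ) :
    (historyLaw μ S σ t).real
      {h | l * pathSum (fun i g _ => V i g) h + a / l < pathSum D h} ≤ Real.exp (-a) := by
  have hPt := hσ.isProbabilityMeasure_historyLaw t
  set G : (i : ℕ) → History X i → Round X → ℝ := fun i g o => l * D i g o - l ^ 2 * V i g
    with hGdef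
  have hG : ∀ i, Measurable (Function.uncurry (G i)) := fun i =>
    ((hD i).const_mul l).sub (((hV i).comp measurable_fst).const_mul (l ^ 2))
  have hC : ∀ i h o, |G i h o| ≤ l * M + l ^ 2 * M := fun i h o => by
    refine (abs_sub _ _).trans ?_
    rw [abs_mul, abs_mul, abs_of_nonneg hl.le, abs_of_nonneg (sq_nonneg l)]
    gcongr
    · exact hM i h o
    · exact hVM i h
  have hint : Integrable (fun h => Real.exp (pathSum G h)) (historyLaw μ S σ t) :=
    integrable_of_measurable_of_abs_le (measurable_pathSum hG t).exp
      (C := Real.exp (t * (l * M + l ^ 2 * M))) fun h => by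
        rw [abs_of_pos (Real.exp_pos _)]
        exact Real.exp_le_exp.2 ((le_abs_self _).trans (abs_pathSum_le hC h))
  have hmarkov := mul_meas_ge_le_integral_of_nonneg
    (Filter.Eventually.of_forall fun h => (Real.exp_pos (pathSum G h)).le) hint (Real.exp a)
  have hle := hmarkov.trans
    (hσ.integral_exp_pathSum_le hD hV hM hVM h0 h2 hl.le hlM t)
  have hsub : {h | l * pathSum (fun i g _ => V i g) h + a / l < pathSum D h} ⊆
      {h : History X t | Real.exp a ≤ Real.exp (pathSum G h)} := by
    intro h hh
    have hh' : l * pathSum (fun i g _ => V i g) h + a / l < pathSum D h := hh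
    have e : pathSum G h = l * pathSum D h - l ^ 2 * pathSum (fun i g _ => V i g) h := by
      simp only [pathSum, hGdef, Finset.sum_sub_distrib, Finset.mul_sum]
    change Real.exp a ≤ Real.exp (pathSum G h)
    rw [Real.exp_le_exp, e]
    have := mul_lt_mul_of_pos_left hh' hl
    rw [mul_add, mul_div_cancel₀ _ hl.ne'] at this
    nlinarith
  have hmono := measureReal_mono (μ := historyLaw μ S σ t) hsub
  rw [Real.exp_neg, ← one_div, le_div_iff₀' (Real.exp_pos a)]
  exact (mul_le_mul_of_nonneg_left hmono (Real.exp_pos a).le).trans hle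

end Martingale

/-! ### Mixtures of policies -/

/-- The law of a round with context `x` and action `a`. -/
noncomputable def outcomeLaw (S : Demand X) (x : X) (a : Act) : Measure (Round X) :=
  ENNReal.ofReal (saleProb S x a) • Measure.dirac (x, a, true) +
    ENNReal.ofReal (1 - saleProb S x a) • Measure.dirac (x, a, false)

/-- The expectation of `F` in a round with context `x` and action `a`. -/
def outcomeMean {X : Type*} (S : Demand X) (F : Round X → ℝ) (x : X) (a : Act) : ℝ :=
  saleProb S x a * F (x, a, true) + (1 - saleProb S x a) * F (x, a, false)

theorem saleProb_nonneg {X : Type*} (S : Demand X) (x : X) (a : Act) : 0 ≤ saleProb S x a := by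
  rcases a with p | u
  · exact (S x p).2.1
  · exact le_rfl

theorem saleProb_le_one {X : Type*} (S : Demand X) (x : X) (a : Act) : saleProb S x a ≤ 1 := by
  rcases a with p | u
  · exact (S x p).2.2
  · exact zero_le_one

theorem price_nonneg (a : Act) : 0 ≤ price a := by
  rcases a with p | u
  · exact p.2.1
  · exact le_rfl

theorem price_le_one (a : Act) : price a ≤ 1 := by
  rcases a with p | u
  · exact p.2.2
  · exact zero_le_one

theorem measurable_price : Measurable price :=
  measurable_subtype_coe.sumElim measurable_const

/-- A Lipschitz demand is jointly measurable in context and action. -/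
theorem measurable_saleProb {S : Demand X} (hS : ∀ p, Measurable fun x => S x p) {L : ℝ}
    (hL : LipschitzDemand S L) : Measurable fun q : X × Act => saleProb S q.1 q.2 := by
  have hc : ∀ x, Continuous fun p => S x p := fun x => by
    refine continuous_induced_rng.2 ?_
    have : LipschitzWith (Real.toNNReal |L|) fun p => (S x p : ℝ) :=
      LipschitzWith.of_dist_le_mul fun p q => by
        rw [Real.dist_eq, Subtype.dist_eq, Real.dist_eq, Real.coe_toNNReal _ (abs_nonneg L)]
        exact (hL x p q).trans (mul_le_mul_of_nonneg_right (le_abs_self L) (abs_nonneg _))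
    exact this.continuous
  have h1 := measurable_uncurry_of_continuous_of_measurable (u := fun p x => S x p) hc hS
  have h2 : Measurable (Sum.elim (fun q : X × unitInterval => (S q.1 q.2 : ℝ))
      (fun _ : X × Unit => (0 : ℝ))) :=
    (measurable_subtype_coe.comp (h1.comp measurable_swap)).sumElim measurable_const
  convert h2.comp (MeasurableEquiv.prodSumDistrib X unitInterval Unit).measurable using 1
  funext ⟨x, a⟩
  rcases a with p | u <;> rfl

theorem isProbabilityMeasure_outcomeLaw (S : Demand X) (x : X) (a : Act) :
    IsProbabilityMeasure (outcomeLaw S x a) := by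
  constructor
  simp only [outcomeLaw, Measure.coe_add, Measure.coe_smul, Pi.add_apply, Pi.smul_apply,
    measure_univ, smul_eq_mul, mul_one]
  rw [← ENNReal.ofReal_add (saleProb_nonneg _ _ _) (by linarith [saleProb_le_one S x a])]
  simp

theorem integral_outcomeLaw (S : Demand X) (x : X) (a : Act) {F : Round X → ℝ}
    (hF : Measurable F) {C : ℝ} (hC : ∀ o, |F o| ≤ C) :
    ∫ o, F o ∂(outcomeLaw S x a) = outcomeMean S F x a := by
  have hi : ∀ o, Integrable F (Measure.dirac o) := fun o =>
    integrable_of_measurable_of_abs_le hF hC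
  rw [outcomeLaw, integral_add_measure ((hi _).smul_measure ENNReal.ofReal_ne_top)
    ((hi _).smul_measure ENNReal.ofReal_ne_top), integral_smul_measure, integral_smul_measure,
    integral_dirac' _ _ hF.stronglyMeasurable, integral_dirac' _ _ hF.stronglyMeasurable,
    ENNReal.toReal_ofReal (saleProb_nonneg _ _ _),
    ENNReal.toReal_ofReal (by linarith [saleProb_le_one S x a])]
  rfl

theorem measurable_outcomeLaw {S : Demand X}
    (hS : Measurable fun q : X × Act => saleProb S q.1 q.2) :
    Measurable fun q : X × Act => outcomeLaw S q.1 q.2 := by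
  refine Measure.measurable_of_measurable_coe _ fun A hA => ?_
  simp only [outcomeLaw, Measure.coe_add, Measure.coe_smul, Pi.add_apply, Pi.smul_apply,
    smul_eq_mul]
  have hd : ∀ b : Bool, Measurable fun q : X × Act =>
      (Measure.dirac ((q.1, q.2, b) : Round X)) A := fun b =>
    (Measure.measurable_coe hA).comp (Measure.measurable_dirac.comp (by fun_prop))
  exact (hS.ennreal_ofReal.mul (hd true)).add
    ((measurable_const.sub hS).ennreal_ofReal.mul (hd false))

/-- Weights of a mixture: nonnegative, summing to one. -/
structure IsMixture {J : Type*} (s : Finset J) (w : J → ℝ) : Prop where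
  nonneg : ∀ j ∈ s, 0 ≤ w j
  sum_eq_one : ∑ j ∈ s, w j = 1

section Mix

variable {J : Type*} (s : Finset J) (f : J → X → Act) {S : Demand X}

theorem sum_smul_apply {J α : Type*} [MeasurableSpace α] (s : Finset J) (c : J → ENNReal)
    (ν : J → Measure α) (A : Set α) : (∑ j ∈ s, c j • ν j) A = ∑ j ∈ s, c j * ν j A := by
  simp [Measure.finsetSum_apply]

theorem roundLaw_mixture (μ : Measure X)
    (hS : Measurable fun q : X × Act => saleProb S q.1 q.2) (w : J → X → ℝ) :
    roundLaw μ S (fun x => ∑ j ∈ s, ENNReal.ofReal (w j x) • Measure.dirac (f j x)) =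
      μ.bind fun x => ∑ j ∈ s, ENNReal.ofReal (w j x) • outcomeLaw S x (f j x) := by
  unfold roundLaw
  congr 1
  funext x
  have hm : Measurable fun a => outcomeLaw S x a :=
    (measurable_outcomeLaw hS).comp (f := fun a => (x, a)) measurable_prodMk_left
  change (∑ j ∈ s, ENNReal.ofReal (w j x) • Measure.dirac (f j x)).bind
    (fun a => outcomeLaw S x a) = _
  ext A hA
  have hmA : Measurable fun a => outcomeLaw S x a A :=
    (Measure.measurable_coe hA).comp (f := fun a => outcomeLaw S x a) hm
  rw [Measure.bind_apply hA hm.aemeasurable, lintegral_finsetSum_measure, sum_smul_apply]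
  refine Finset.sum_congr rfl fun j _ => ?_
  rw [lintegral_smul_measure, lintegral_dirac' _ hmA, smul_eq_mul]

variable {H : Type*} [MeasurableSpace H] {w : J → H → X → ℝ}

theorem measurable_mixture (hS : Measurable fun q : X × Act => saleProb S q.1 q.2)
    (hf : ∀ j ∈ s, Measurable (f j)) (hw : ∀ j ∈ s, Measurable fun q : H × X => w j q.1 q.2) :
    Measurable fun q : H × X =>
      ∑ j ∈ s, ENNReal.ofReal (w j q.1 q.2) • outcomeLaw S q.2 (f j q.2) := by
  refine Measure.measurable_of_measurable_coe _ fun A hA => ?_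
  simp only [sum_smul_apply]
  refine Finset.measurable_fun_sum _ fun j hj => (hw j hj).ennreal_ofReal.mul ?_
  have h1 : Measurable fun q : X × Act => outcomeLaw S q.1 q.2 A :=
    (Measure.measurable_coe hA).comp (f := fun q : X × Act => outcomeLaw S q.1 q.2)
      (measurable_outcomeLaw hS)
  have h2 : Measurable fun q : H × X => (q.2, f j q.2) :=
    measurable_snd.prodMk ((hf j hj).comp measurable_snd)
  exact h1.comp (f := fun q : H × X => (q.2, f j q.2)) h2

theorem isProbabilityMeasure_mixture {w : J → ℝ} (hw1 : IsMixture s w) (x : X) :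
    IsProbabilityMeasure (∑ j ∈ s, ENNReal.ofReal (w j) • outcomeLaw S x (f j x)) := by
  constructor
  have : ∀ j, outcomeLaw S x (f j x) Set.univ = 1 := fun j =>
    (isProbabilityMeasure_outcomeLaw S x (f j x)).measure_univ
  simp only [sum_smul_apply, this, mul_one]
  rw [← ENNReal.ofReal_sum_of_nonneg hw1.nonneg, hw1.sum_eq_one, ENNReal.ofReal_one]

theorem measurable_roundLaw_mixture (μ : Measure X) [IsProbabilityMeasure μ]
    (hS : Measurable fun q : X × Act => saleProb S q.1 q.2)
    (hf : ∀ j ∈ s, Measurable (f j)) (hw : ∀ j ∈ s, Measurable fun q : H × X => w j q.1 q.2) :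
    Measurable fun h => roundLaw μ S
      (fun x => ∑ j ∈ s, ENNReal.ofReal (w j h x) • Measure.dirac (f j x)) := by
  have hm := measurable_mixture s f hS hf hw
  have hm1 : ∀ h, Measurable fun x => ∑ j ∈ s, ENNReal.ofReal (w j h x) • outcomeLaw S x (f j x) :=
    fun h => hm.comp (f := fun x => (h, x)) measurable_prodMk_left
  refine Measure.measurable_of_measurable_coe _ fun A hA => ?_
  have : ∀ h, roundLaw μ S
      (fun x => ∑ j ∈ s, ENNReal.ofReal (w j h x) • Measure.dirac (f j x)) A =
      ∫⁻ x, (∑ j ∈ s, ENNReal.ofReal (w j h x) • outcomeLaw S x (f j x)) A ∂μ := fun h => by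
    rw [roundLaw_mixture s f μ hS (fun j x => w j h x), Measure.bind_apply hA (hm1 h).aemeasurable]
  simp only [this]
  have hmA : Measurable fun q : H × X =>
      (∑ j ∈ s, ENNReal.ofReal (w j q.1 q.2) • outcomeLaw S q.2 (f j q.2)) A :=
    (Measure.measurable_coe hA).comp hm
  exact hmA.lintegral_prod_right'

theorem isProbabilityMeasure_roundLaw_mixture (μ : Measure X) [IsProbabilityMeasure μ]
    (hS : Measurable fun q : X × Act => saleProb S q.1 q.2)
    (hf : ∀ j ∈ s, Measurable (f j)) {w : J → X → ℝ} (hw : ∀ j ∈ s, Measurable (w j))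
    (hw1 : ∀ x, IsMixture s fun j => w j x) :
    IsProbabilityMeasure (roundLaw μ S
      (fun x => ∑ j ∈ s, ENNReal.ofReal (w j x) • Measure.dirac (f j x))) := by
  rw [roundLaw_mixture s f μ hS w]
  have hm : Measurable fun x => ∑ j ∈ s, ENNReal.ofReal (w j x) • outcomeLaw S x (f j x) :=
    (measurable_mixture (H := Unit) (w := fun j _ x => w j x) s f hS hf
      (fun j hj => (hw j hj).comp measurable_snd)).comp (f := fun x => ((), x))
      measurable_prodMk_left
  exact isProbabilityMeasure_bind hm fun x => isProbabilityMeasure_mixture s f (hw1 x) x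

/-- The expectation over one round in which a mixture of policies is played. -/
theorem integral_roundLaw_mixture (μ : Measure X) [IsProbabilityMeasure μ]
    (hS : Measurable fun q : X × Act => saleProb S q.1 q.2)
    (hf : ∀ j ∈ s, Measurable (f j)) {w : J → X → ℝ} (hw : ∀ j ∈ s, Measurable (w j))
    (hw1 : ∀ x, IsMixture s fun j => w j x) {F : Round X → ℝ}
    (hF : Measurable F) {C : ℝ} (hC : ∀ o, |F o| ≤ C) :
    ∫ o, F o ∂(roundLaw μ S
      (fun x => ∑ j ∈ s, ENNReal.ofReal (w j x) • Measure.dirac (f j x))) =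
      ∫ x, ∑ j ∈ s, w j x * outcomeMean S F x (f j x) ∂μ := by
  have hm : Measurable fun x => ∑ j ∈ s, ENNReal.ofReal (w j x) • outcomeLaw S x (f j x) :=
    (measurable_mixture (H := Unit) (w := fun j _ x => w j x) s f hS hf
      (fun j hj => (hw j hj).comp measurable_snd)).comp (f := fun x => ((), x))
      measurable_prodMk_left
  rw [roundLaw_mixture s f μ hS w, integral_bind_of_abs_le hm
    (fun x => isProbabilityMeasure_mixture s f (hw1 x) x) hF hC]
  congr 1
  funext x
  have hi : ∀ j, Integrable F (outcomeLaw S x (f j x)) := fun j => by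
    have := isProbabilityMeasure_outcomeLaw S x (f j x)
    exact integrable_of_measurable_of_abs_le hF hC
  rw [integral_finsetSum_measure fun j _ => (hi j).smul_measure ENNReal.ofReal_ne_top]
  refine Finset.sum_congr rfl fun j hj => ?_
  rw [integral_smul_measure, ENNReal.toReal_ofReal ((hw1 x).nonneg j hj),
    integral_outcomeLaw S x _ hF hC, smul_eq_mul]

end Mix

/-! ### Basic facts about the algorithm's input -/

theorem measurableSet_eq_act {α : Type*} [MeasurableSpace α] {f g : α → Act} (hf : Measurable f)
    (hg : Measurable g) : MeasurableSet {a | f a = g a} := by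
  -- an injective measurable encoding of actions by real numbers
  let e : Act → ℝ := Sum.elim (fun p => (p : ℝ)) (fun _ => 2)
  have he : Measurable e := measurable_subtype_coe.sumElim measurable_const
  have hinj : Function.Injective e := by
    rintro (p | u) (q | v) h
    · exact congrArg _ (Subtype.ext h)
    · have h1 : (p : ℝ) = 2 := h
      linarith [p.2.2]
    · have h1 : (2 : ℝ) = q := h
      linarith [q.2.2]
    · rfl
  have : {a | f a = g a} = {a | e (f a) = e (g a)} := by
    ext a
    exact hinj.eq_iff.symm
  rw [this]
  exact measurableSet_eq_fun (he.comp hf) (he.comp hg)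

namespace Input

/-- The standing assumptions on the input of CBalance: the context law is a probability measure,
there is at least one round, and the policies are measurable and use the given prices only. -/
structure Proper (I : Input X) : Prop where
  isProbabilityMeasure : IsProbabilityMeasure I.contextLaw
  one_le_T : 1 ≤ I.T
  measurable_policies : ∀ π ∈ I.policies, Measurable π
  mem_prices : ∀ π ∈ I.policies, ∀ x, π x ∈ I.prices
  radConst_pos : 0 < I.radConst

variable {I : Input X}

theorem skip_mem_acts (I : Input X) : Sum.inr () ∈ I.acts := by
  classical exact Finset.mem_insert_self _ _

theorem inl_mem_acts {p : unitInterval} (hp : p ∈ I.prices) : Sum.inl p ∈ I.acts := by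
  classical exact Finset.mem_insert_of_mem (Finset.mem_image_of_mem _ hp)

theorem skip_mem_cands (I : Input X) : (fun _ => Sum.inr ()) ∈ I.cands := by
  classical exact Finset.mem_insert_self _ _

theorem inl_mem_cands {π : X → unitInterval} (hπ : π ∈ I.policies) :
    (fun x => Sum.inl (π x)) ∈ I.cands := by
  classical exact Finset.mem_insert_of_mem (Finset.mem_image_of_mem _ hπ)

theorem cands_cases (π : I.cands) :
    π.1 = (fun _ => Sum.inr ()) ∨ ∃ π' ∈ I.policies, π.1 = fun x => Sum.inl (π' x) := by
  classical
  obtain ⟨π, hπ⟩ := π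
  rcases Finset.mem_insert.1 hπ with rfl | h
  · exact Or.inl rfl
  · obtain ⟨π', h', rfl⟩ := Finset.mem_image.1 h
    exact Or.inr ⟨π', h', rfl⟩

theorem one_le_numActs (I : Input X) : 1 ≤ I.numActs := by
  have : 1 ≤ I.acts.card := Finset.card_pos.2 ⟨_, I.skip_mem_acts⟩
  unfold numActs
  exact_mod_cast this

theorem numActs_pos (I : Input X) : 0 < I.numActs := zero_lt_one.trans_le I.one_le_numActs

theorem one_le_card_cands (I : Input X) : (1 : ℝ) ≤ I.cands.card := by
  have : 0 < I.cands.card := Finset.card_pos.2 ⟨_, I.skip_mem_cands⟩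
  exact_mod_cast this

theorem Proper.mem_acts (hI : I.Proper) (π : I.cands) (x : X) : π.1 x ∈ I.acts := by
  rcases cands_cases π with h | ⟨π', h', h⟩
  · rw [h]
    exact I.skip_mem_acts
  · rw [h]
    exact inl_mem_acts (hI.mem_prices π' h' x)

theorem Proper.measurable_cands (hI : I.Proper) (π : I.cands) : Measurable π.1 := by
  rcases cands_cases π with h | ⟨π', h', h⟩
  · rw [h]
    exact measurable_const
  · rw [h]
    exact measurable_inl.comp (hI.measurable_policies π' h')

/-- The null policy as a candidate. -/
def nullPolicy (I : Input X) : I.cands := ⟨fun _ => Sum.inr (), I.skip_mem_cands⟩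

theorem Proper.one_le_T' (hI : I.Proper) : (1 : ℝ) ≤ I.T := by exact_mod_cast hI.one_le_T

theorem Proper.two_le_arg (hI : I.Proper) : 2 ≤ 2 * I.numActs * I.T * I.cands.card := by
  have h1 := one_le_mul_of_one_le_of_one_le I.one_le_numActs hI.one_le_T'
  have h2 := one_le_mul_of_one_le_of_one_le h1 I.one_le_card_cands
  linarith

theorem Proper.exp_logTerm (hI : I.Proper) :
    Real.exp I.logTerm = 2 * I.numActs * I.T * I.cands.card :=
  Real.exp_log (by linarith [hI.two_le_arg])

theorem Proper.half_le_logTerm (hI : I.Proper) : 1 / 2 ≤ I.logTerm := by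
  have := Real.log_le_log (by norm_num) hI.two_le_arg
  have h2 := Real.log_two_gt_d9
  unfold logTerm
  linarith

theorem Proper.logTerm_pos (hI : I.Proper) : 0 < I.logTerm := by linarith [hI.half_le_logTerm]

theorem noise_le_half (I : Input X) : I.noise ≤ 1 / 2 := min_le_left _ _

theorem Proper.inv_le_noise (hI : I.Proper) : 1 / (2 * I.T) ≤ I.noise := by
  have hT := hI.one_le_T'
  refine le_min ?_ (Real.le_sqrt_of_sq_le ?_)
  · rw [div_le_div_iff₀ (by positivity) two_pos]
    linarith
  · have h1 : 1 / 2 ≤ I.numActs * I.logTerm := by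
      nlinarith [I.one_le_numActs, hI.half_le_logTerm]
    rw [div_pow, div_le_div_iff₀ (by positivity) (by positivity)]
    nlinarith

theorem Proper.noise_pos (hI : I.Proper) : 0 < I.noise := by
  have hT := hI.one_le_T'
  exact lt_of_lt_of_le (by positivity) hI.inv_le_noise

theorem Proper.one_le_maxWeight (hI : I.Proper) : 1 ≤ I.numActs / I.noise := by
  rw [le_div_iff₀ hI.noise_pos]
  linarith [I.noise_le_half, I.one_le_numActs]

theorem Proper.floor_pos (hI : I.Proper) : 0 < I.noise / I.numActs :=
  div_pos hI.noise_pos I.numActs_pos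

section Noisy

variable {P : I.cands → ℝ}

theorem Proper.floor_le_noisy (_hI : I.Proper) (hP : P ∈ stdSimplex ℝ I.cands) (x : X)
    (a : Act) : I.noise / I.numActs ≤ I.noisy P x a := by
  unfold noisy
  have h1 : 0 ≤ 1 - I.noise := by linarith [I.noise_le_half]
  have : 0 ≤ (1 - I.noise) * (∑ π : I.cands, open Classical in if π.1 x = a then P π else 0) :=
    mul_nonneg h1 (Finset.sum_nonneg fun π _ => by
      split_ifs
      · exact hP.1 π
      · exact le_rfl)
  linarith

theorem Proper.noisy_pos (hI : I.Proper) (hP : P ∈ stdSimplex ℝ I.cands) (x : X)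
    (a : Act) : 0 < I.noisy P x a :=
  hI.floor_pos.trans_le (hI.floor_le_noisy hP x a)

theorem Proper.inv_noisy_le (hI : I.Proper) (hP : P ∈ stdSimplex ℝ I.cands) (x : X)
    (a : Act) : 1 / I.noisy P x a ≤ I.numActs / I.noise := by
  rw [← one_div_div I.noise]
  exact one_div_le_one_div_of_le hI.floor_pos (hI.floor_le_noisy hP x a)

theorem Proper.sum_acts_mul_ite (hI : I.Proper) (Q : I.cands → ℝ) (x : X) (g : Act → ℝ) :
    ∑ a ∈ I.acts, (∑ π : I.cands, open Classical in if π.1 x = a then Q π else 0) * g a =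
      ∑ π : I.cands, Q π * g (π.1 x) := by
  classical
  simp only [Finset.sum_mul]
  rw [Finset.sum_comm]
  refine Finset.sum_congr rfl fun π _ => ?_
  rw [Finset.sum_eq_single (π.1 x)]
  · simp
  · intro a _ ha
    rw [if_neg ha.symm, zero_mul]
  · intro h
    exact absurd (hI.mem_acts π x) h

theorem Proper.isMixture_noisy (hI : I.Proper) (hP : P ∈ stdSimplex ℝ I.cands) (x : X) :
    IsMixture I.acts fun a => I.noisy P x a := by
  refine ⟨fun a _ => (hI.noisy_pos hP x a).le, ?_⟩
  have h := hI.sum_acts_mul_ite P x fun _ => 1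
  simp only [mul_one] at h
  have hP1 : ∑ π, P π = 1 := hP.2
  have hK : (I.acts.card : ℝ) = I.numActs := rfl
  simp only [noisy, Finset.sum_add_distrib, ← Finset.mul_sum, h, hP1, Finset.sum_const,
    nsmul_eq_mul, hK]
  rw [mul_div_cancel₀ _ I.numActs_pos.ne']
  ring

theorem Proper.noisy_le_one (hI : I.Proper) (hP : P ∈ stdSimplex ℝ I.cands) (x : X) {a : Act}
    (ha : a ∈ I.acts) : I.noisy P x a ≤ 1 := by
  have h := hI.isMixture_noisy hP x
  rw [← h.sum_eq_one]
  exact Finset.single_le_sum (f := fun a => I.noisy P x a) h.nonneg ha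

theorem Proper.measurable_noisy (hI : I.Proper) :
    Measurable fun q : (I.cands → ℝ) × X × Act => I.noisy q.1 q.2.1 q.2.2 := by
  unfold noisy
  refine ((Finset.measurable_fun_sum _ fun π _ => ?_).const_mul _).add_const _
  refine Measurable.ite (measurableSet_eq_act ?_ ?_) ?_ measurable_const
  · exact (hI.measurable_cands π).comp (measurable_fst.comp measurable_snd)
  · exact measurable_snd.comp measurable_snd
  · exact (measurable_pi_apply π).comp measurable_fst

/-- The law of a round in which the noisy version of `P` is played. -/
noncomputable def noisyLaw (I : Input X) (S : Demand X) (P : I.cands → ℝ) : Measure (Round X) :=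
  roundLaw I.contextLaw S fun x => ∑ a ∈ I.acts, ENNReal.ofReal (I.noisy P x a) • Measure.dirac a

theorem Proper.measurable_noisy_left (hI : I.Proper) (P : I.cands → ℝ) (a : Act) :
    Measurable fun x => I.noisy P x a :=
  hI.measurable_noisy.comp (f := fun x => (P, x, a)) (by fun_prop)

variable {S : Demand X}

theorem Proper.isProbabilityMeasure_noisyLaw (hI : I.Proper)
    (hS : Measurable fun q : X × Act => saleProb S q.1 q.2) (hP : P ∈ stdSimplex ℝ I.cands) :
    IsProbabilityMeasure (I.noisyLaw S P) := by
  have := hI.isProbabilityMeasure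
  exact isProbabilityMeasure_roundLaw_mixture I.acts (fun a _ => a) _ hS
    (fun _ _ => measurable_const) (fun a _ => hI.measurable_noisy_left P a)
    (fun x => hI.isMixture_noisy hP x)

theorem Proper.integral_noisyLaw (hI : I.Proper)
    (hS : Measurable fun q : X × Act => saleProb S q.1 q.2) (hP : P ∈ stdSimplex ℝ I.cands)
    {F : Round X → ℝ} (hF : Measurable F) {C : ℝ} (hC : ∀ o, |F o| ≤ C) :
    ∫ o, F o ∂(I.noisyLaw S P) =
      ∫ x, ∑ a ∈ I.acts, I.noisy P x a * outcomeMean S F x a ∂I.contextLaw := by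
  have := hI.isProbabilityMeasure
  exact integral_roundLaw_mixture I.acts (fun a _ => a) _ hS
    (fun _ _ => measurable_const) (fun a _ => hI.measurable_noisy_left P a)
    (fun x => hI.isMixture_noisy hP x) hF hC

theorem Proper.regular_strategy (hI : I.Proper)
    (hS : Measurable fun q : X × Act => saleProb S q.1 q.2) {ρ : I.MixtureRule}
    (hρ : ∀ t, Measurable (ρ t)) (hρ' : ∀ t h, ρ t h ∈ stdSimplex ℝ I.cands) :
    Regular I.contextLaw S ρ.strategy := by
  have := hI.isProbabilityMeasure
  refine ⟨fun t => ?_, fun t h => hI.isProbabilityMeasure_noisyLaw hS (hρ' t h)⟩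
  refine measurable_roundLaw_mixture (w := fun a h x => I.noisy (ρ t h) x a) I.acts
    (fun a _ => a) I.contextLaw hS (fun _ _ => measurable_const) fun a _ => ?_
  exact hI.measurable_noisy.comp (f := fun q : History X t × X => (ρ t q.1, q.2, a))
    (((hρ t).comp measurable_fst).prodMk (measurable_snd.prodMk measurable_const))

/-! ### Inverse propensity scores -/

/-- The expectation of the payoff `g` of the action of `π`, collected when an item is sold. With
`g = price` this is the expected revenue, with `g = 1` the expected consumption. -/
noncomputable def policyMean (I : Input X) (S : Demand X) (g : Act → ℝ) (π : I.cands) : ℝ :=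
  ∫ x, saleProb S x (π.1 x) * g (π.1 x) ∂I.contextLaw

open Classical in
/-- The inverse propensity score of `π` in a round in which the noisy version of `P` is played. -/
noncomputable def score (I : Input X) (g : Act → ℝ) (π : I.cands) (P : I.cands → ℝ)
    (o : Round X) : ℝ :=
  (if o.2.1 = π.1 o.1 then 1 / I.noisy P o.1 o.2.1 else 0) * (if o.2.2 = true then g o.2.1 else 0)

/-- The expectation of `1 / P'(π(x) | x)`, which bounds the conditional second moment of `score` for
payoffs in `[0,1]`. -/
noncomputable def scoreVar (I : Input X) (π : I.cands) (P : I.cands → ℝ) : ℝ :=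
  ∫ x, 1 / I.noisy P x (π.1 x) ∂I.contextLaw

variable {g : Act → ℝ}

theorem Proper.measurable_score (hI : I.Proper) (hg : Measurable g) (π : I.cands) :
    Measurable (Function.uncurry (I.score g π)) := by
  unfold score
  refine Measurable.mul ?_ ?_
  · refine Measurable.ite (measurableSet_eq_act ?_ ?_) ?_ measurable_const
    · fun_prop
    · exact (hI.measurable_cands π).comp (by fun_prop)
    · refine Measurable.div measurable_const ?_
      exact hI.measurable_noisy.comp
        (f := fun p : (I.cands → ℝ) × Round X => (p.1, p.2.1, p.2.2.1)) (by fun_prop)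
  · refine Measurable.ite ?_ (hg.comp (by fun_prop)) measurable_const
    exact measurableSet_eq_fun (by fun_prop) measurable_const

theorem Proper.score_nonneg (hI : I.Proper) (hP : P ∈ stdSimplex ℝ I.cands)
    (hg0 : ∀ a, 0 ≤ g a) (π : I.cands) (o : Round X) : 0 ≤ I.score g π P o := by
  unfold score
  refine mul_nonneg ?_ ?_
  · split_ifs
    · exact one_div_nonneg.2 (hI.noisy_pos hP _ _).le
    · exact le_rfl
  · split_ifs
    · exact hg0 _
    · exact le_rfl

theorem Proper.score_le (hI : I.Proper) (hP : P ∈ stdSimplex ℝ I.cands)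
    (hg0 : ∀ a, 0 ≤ g a) (hg1 : ∀ a, g a ≤ 1) (π : I.cands) (o : Round X) :
    I.score g π P o ≤ I.numActs / I.noise := by
  have hM := hI.one_le_maxWeight
  unfold score
  rw [← mul_one (I.numActs / I.noise)]
  refine mul_le_mul ?_ ?_ ?_ (by linarith)
  · split_ifs
    · exact hI.inv_noisy_le hP _ _
    · linarith
  · split_ifs
    · exact hg1 _
    · exact zero_le_one
  · split_ifs
    · exact hg0 _
    · exact le_rfl

theorem Proper.abs_score_le (hI : I.Proper) (hP : P ∈ stdSimplex ℝ I.cands)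
    (hg0 : ∀ a, 0 ≤ g a) (hg1 : ∀ a, g a ≤ 1) (π : I.cands) (o : Round X) :
    |I.score g π P o| ≤ I.numActs / I.noise := by
  rw [abs_of_nonneg (hI.score_nonneg hP hg0 π o)]
  exact hI.score_le hP hg0 hg1 π o

theorem Proper.measurable_policyMean_integrand (hI : I.Proper)
    (hS : Measurable fun q : X × Act => saleProb S q.1 q.2) (hg : Measurable g) (π : I.cands) :
    Measurable fun x => saleProb S x (π.1 x) * g (π.1 x) :=
  (hS.comp (f := fun x => (x, π.1 x)) (measurable_id.prodMk (hI.measurable_cands π))).mul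
    (hg.comp (hI.measurable_cands π))

theorem policyMean_integrand_mem (hg0 : ∀ a, 0 ≤ g a) (hg1 : ∀ a, g a ≤ 1) (π : I.cands) (x : X) :
    saleProb S x (π.1 x) * g (π.1 x) ∈ Set.Icc (0 : ℝ) 1 :=
  ⟨mul_nonneg (saleProb_nonneg _ _ _) (hg0 _),
    mul_le_one₀ (saleProb_le_one _ _ _) (hg0 _) (hg1 _)⟩

theorem Proper.integrable_policyMean (hI : I.Proper)
    (hS : Measurable fun q : X × Act => saleProb S q.1 q.2) (hg : Measurable g)
    (hg0 : ∀ a, 0 ≤ g a) (hg1 : ∀ a, g a ≤ 1) (π : I.cands) :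
    Integrable (fun x => saleProb S x (π.1 x) * g (π.1 x)) I.contextLaw := by
  have := hI.isProbabilityMeasure
  refine integrable_of_measurable_of_abs_le (hI.measurable_policyMean_integrand hS hg π) (C := 1)
    fun x => ?_
  have h := policyMean_integrand_mem (S := S) hg0 hg1 π x
  rw [abs_of_nonneg h.1]
  exact h.2

theorem Proper.policyMean_mem (hI : I.Proper)
    (hS : Measurable fun q : X × Act => saleProb S q.1 q.2) (hg : Measurable g)
    (hg0 : ∀ a, 0 ≤ g a) (hg1 : ∀ a, g a ≤ 1) (π : I.cands) :
    I.policyMean S g π ∈ Set.Icc (0 : ℝ) 1 := by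
  have := hI.isProbabilityMeasure
  refine ⟨integral_nonneg fun x => (policyMean_integrand_mem hg0 hg1 π x).1, ?_⟩
  have h := integral_mono (hI.integrable_policyMean hS hg hg0 hg1 π) (integrable_const (1 : ℝ))
    fun x => (policyMean_integrand_mem (S := S) hg0 hg1 π x).2
  simpa [policyMean] using h

/-- The inverse propensity score is unbiased. -/
theorem Proper.integral_score (hI : I.Proper)
    (hS : Measurable fun q : X × Act => saleProb S q.1 q.2) (hP : P ∈ stdSimplex ℝ I.cands)
    (hg : Measurable g) (hg0 : ∀ a, 0 ≤ g a) (hg1 : ∀ a, g a ≤ 1) (π : I.cands) :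
    ∫ o, I.score g π P o ∂(I.noisyLaw S P) = I.policyMean S g π := by
  rw [hI.integral_noisyLaw hS hP (hI.measurable_score hg π).of_uncurry_left
    (hI.abs_score_le hP hg0 hg1 π)]
  unfold policyMean
  congr 1
  funext x
  rw [Finset.sum_eq_single (π.1 x)]
  · have := (hI.noisy_pos hP x (π.1 x)).ne'
    simp only [outcomeMean, score, if_true]
    field_simp
    simp
  · intro a _ ha
    simp [outcomeMean, score, ha]
  · intro h
    exact absurd (hI.mem_acts π x) h

theorem Proper.measurable_inv_noisy (hI : I.Proper) (π : I.cands) (P : I.cands → ℝ) :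
    Measurable fun x => 1 / I.noisy P x (π.1 x) := by
  refine Measurable.div measurable_const (hI.measurable_noisy.comp (f := fun x => (P, x, π.1 x)) ?_)
  exact measurable_const.prodMk (measurable_id.prodMk (hI.measurable_cands π))

theorem Proper.abs_inv_noisy_le (hI : I.Proper) (hP : P ∈ stdSimplex ℝ I.cands) (x : X)
    (a : Act) : |1 / I.noisy P x a| ≤ I.numActs / I.noise := by
  rw [abs_of_nonneg (one_div_nonneg.2 (hI.noisy_pos hP x a).le)]
  exact hI.inv_noisy_le hP x a

theorem Proper.integrable_inv_noisy (hI : I.Proper) (hP : P ∈ stdSimplex ℝ I.cands)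
    (π : I.cands) : Integrable (fun x => 1 / I.noisy P x (π.1 x)) I.contextLaw := by
  have := hI.isProbabilityMeasure
  exact integrable_of_measurable_of_abs_le (hI.measurable_inv_noisy π P)
    fun x => hI.abs_inv_noisy_le hP x _

theorem Proper.scoreVar_nonneg (hI : I.Proper) (hP : P ∈ stdSimplex ℝ I.cands) (π : I.cands) :
    0 ≤ I.scoreVar π P :=
  integral_nonneg fun _ => one_div_nonneg.2 (hI.noisy_pos hP _ _).le

theorem Proper.abs_scoreVar_le (hI : I.Proper) (hP : P ∈ stdSimplex ℝ I.cands) (π : I.cands) :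
    |I.scoreVar π P| ≤ I.numActs / I.noise := by
  have := hI.isProbabilityMeasure
  exact abs_integral_le_of_abs_le fun x => hI.abs_inv_noisy_le hP x _

theorem Proper.measurable_scoreVar (hI : I.Proper) (π : I.cands) : Measurable (I.scoreVar π) := by
  have := hI.isProbabilityMeasure
  refine measurable_integral_of_abs_le (k := fun _ => I.contextLaw) measurable_const
    (fun _ => inferInstance) (F := fun P x => 1 / I.noisy P x (π.1 x)) ?_
  refine Measurable.div measurable_const (hI.measurable_noisy.comp
    (f := fun q : (I.cands → ℝ) × X => (q.1, q.2, π.1 q.2)) ?_)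
  exact measurable_fst.prodMk (measurable_snd.prodMk
    ((hI.measurable_cands π).comp measurable_snd))

theorem Proper.integral_score_sq_le (hI : I.Proper)
    (hS : Measurable fun q : X × Act => saleProb S q.1 q.2) (hP : P ∈ stdSimplex ℝ I.cands)
    (hg : Measurable g) (hg0 : ∀ a, 0 ≤ g a) (hg1 : ∀ a, g a ≤ 1) (π : I.cands) :
    ∫ o, I.score g π P o ^ 2 ∂(I.noisyLaw S P) ≤ I.scoreVar π P := by
  rw [hI.integral_noisyLaw hS hP ((hI.measurable_score hg π).of_uncurry_left.pow_const 2)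
    (C := (I.numActs / I.noise) ^ 2) fun o => by
      rw [abs_pow]
      exact pow_le_pow_left₀ (abs_nonneg _) (hI.abs_score_le hP hg0 hg1 π o) 2]
  have he : ∀ x, ∑ a ∈ I.acts, I.noisy P x a * outcomeMean S (fun o => I.score g π P o ^ 2) x a =
      saleProb S x (π.1 x) * g (π.1 x) ^ 2 * (1 / I.noisy P x (π.1 x)) := fun x => by
    rw [Finset.sum_eq_single (π.1 x)]
    · have := (hI.noisy_pos hP x (π.1 x)).ne'
      simp only [outcomeMean, score, if_true]
      field_simp
      simp
    · intro a _ ha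
      simp [outcomeMean, score, ha]
    · intro h
      exact absurd (hI.mem_acts π x) h
  simp only [he]
  refine integral_mono_of_nonneg (Filter.Eventually.of_forall fun x => ?_)
    (hI.integrable_inv_noisy hP π) (Filter.Eventually.of_forall fun x => ?_)
  · exact mul_nonneg (mul_nonneg (saleProb_nonneg _ _ _) (sq_nonneg _))
      (one_div_nonneg.2 (hI.noisy_pos hP _ _).le)
  · refine mul_le_of_le_one_left (one_div_nonneg.2 (hI.noisy_pos hP _ _).le) ?_
    exact mul_le_one₀ (saleProb_le_one _ _ _) (sq_nonneg _) (pow_le_one₀ (hg0 _) (hg1 _))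

end Noisy

end Input

namespace Input

variable {I : Input X}

/-! ### Concentration of the estimates -/

theorem estReward_eq (ρ : I.MixtureRule) {s : ℕ} (h : History X s) (π : I.cands) :
    estReward ρ h π = pathSum (fun i g o => I.score price π (ρ i g) o) h / s := rfl

theorem estSales_eq (ρ : I.MixtureRule) {s : ℕ} (h : History X s) (π : I.cands) :
    estSales ρ h π = pathSum (fun i g o => I.score (fun _ => 1) π (ρ i g) o) h / s := rfl

theorem varProxy_eq (ρ : I.MixtureRule) {s : ℕ} (h : History X s) (π : I.cands) :
    varProxy ρ h π = pathSum (fun i g _ => I.scoreVar π (ρ i g)) h / s := rfl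

/-- The expected per-round outcomes of the policies under the demand `S`. -/
noncomputable def trueOutcomes (I : Input X) (S : Demand X) : I.Outcomes where
  reward := I.policyMean S price
  sales := I.policyMean S fun _ => 1

/-- The deviation of the score from its mean, with a sign. -/
noncomputable def deviation (I : Input X) (S : Demand X) (ρ : I.MixtureRule) (g : Act → ℝ)
    (e : ℝ) (π : I.cands) (i : ℕ) (h : History X i) (o : Round X) : ℝ :=
  e * (I.score g π (ρ i h) o - I.policyMean S g π)

variable {S : Demand X} {ρ : I.MixtureRule} {g : Act → ℝ}

theorem pathSum_deviation (e : ℝ) (π : I.cands) {s : ℕ} (h : History X s) :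
    pathSum (I.deviation S ρ g e π) h =
      e * (pathSum (fun i g' o => I.score g π (ρ i g') o) h - s * I.policyMean S g π) := by
  simp [pathSum, deviation, ← Finset.mul_sum, Finset.sum_sub_distrib]

/-- The event that the bound of `Regular.measureReal_pathSum_le` with tilt `1 / n` is violated after
`s` rounds. -/
def tailEvent (S : Demand X) (ρ : I.MixtureRule) (g : Act → ℝ) (e : ℝ) (π : I.cands) (n : ℕ)
    (a : ℝ) (s : ℕ) : Set (History X s) :=
  {h | 1 / (n : ℝ) * pathSum (fun i g' _ => I.scoreVar π (ρ i g')) h + a / (1 / (n : ℝ)) <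
    pathSum (I.deviation S ρ g e π) h}

theorem Proper.measurable_deviation (hI : I.Proper) (hρ : ∀ t, Measurable (ρ t))
    (hg : Measurable g) (e : ℝ) (π : I.cands) (i : ℕ) :
    Measurable (Function.uncurry (I.deviation S ρ g e π i)) := by
  unfold deviation
  refine Measurable.const_mul (Measurable.sub_const ?_ _) _
  exact (hI.measurable_score hg π).comp (f := fun q : History X i × Round X => (ρ i q.1, q.2))
    (((hρ i).comp measurable_fst).prodMk measurable_snd)

theorem Proper.measurable_scoreVar_comp (hI : I.Proper) (hρ : ∀ t, Measurable (ρ t))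
    (π : I.cands) (i : ℕ) : Measurable fun h : History X i => I.scoreVar π (ρ i h) :=
  (hI.measurable_scoreVar π).comp (hρ i)

theorem Proper.measurableSet_tailEvent (hI : I.Proper) (hρ : ∀ t, Measurable (ρ t))
    (hg : Measurable g) (e : ℝ) (π : I.cands) (n : ℕ) (a : ℝ) (s : ℕ) :
    MeasurableSet (tailEvent S ρ g e π n a s) :=
  measurableSet_lt (((measurable_pathSum (G := fun i g' _ => I.scoreVar π (ρ i g')) (fun i =>
    (hI.measurable_scoreVar_comp hρ π i).comp measurable_fst) s).const_mul _).add_const _)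
    (measurable_pathSum (hI.measurable_deviation hρ hg e π) s)

theorem Proper.measureReal_tailEvent_le (hI : I.Proper)
    (hS : Measurable fun q : X × Act => saleProb S q.1 q.2) (hρ : ∀ t, Measurable (ρ t))
    (hρ' : ∀ t h, ρ t h ∈ stdSimplex ℝ I.cands) (hg : Measurable g)
    (hg0 : ∀ a, 0 ≤ g a) (hg1 : ∀ a, g a ≤ 1) {e : ℝ} (he : |e| = 1) (π : I.cands) {n : ℕ}
    (hn : I.numActs / I.noise ≤ n) (a : ℝ) (s : ℕ) :
    (historyLaw I.contextLaw S ρ.strategy s).real (tailEvent S ρ g e π n a s) ≤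
      Real.exp (-a) := by
  have hσ := hI.regular_strategy hS hρ hρ'
  have hM := hI.one_le_maxWeight
  have hm := hI.policyMean_mem hS hg hg0 hg1 π
  have hn0 : (0 : ℝ) < n := by linarith
  have he2 : e ^ 2 = 1 := by rw [← sq_abs, he, one_pow]
  refine hσ.measureReal_pathSum_le (V := fun i h => I.scoreVar π (ρ i h))
    (M := I.numActs / I.noise) (hI.measurable_deviation hρ hg e π)
    (hI.measurable_scoreVar_comp hρ π) ?_ (fun i h => hI.abs_scoreVar_le (hρ' i h) π)
    ?_ ?_ (by positivity) ?_ a s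
  · intro i h o
    have h0 := hI.score_nonneg (hρ' i h) hg0 π o
    have h1 := hI.score_le (hρ' i h) hg0 hg1 π o
    rw [deviation, abs_mul, he, one_mul, abs_le]
    constructor <;> linarith [hm.1, hm.2]
  · intro i h
    have := hI.isProbabilityMeasure_noisyLaw hS (hρ' i h)
    have hi : Integrable (I.score g π (ρ i h)) (I.noisyLaw S (ρ i h)) :=
      integrable_of_measurable_of_abs_le (hI.measurable_score hg π).of_uncurry_left
        (hI.abs_score_le (hρ' i h) hg0 hg1 π)
    change ∫ o, e * (I.score g π (ρ i h) o - I.policyMean S g π) ∂(I.noisyLaw S (ρ i h)) = 0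
    rw [integral_const_mul, integral_sub hi (integrable_const _),
      hI.integral_score hS (hρ' i h) hg hg0 hg1 π]
    simp
  · intro i h
    have := hI.isProbabilityMeasure_noisyLaw hS (hρ' i h)
    have hi : Integrable (I.score g π (ρ i h)) (I.noisyLaw S (ρ i h)) :=
      integrable_of_measurable_of_abs_le (hI.measurable_score hg π).of_uncurry_left
        (hI.abs_score_le (hρ' i h) hg0 hg1 π)
    have hi2 : Integrable (fun o => I.score g π (ρ i h) o ^ 2) (I.noisyLaw S (ρ i h)) :=
      integrable_of_measurable_of_abs_le
        ((hI.measurable_score hg π).of_uncurry_left.pow_const 2)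
        (C := (I.numActs / I.noise) ^ 2) fun o => by
          rw [abs_pow]
          exact pow_le_pow_left₀ (abs_nonneg _) (hI.abs_score_le (hρ' i h) hg0 hg1 π o) 2
    change ∫ o, (e * (I.score g π (ρ i h) o - I.policyMean S g π)) ^ 2
      ∂(I.noisyLaw S (ρ i h)) ≤ I.scoreVar π (ρ i h)
    have hexp : ∀ o, (e * (I.score g π (ρ i h) o - I.policyMean S g π)) ^ 2 =
        I.score g π (ρ i h) o ^ 2 - 2 * I.policyMean S g π * I.score g π (ρ i h) o +
          I.policyMean S g π ^ 2 := fun o => by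
      rw [mul_pow, he2]
      ring
    have hi3 : Integrable (fun o => I.score g π (ρ i h) o ^ 2 -
        2 * I.policyMean S g π * I.score g π (ρ i h) o) (I.noisyLaw S (ρ i h)) :=
      hi2.sub (hi.const_mul _)
    simp only [hexp]
    rw [integral_add hi3 (integrable_const _), integral_sub hi2 (hi.const_mul _),
      integral_const_mul,
      hI.integral_score hS (hρ' i h) hg hg0 hg1 π]
    have := hI.integral_score_sq_le hS (hρ' i h) hg hg0 hg1 π
    simp only [integral_const, probReal_univ, one_smul]
    nlinarith [sq_nonneg (I.policyMean S g π)]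
  · rw [one_div, inv_mul_le_iff₀ hn0, mul_one]
    exact hn

/-- Optimizing the tilt `1 / n` over the integers turns the tilted tail bounds into a
Bernstein-type bound with the realized variance `V`. -/
theorem le_of_forall_tilt {V D a M : ℝ} {N : ℕ} (hV : 0 ≤ V) (ha : 0 < a) (hM : 1 ≤ M)
    (hN : M + √(V / a) + 1 ≤ N)
    (h : ∀ n : ℕ, M ≤ n → n ≤ N → D ≤ 1 / (n : ℝ) * V + a / (1 / (n : ℝ))) :
    D ≤ √(4 * a * V) + 4 * a * M := by
  set r := √(V / a) with hr
  have hr0 : 0 ≤ r := Real.sqrt_nonneg _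
  have hrV : a * r ^ 2 = V := by
    rw [hr, Real.sq_sqrt (by positivity)]
    field_simp
  set x := max M r
  have hx1 : M ≤ x := le_max_left _ _
  have hx2 : r ≤ x := le_max_right _ _
  have hxle : x ≤ M + r := max_le (by linarith) (by linarith)
  have hx0 : 0 < x := by linarith
  have hn1 : x ≤ ⌈x⌉₊ := Nat.le_ceil x
  have hn2 : (⌈x⌉₊ : ℝ) < x + 1 := Nat.ceil_lt_add_one hx0.le
  have hnN : ⌈x⌉₊ ≤ N := by
    have : (⌈x⌉₊ : ℝ) ≤ N := by linarith
    exact_mod_cast this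
  have hD := h ⌈x⌉₊ (hx1.trans hn1) hnN
  have hn0 : (0 : ℝ) < ⌈x⌉₊ := by linarith
  have h1 : 1 / (⌈x⌉₊ : ℝ) * V ≤ a * r := by
    rw [one_div, inv_mul_le_iff₀ hn0, ← hrV]
    nlinarith [mul_nonneg ha.le hr0]
  have h2 : a / (1 / (⌈x⌉₊ : ℝ)) ≤ a * (M + r + 1) := by
    rw [div_div_eq_mul_div, div_one]
    exact mul_le_mul_of_nonneg_left (by linarith) ha.le
  have h3 : √(4 * a * V) = 2 * (a * r) := by
    rw [← hrV, show 4 * a * (a * r ^ 2) = (2 * (a * r)) ^ 2 by ring]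
    exact Real.sqrt_sq (by positivity)
  rw [h3]
  nlinarith

/-- The payoffs that are estimated: the revenue and the number of items sold. -/
def payoff (b : Bool) : Act → ℝ := if b then price else fun _ => 1

theorem measurable_payoff (b : Bool) : Measurable (payoff b) := by
  cases b
  · exact measurable_const
  · exact measurable_price

theorem payoff_nonneg (b : Bool) (a : Act) : 0 ≤ payoff b a := by
  cases b
  · exact zero_le_one
  · exact price_nonneg a

theorem payoff_le_one (b : Bool) (a : Act) : payoff b a ≤ 1 := by
  cases b
  · exact le_rfl
  · exact price_le_one a

/-- The sign encoded by a Boolean. -/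
def signOf (b : Bool) : ℝ := if b then 1 else -1

theorem abs_signOf (b : Bool) : |signOf b| = 1 := by cases b <;> simp [signOf]

/-- The largest integer `n` for which the tilt `1 / n` is used. It is about twice
`(2 K T |Π'|)²`: large enough to approximate the optimal tilt, small enough for a union bound. -/
noncomputable def tiltBound (I : Input X) : ℕ := ⌊2 * Real.exp (2 * I.logTerm)⌋₊

open Classical in
/-- The event that some tilted tail bound fails in the course of the `I.T` rounds: the union is over
the number of rounds, the candidates, revenue or sales, the sign of the deviation, and the tilts
`1 / n` that are small enough for Freedman's inequality. -/
def failure (S : Demand X) (ρ : I.MixtureRule) : Set (History X I.T) :=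
  ⋃ q ∈ (Finset.univ : Finset (Fin (I.T) × I.cands × Bool × Bool)) ×ˢ
      ((Finset.Icc 1 I.tiltBound).filter fun n : ℕ => I.numActs / I.noise ≤ n),
    (fun h : History X I.T => h.take (q.1.1 + 1) q.1.1.2) ⁻¹'
      tailEvent S ρ (payoff q.1.2.2.1) (signOf q.1.2.2.2) q.1.2.1 q.2 (8 * I.logTerm) (q.1.1 + 1)

theorem Proper.measurableSet_failure (hI : I.Proper) (hρ : ∀ t, Measurable (ρ t)) :
    MeasurableSet (failure S ρ) :=
  Finset.measurableSet_biUnion _ fun _ _ => measurable_take _ _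
    (hI.measurableSet_tailEvent hρ (measurable_payoff _) _ _ _ _ _)

theorem Proper.measureReal_failure_le (hI : I.Proper)
    (hS : Measurable fun q : X × Act => saleProb S q.1 q.2) (hρ : ∀ t, Measurable (ρ t))
    (hρ' : ∀ t h, ρ t h ∈ stdSimplex ℝ I.cands) :
    (historyLaw I.contextLaw S ρ.strategy I.T).real (failure S ρ) ≤ 1 / I.T := by
  classical
  have hσ := hI.regular_strategy hS hρ hρ'
  have hT := hI.one_le_T'
  have hW := hI.exp_logTerm
  have hW2 := hI.two_le_arg
  rw [← hW] at hW2
  set W := Real.exp I.logTerm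
  have hKT := one_le_mul_of_one_le_of_one_le I.one_le_numActs I.one_le_card_cands
  have hTW : (I.T : ℝ) ≤ W := by rw [hW]; nlinarith [I.one_le_numActs, I.one_le_card_cands]
  have hTNW : (I.T : ℝ) * I.cands.card * 2 ≤ W := by
    rw [hW]
    have : 0 ≤ (I.T : ℝ) * I.cands.card := by positivity
    nlinarith [I.one_le_numActs]
  refine (measureReal_biUnion_finset_le _ _).trans ?_
  have hterm : ∀ q ∈ (Finset.univ : Finset (Fin (I.T) × I.cands × Bool × Bool)) ×ˢ
      ((Finset.Icc 1 I.tiltBound).filter fun n : ℕ => I.numActs / I.noise ≤ n),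
      (historyLaw I.contextLaw S ρ.strategy I.T).real
        ((fun h : History X I.T => h.take (q.1.1 + 1) q.1.1.2) ⁻¹'
        tailEvent S ρ (payoff q.1.2.2.1) (signOf q.1.2.2.2) q.1.2.1 q.2 (8 * I.logTerm)
          (q.1.1 + 1)) ≤ Real.exp (-(8 * I.logTerm)) := by
    intro q hq
    have hq2 := (Finset.mem_filter.1 (Finset.mem_product.1 hq).2).2
    rw [← map_measureReal_apply (measurable_take _ _)
      (hI.measurableSet_tailEvent hρ (measurable_payoff _) _ _ _ _ _), hσ.map_take]
    exact hI.measureReal_tailEvent_le hS hρ hρ' (measurable_payoff _) (payoff_nonneg _)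
      (payoff_le_one _) (abs_signOf _) _ hq2 _ _
  refine (Finset.sum_le_card_nsmul _ _ _ hterm).trans ?_
  have hcard : (((Finset.univ : Finset (Fin (I.T) × I.cands × Bool × Bool)) ×ˢ
      ((Finset.Icc 1 I.tiltBound).filter fun n : ℕ => I.numActs / I.noise ≤ n)).card : ℝ) ≤
      4 * W ^ 3 := by
    have h1 : ((Finset.Icc 1 I.tiltBound).filter fun n : ℕ => I.numActs / I.noise ≤ n).card ≤
        I.tiltBound := (Finset.card_filter_le _ _).trans (by simp)
    have h2 : (I.tiltBound : ℝ) ≤ 2 * W ^ 2 := by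
      refine (Nat.floor_le (by positivity)).trans (le_of_eq ?_)
      rw [two_mul I.logTerm, Real.exp_add]
      ring
    rw [Finset.card_product]
    simp only [Finset.card_univ, Fintype.card_prod, Fintype.card_fin, Fintype.card_coe,
      Fintype.card_bool]
    push_cast
    have h3 : (((Finset.Icc 1 I.tiltBound).filter
        fun n : ℕ => I.numActs / I.noise ≤ n).card : ℝ) ≤ 2 * W ^ 2 :=
      le_trans (by exact_mod_cast h1) h2
    refine (mul_le_mul_of_nonneg_left h3 (by positivity)).trans ?_
    calc _ = (I.T * I.cands.card * 2) * (4 * W ^ 2) := by ring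
      _ ≤ W * (4 * W ^ 2) := mul_le_mul_of_nonneg_right hTNW (by positivity)
      _ = _ := by ring
  have hW0 : 0 < W := by linarith
  have hexp : Real.exp (-(8 * I.logTerm)) = 1 / W ^ 8 := by
    rw [Real.exp_neg, show 8 * I.logTerm = ((8 : ℕ) : ℝ) * I.logTerm by norm_num,
      Real.exp_nat_mul, one_div]
  rw [nsmul_eq_mul, hexp]
  calc _ ≤ 4 * W ^ 3 * (1 / W ^ 8) := mul_le_mul_of_nonneg_right hcard (by positivity)
    _ = (4 / W ^ 4) * (1 / W) := by field_simp
    _ ≤ 1 * (1 / W) := by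
        refine mul_le_mul_of_nonneg_right ?_ (by positivity)
        rw [div_le_one (by positivity)]
        nlinarith [pow_le_pow_left₀ zero_le_two hW2 4]
    _ ≤ 1 / I.T := by
        rw [one_mul]
        exact one_div_le_one_div_of_le (by linarith) hTW

theorem Proper.trueOutcomes_feasible (hI : I.Proper)
    (hS : Measurable fun q : X × Act => saleProb S q.1 q.2) : (I.trueOutcomes S).Feasible := by
  intro π
  refine ⟨hI.policyMean_mem hS (measurable_payoff true) (payoff_nonneg true) (payoff_le_one true) π,
    hI.policyMean_mem hS (measurable_payoff false) (payoff_nonneg false) (payoff_le_one false) π,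
    fun h => ?_⟩
  simp [trueOutcomes, policyMean, h, saleProb]

theorem pathSum_scoreVar_nonneg (hI : I.Proper) (hρ' : ∀ t h, ρ t h ∈ stdSimplex ℝ I.cands)
    (π : I.cands) {s : ℕ} (h : History X s) :
    0 ≤ pathSum (fun i g' _ => I.scoreVar π (ρ i g')) h :=
  Finset.sum_nonneg fun _ _ => hI.scoreVar_nonneg (hρ' _ _) π

theorem pathSum_scoreVar_le (hI : I.Proper) (hρ' : ∀ t h, ρ t h ∈ stdSimplex ℝ I.cands)
    (π : I.cands) {s : ℕ} (h : History X s) :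
    pathSum (fun i g' _ => I.scoreVar π (ρ i g')) h ≤ s * (I.numActs / I.noise) :=
  (le_abs_self _).trans (abs_pathSum_le (fun i g' _ => hI.abs_scoreVar_le (hρ' i g') π) h)

/-- Outside the failure event every estimate is within the confidence radius. The constant `32` is
four times the exponent `8` (in units of `ℓ`) of the tail bounds, which has to survive the union
bound. -/
theorem Proper.abs_est_sub_le (hI : I.Proper) (hκ : I.radConst = 32)
    (hρ' : ∀ t h, ρ t h ∈ stdSimplex ℝ I.cands) {h : History X I.T} (hh : h ∉ failure S ρ)
    {s : ℕ} (hs : s ≤ I.T) (hs0 : 0 < s) (π : I.cands) (b : Bool) :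
    |pathSum (fun i g o => I.score (payoff b) π (ρ i g) o) (h.take s hs) / s -
      I.policyMean S (payoff b) π| ≤ radius ρ (h.take s hs) π := by
  classical
  have hT := hI.one_le_T'
  have hl := hI.half_le_logTerm
  have hM := hI.one_le_maxWeight
  have hs1 : (0 : ℝ) < s := by exact_mod_cast hs0
  set V := pathSum (fun i g' _ => I.scoreVar π (ρ i g')) (h.take s hs) with hVdef
  have hV0 : 0 ≤ V := pathSum_scoreVar_nonneg hI hρ' π _
  have hVle : V ≤ s * (I.numActs / I.noise) := pathSum_scoreVar_le hI hρ' π _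
  have hsT : (s : ℝ) ≤ I.T := by exact_mod_cast hs
  -- the tilts used include the nearly optimal one, since `V ≤ T K / q₀ ≤ 2 K T²`
  have hMW : I.numActs / I.noise ≤ 2 * I.numActs * I.T := by
    rw [div_le_iff₀ hI.noise_pos]
    have := hI.inv_le_noise
    rw [div_le_iff₀ (by positivity)] at this
    nlinarith [I.numActs_pos]
  have hN : I.numActs / I.noise + √(V / (8 * I.logTerm)) + 1 ≤ I.tiltBound := by
    have hexp : Real.exp (2 * I.logTerm) = (2 * I.numActs * I.T * I.cands.card) ^ 2 := by
      rw [two_mul I.logTerm, Real.exp_add, hI.exp_logTerm, sq]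
    have hfl := Nat.lt_floor_add_one (2 * Real.exp (2 * I.logTerm))
    have hsq : √(V / (8 * I.logTerm)) ≤ 2 * I.numActs * I.T := by
      refine Real.sqrt_le_iff.2 ⟨by have := I.numActs_pos; positivity, ?_⟩
      rw [div_le_iff₀ (by linarith)]
      have h1 : V ≤ I.T * (2 * I.numActs * I.T) :=
        hVle.trans (mul_le_mul hsT hMW (by linarith) (by linarith))
      have h2 : 0 ≤ I.T * (2 * I.numActs * I.T) := hV0.trans h1
      have h3 : (1:ℝ) ≤ 2 * I.numActs := by linarith [I.one_le_numActs]
      calc V ≤ I.T * (2 * I.numActs * I.T) := h1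
        _ ≤ I.T * (2 * I.numActs * I.T) * (2 * I.numActs * (8 * I.logTerm)) :=
            le_mul_of_one_le_right h2 (by nlinarith)
        _ = _ := by ring
    have hbig : 2 * I.numActs * I.T + 2 * I.numActs * I.T + 2 ≤ 2 * Real.exp (2 * I.logTerm) := by
      rw [hexp]
      have h1 : 2 ≤ 2 * I.numActs * I.T := by nlinarith [I.one_le_numActs]
      have h2 : 2 * I.numActs * I.T ≤ 2 * I.numActs * I.T * I.cands.card :=
        le_mul_of_one_le_right (by linarith) I.one_le_card_cands
      nlinarith
    unfold tiltBound
    linarith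
  have key : ∀ c : Bool, pathSum (I.deviation S ρ (payoff b) (signOf c) π) (h.take s hs) ≤
      √(4 * (8 * I.logTerm) * V) + 4 * (8 * I.logTerm) * (I.numActs / I.noise) := by
    intro c
    refine le_of_forall_tilt hV0 (by linarith) hM hN fun n hn1 hn2 => ?_
    by_contra hcon
    push Not at hcon
    refine hh (Set.mem_biUnion (x := ((⟨s - 1, by omega⟩, π, b, c), n)) ?_ ?_)
    · refine Finset.mem_product.2 ⟨Finset.mem_univ _, Finset.mem_filter.2
        ⟨Finset.mem_Icc.2 ⟨?_, hn2⟩, hn1⟩⟩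
      have : (1 : ℝ) ≤ n := hM.trans hn1
      exact_mod_cast this
    · obtain ⟨r, rfl⟩ : ∃ r, s = r + 1 := ⟨s - 1, by omega⟩
      exact hcon
  have hrad : s * radius ρ (h.take s hs) π =
      √(4 * (8 * I.logTerm) * V) + 4 * (8 * I.logTerm) * (I.numActs / I.noise) := by
    unfold radius
    rw [hκ, varProxy_eq, mul_add]
    congr 1
    · rw [← hVdef, mul_div_assoc', div_div, show 32 * I.logTerm * V / (s * s : ℝ) =
        (4 * (8 * I.logTerm) * V) / (s : ℝ) ^ 2 by ring, Real.sqrt_div' _ (sq_nonneg _),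
        Real.sqrt_sq hs1.le, mul_div_cancel₀ _ hs1.ne']
    · have := hI.noise_pos.ne'
      field_simp
      ring
  have k1 := key true
  have k2 := key false
  simp only [pathSum_deviation, signOf, if_true, one_mul, Bool.false_eq_true, if_false] at k1 k2
  rw [← hrad] at k1 k2
  rw [div_sub' hs1.ne', abs_div, abs_of_pos hs1, div_le_iff₀ hs1, abs_le]
  constructor <;> linarith

/-- Outside the failure event the true outcomes stay in the confidence region. -/
theorem Proper.trueOutcomes_mem_confRegion (hI : I.Proper) (hκ : I.radConst = 32)
    (hS : Measurable fun q : X × Act => saleProb S q.1 q.2)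
    (hρ' : ∀ t h, ρ t h ∈ stdSimplex ℝ I.cands) {h : History X I.T} (hh : h ∉ failure S ρ)
    {t : ℕ} (ht : t ≤ I.T) : I.trueOutcomes S ∈ confRegion ρ (h.take t ht) :=
  ⟨hI.trueOutcomes_feasible hS, fun _ hs hs0 π =>
    ⟨hI.abs_est_sub_le hκ hρ' hh (hs.trans ht) hs0 π true,
      hI.abs_est_sub_le hκ hρ' hh (hs.trans ht) hs0 π false⟩⟩

end Input

namespace Input

variable {I : Input X}

/-! ### Potentially perfect distributions -/

theorem Outcomes.Feasible.null {m : I.Outcomes} (hm : m.Feasible) :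
    m.reward I.nullPolicy = 0 ∧ m.sales I.nullPolicy = 0 :=
  (hm I.nullPolicy).2.2 rfl

theorem Proper.supplyRate_pos (hI : I.Proper) (hB : 0 < I.B) : 0 < (I.B : ℝ) / I.T := by
  have := hI.one_le_T'
  have : (0 : ℝ) < I.B := by exact_mod_cast hB
  positivity

theorem sum_mul_nonneg_of_mem {P f : I.cands → ℝ} (hP : P ∈ stdSimplex ℝ I.cands)
    (hf : ∀ π, 0 ≤ f π) : 0 ≤ ∑ π, P π * f π :=
  Finset.sum_nonneg fun π _ => mul_nonneg (hP.1 π) (hf π)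

theorem sum_mul_le_of_mem {P f : I.cands → ℝ} (hP : P ∈ stdSimplex ℝ I.cands) {c : ℝ}
    (hf : ∀ π, f π ≤ c) : ∑ π, P π * f π ≤ c := by
  calc ∑ π, P π * f π ≤ ∑ π, P π * c :=
        Finset.sum_le_sum fun π _ => mul_le_mul_of_nonneg_left (hf π) (hP.1 π)
    _ = c := by rw [← Finset.sum_mul, hP.2, one_mul]

theorem null_mem_stdSimplex [DecidableEq I.cands] :
    (Pi.single I.nullPolicy 1 : I.cands → ℝ) ∈ stdSimplex ℝ I.cands :=
  single_mem_stdSimplex ℝ _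

/-- An LP-perfect distribution beats every distribution `Q` up to the factor by which `Q` exceeds
the supply rate: `Q` becomes feasible when mixed with the null policy. -/
theorem Outcomes.LPPerfect.mul_le {m : I.Outcomes} (hm : m.Feasible)
    (hB : 0 < (I.B : ℝ) / I.T) {P : I.cands → ℝ} (hP : m.LPPerfect P) {Q : I.cands → ℝ}
    (hQ : Q ∈ stdSimplex ℝ I.cands) :
    (∑ π, Q π * m.reward π) * (I.B / I.T) ≤
      (∑ π, P π * m.reward π) * max (I.B / I.T : ℝ) (∑ π, Q π * m.sales π) := by
  classical
  rcases le_or_gt (∑ π, Q π * m.sales π) (I.B / I.T : ℝ) with h | h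
  · rw [max_eq_left h]
    exact mul_le_mul_of_nonneg_right (hP.2 Q ⟨hQ, h⟩) hB.le
  rw [max_eq_right h.le]
  set β : ℝ := I.B / I.T
  set c := ∑ π, Q π * m.sales π
  have hc : 0 < c := hB.trans h
  set s := β / c with hs
  have hs0 : 0 ≤ s := by positivity
  have hs1 : s ≤ 1 := by rw [hs, div_le_one hc]; exact h.le
  let N : I.cands → ℝ := Pi.single I.nullPolicy 1
  have hN : ∀ f : I.cands → ℝ, ∑ π, (s • Q + (1 - s) • N) π * f π =
      s * ∑ π, Q π * f π + (1 - s) * f I.nullPolicy := fun f => by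
    simp [N, Pi.single_apply, add_mul, Finset.sum_add_distrib, Finset.mul_sum, mul_assoc]
  have hmem : s • Q + (1 - s) • N ∈ stdSimplex ℝ I.cands :=
    convex_stdSimplex ℝ _ hQ null_mem_stdSimplex hs0 (by linarith) (by ring)
  have := hP.2 _ ⟨hmem, by
    rw [hN, hm.null.2, mul_zero, add_zero, hs, div_mul_cancel₀ _ hc.ne']⟩
  rw [hN, hm.null.1, mul_zero, add_zero, hs, div_mul_eq_mul_div, div_le_iff₀ hc] at this
  linarith

/-- LP-perfection as a family of closed conditions on the tuple and the distribution jointly. (In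
the definition, the range of the competitors `Q` depends on the tuple.) This needs a positive supply
rate. -/
theorem Outcomes.lpPerfect_iff {m : I.Outcomes} (hm : m.Feasible)
    (hB : 0 < (I.B : ℝ) / I.T) {P : I.cands → ℝ} :
    m.LPPerfect P ↔ P ∈ m.lpFeasible ∧ ∀ Q ∈ stdSimplex ℝ I.cands,
      (∑ π, Q π * m.reward π) * (I.B / I.T) ≤
        (∑ π, P π * m.reward π) * max (I.B / I.T : ℝ) (∑ π, Q π * m.sales π) := by
  refine ⟨fun h => ⟨h.1, fun Q hQ => h.mul_le hm hB hQ⟩, fun h => ⟨h.1, fun Q hQ => ?_⟩⟩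
  have := h.2 Q hQ.1
  rw [max_eq_left hQ.2] at this
  exact le_of_mul_le_mul_right this hB

theorem Outcomes.exists_lpPerfect {m : I.Outcomes} (hm : m.Feasible) : ∃ P, m.LPPerfect P := by
  classical
  have hcomp : IsCompact m.lpFeasible :=
    (isCompact_stdSimplex ℝ I.cands).inter_right
      (isClosed_le (f := fun P : I.cands → ℝ => ∑ π, P π * m.sales π) (by fun_prop)
        continuous_const)
  have hne : m.lpFeasible.Nonempty := ⟨Pi.single I.nullPolicy 1, null_mem_stdSimplex, by
    simp only [Pi.single_apply, ite_mul, one_mul, zero_mul, Finset.sum_ite_eq',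
      Finset.mem_univ, if_true, hm.null.2]
    positivity⟩
  obtain ⟨P, hP, hmax⟩ := hcomp.exists_isMaxOn hne
    (f := fun P : I.cands → ℝ => ∑ π, P π * m.reward π) (by fun_prop)
  exact ⟨P, hP, fun Q hQ => hmax hQ⟩

theorem confRegion_take {ρ : I.MixtureRule} {t : ℕ} {h : History X t} {m : I.Outcomes}
    (hm : m ∈ confRegion ρ h) {s : ℕ} (hs : s ≤ t) : m ∈ confRegion ρ (h.take s hs) :=
  ⟨hm.1, fun r hr => hm.2 r (hr.trans hs)⟩

theorem potentiallyPerfect_take {ρ : I.MixtureRule} {t : ℕ} {h : History X t} {P : I.cands → ℝ}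
    (hP : P ∈ potentiallyPerfect ρ h) {s : ℕ} (hs : s ≤ t) :
    P ∈ potentiallyPerfect ρ (h.take s hs) := by
  obtain ⟨m, hm, h⟩ := hP
  exact ⟨m, confRegion_take hm hs, h⟩

theorem potentiallyPerfect_subset (ρ : I.MixtureRule) {t : ℕ} (h : History X t) :
    potentiallyPerfect ρ h ⊆ stdSimplex ℝ I.cands := by
  rintro P ⟨m, -, hP⟩
  exact hP.1.1

/-- The bound on the average confidence radius of a potentially perfect distribution: the confidence
radius with `2 K` in place of the variance proxy. -/
noncomputable def avgRadius (I : Input X) (t : ℕ) : ℝ :=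
  √(I.radConst * I.logTerm * (2 * I.numActs) / t) +
    I.radConst * I.logTerm * I.numActs / (I.noise * t)

variable {ρ : I.MixtureRule}

theorem Proper.integral_sum_div_noisy (hI : I.Proper) {P : I.cands → ℝ}
    (hP : P ∈ stdSimplex ℝ I.cands) (Q : I.cands → ℝ) :
    ∫ x, ∑ π : I.cands, Q π / I.noisy P x (π.1 x) ∂I.contextLaw =
      ∑ π : I.cands, Q π * I.scoreVar π P := by
  simp only [div_eq_mul_one_div (Q _)]
  rw [integral_finsetSum _ fun π _ => (hI.integrable_inv_noisy hP π).const_mul _]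
  simp only [integral_const_mul, scoreVar]

/-- A potentially perfect distribution was potentially perfect in all earlier rounds, so the
distributions played there explored it: its average variance proxy is at most `2 K`. -/
theorem Proper.sum_varProxy_le (hI : I.Proper) (hρ : IsCBalance ρ) {t : ℕ} (ht : 0 < t)
    {h : History X t} {P : I.cands → ℝ} (hP : P ∈ potentiallyPerfect ρ h) :
    ∑ π, P π * varProxy ρ h π ≤ 2 * I.numActs := by
  have ht0 : (0 : ℝ) < t := by exact_mod_cast ht
  simp only [varProxy_eq, pathSum]
  calc ∑ π, P π * ((∑ i : Fin t, I.scoreVar π (ρ i (h.take i i.2.le))) / t)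
      = (∑ i : Fin t, ∑ π, P π * I.scoreVar π (ρ i (h.take i i.2.le))) / t := by
        rw [Finset.sum_comm, Finset.sum_div]
        refine Finset.sum_congr rfl fun π _ => ?_
        rw [← Finset.mul_sum, mul_div_assoc]
    _ ≤ (∑ _i : Fin t, 2 * I.numActs) / t := by
        refine div_le_div_of_nonneg_right (Finset.sum_le_sum fun i _ => ?_) ht0.le
        have hPi := potentiallyPerfect_take hP i.2.le
        have := hρ.balanced i (h.take i i.2.le) ⟨P, hPi⟩ P (subset_convexHull ℝ _ hPi)
        rwa [hI.integral_sum_div_noisy (hρ.mem_stdSimplex _ _)] at this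
    _ = 2 * I.numActs := by
        simp only [Finset.sum_const, Finset.card_univ, Fintype.card_fin, nsmul_eq_mul]
        field_simp

theorem Proper.sum_radius_le (hI : I.Proper) (hρ : IsCBalance ρ) {t : ℕ} (ht : 0 < t)
    {h : History X t} {P : I.cands → ℝ} (hP : P ∈ potentiallyPerfect ρ h) :
    ∑ π, P π * radius ρ h π ≤ I.avgRadius t := by
  have ht0 : (0 : ℝ) < t := by exact_mod_cast ht
  have hPs := potentiallyPerfect_subset ρ h hP
  have ha : 0 ≤ I.radConst * I.logTerm := mul_nonneg hI.radConst_pos.le hI.logTerm_pos.le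
  have hV : ∀ π, 0 ≤ varProxy ρ h π := fun π =>
    div_nonneg (pathSum_scoreVar_nonneg hI hρ.mem_stdSimplex π h) ht0.le
  unfold radius avgRadius
  simp only [mul_add, Finset.sum_add_distrib, ← Finset.sum_mul, hPs.2, one_mul]
  gcongr
  have hj := Real.strictConcaveOn_sqrt.concaveOn.le_map_sum (t := Finset.univ) (w := P)
    (p := fun π => I.radConst * I.logTerm * varProxy ρ h π / t) (fun π _ => hPs.1 π) hPs.2
    (fun π _ => Set.mem_Ici.2 (div_nonneg (mul_nonneg ha (hV π)) ht0.le))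
  simp only [smul_eq_mul] at hj
  refine hj.trans (Real.sqrt_le_sqrt ?_)
  have : ∑ π, P π * (I.radConst * I.logTerm * varProxy ρ h π / t) =
      I.radConst * I.logTerm * (∑ π, P π * varProxy ρ h π) / t := by
    rw [Finset.mul_sum, Finset.sum_div]
    refine Finset.sum_congr rfl fun π _ => ?_
    ring
  rw [this]
  gcongr
  exact hI.sum_varProxy_le hρ ht hP

/-- Under two tuples of the confidence region, a potentially perfect distribution has nearly the
same outcomes. -/
theorem Proper.abs_sum_sub_le (hI : I.Proper) (hρ : IsCBalance ρ) {t : ℕ} (ht : 0 < t)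
    {h : History X t} {P : I.cands → ℝ} (hP : P ∈ potentiallyPerfect ρ h) {m m' : I.Outcomes}
    (hm : m ∈ confRegion ρ h) (hm' : m' ∈ confRegion ρ h) :
    |∑ π, P π * m.reward π - ∑ π, P π * m'.reward π| ≤ 2 * I.avgRadius t ∧
    |∑ π, P π * m.sales π - ∑ π, P π * m'.sales π| ≤ 2 * I.avgRadius t := by
  have hPs := potentiallyPerfect_subset ρ h hP
  have key : ∀ f f' e : I.cands → ℝ, (∀ π, |e π - f π| ≤ radius ρ h π) →
      (∀ π, |e π - f' π| ≤ radius ρ h π) →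
      |∑ π, P π * f π - ∑ π, P π * f' π| ≤ 2 * I.avgRadius t := by
    intro f f' e h1 h2
    rw [← Finset.sum_sub_distrib]
    refine (Finset.abs_sum_le_sum_abs _ _).trans ?_
    calc ∑ π, |P π * f π - P π * f' π| ≤ ∑ π, 2 * (P π * radius ρ h π) := by
          refine Finset.sum_le_sum fun π _ => ?_
          rw [← mul_sub, abs_mul, abs_of_nonneg (hPs.1 π), mul_left_comm]
          refine mul_le_mul_of_nonneg_left ?_ (hPs.1 π)
          have a1 := abs_le.1 (h1 π)
          have a2 := abs_le.1 (h2 π)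
          rw [abs_le]
          constructor <;> linarith
      _ ≤ _ := by
          rw [← Finset.mul_sum]
          exact mul_le_mul_of_nonneg_left (hI.sum_radius_le hρ ht hP) zero_le_two
  have c1 := hm.2 t le_rfl ht
  have c2 := hm'.2 t le_rfl ht
  exact ⟨key _ _ _ (fun π => (c1 π).1) fun π => (c2 π).1,
    key _ _ _ (fun π => (c1 π).2) fun π => (c2 π).2⟩

theorem avgRadius_nonneg (hI : I.Proper) (t : ℕ) : 0 ≤ I.avgRadius t := by
  have := hI.radConst_pos
  have := hI.logTerm_pos
  have := I.numActs_pos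
  have := hI.noise_pos
  unfold avgRadius
  positivity

/-- The distribution played in round `t` is nearly optimal and nearly feasible for every tuple
`m` of the confidence region whose rewards do not exceed its sales. -/
theorem Proper.near_optimal (hI : I.Proper) (hB : 0 < I.B) (hρ : IsCBalance ρ) {t : ℕ}
    (ht : 0 < t) {h : History X t} {m : I.Outcomes} (hm : m ∈ confRegion ρ h)
    (hrc : ∀ π, m.reward π ≤ m.sales π) {Q : I.cands → ℝ} (hQ : m.LPPerfect Q) :
    ∑ π, Q π * m.reward π - 6 * I.avgRadius t ≤ ∑ π, ρ t h π * m.reward π ∧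
    ∑ π, ρ t h π * m.sales π ≤ I.B / I.T + 2 * I.avgRadius t := by
  have hβ := hI.supplyRate_pos hB
  have hr0 := avgRadius_nonneg hI t
  have hQΔ : Q ∈ potentiallyPerfect ρ h := ⟨m, hm, hQ⟩
  have hQβ : ∑ π, Q π * m.reward π ≤ (I.B / I.T : ℝ) := by
    refine le_trans (Finset.sum_le_sum fun π _ => ?_) hQ.1.2
    exact mul_le_mul_of_nonneg_left (hrc π) (hQ.1.1.1 π)
  set β : ℝ := I.B / I.T
  set r := I.avgRadius t
  have hconv : convexHull ℝ (potentiallyPerfect ρ h) ⊆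
      {P | ∑ π, Q π * m.reward π - 6 * r ≤ ∑ π, P π * m.reward π} ∩
      {P | ∑ π, P π * m.sales π ≤ β + 2 * r} := by
    refine convexHull_min ?_ ?_
    · rintro P hP
      obtain ⟨m', hm', hPm⟩ := id hP
      have a1 := hI.abs_sum_sub_le hρ ht hP hm hm'
      have a2 := hI.abs_sum_sub_le hρ ht hQΔ hm hm'
      have b1 := abs_le.1 a1.1
      have b2 := abs_le.1 a1.2
      have b3 := abs_le.1 a2.1
      have b4 := abs_le.1 a2.2
      have hle := hPm.mul_le hm'.1 hβ hQ.1.1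
      have hPc : ∑ π, P π * m'.sales π ≤ β := hPm.1.2
      have hQc : ∑ π, Q π * m.sales π ≤ β := hQ.1.2
      refine ⟨?_, ?_⟩
      · change ∑ π, Q π * m.reward π - 6 * r ≤ ∑ π, P π * m.reward π
        have hmax : max β (∑ π, Q π * m'.sales π) ≤ β + 2 * r := max_le (by linarith) (by linarith)
        have hP0 : 0 ≤ ∑ π, P π * m'.reward π :=
          sum_mul_nonneg_of_mem hPm.1.1 fun π => (hm'.1 π).1.1
        have h1 := hle.trans (mul_le_mul_of_nonneg_left hmax hP0)
        -- `(R - 4 r) (β + 2 r) ≤ (R - 2 r) β` because `R ≤ β`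
        have h2 : (∑ π, Q π * m.reward π - 2 * r) * β ≤
            (∑ π, P π * m'.reward π) * (β + 2 * r) :=
          (mul_le_mul_of_nonneg_right (by linarith) hβ.le).trans h1
        have h3 : (∑ π, Q π * m.reward π - 4 * r) * (β + 2 * r) ≤
            (∑ π, P π * m'.reward π) * (β + 2 * r) := by
          refine le_trans ?_ h2
          nlinarith
        have h4 := le_of_mul_le_mul_right h3 (by linarith)
        linarith
      · change ∑ π, P π * m.sales π ≤ β + 2 * r
        linarith
    · have lin : ∀ f : I.cands → ℝ, IsLinearMap ℝ fun P : I.cands → ℝ => ∑ π, P π * f π :=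
        fun f => ⟨fun x y => by simp [add_mul, Finset.sum_add_distrib],
          fun c x => by simp [Finset.mul_sum, mul_assoc]⟩
      exact (convex_halfSpace_ge (lin m.reward) _).inter (convex_halfSpace_le (lin m.sales) _)
  exact hconv (hρ.mem_convexHull t h ⟨Q, hQΔ⟩)

end Input

/-! ### Total reward along a history -/

section Paths

variable {X : Type*}

theorem salesUpTo_lt {t : ℕ} (h : History X t) {i j : Fin t} (hij : i < j)
    (hj : (h j).2.2 = true) : salesUpTo h i < salesUpTo h j := by
  refine Finset.card_lt_card (Finset.ssubset_iff_subset_ne.2 ⟨fun k hk => ?_, fun he => ?_⟩)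
  · rw [Finset.mem_filter] at hk ⊢
    exact ⟨hk.1, hk.2.1.trans hij.le, hk.2.2⟩
  · have : j ∈ Finset.univ.filter fun k : Fin t => k ≤ i ∧ (h k).2.2 = true := by
      rw [he]
      simp [hj]
    simp only [Finset.mem_filter] at this
    exact absurd this.2.1 (not_le.2 hij)

theorem salesUpTo_injOn {t : ℕ} (h : History X t) :
    Set.InjOn (salesUpTo h) {i | (h i).2.2 = true} := by
  intro i hi j hj hij
  rcases lt_trichotomy i j with hlt | rfl | hlt
  · exact absurd hij (salesUpTo_lt h hlt hj).ne
  · rfl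
  · exact absurd hij (salesUpTo_lt h hlt hi).ne'

/-- The number of items requested in a round: one for a sale. -/
def soldCount (o : Round X) : ℝ := if o.2.2 = true then 1 else 0

/-- What is earned in a round while supply lasts. -/
def revenue (o : Round X) : ℝ := if o.2.2 = true then price o.2.1 else 0

theorem sum_soldCount {t : ℕ} (h : History X t) :
    ∑ i, soldCount (h i) = (Finset.univ.filter fun i : Fin t => (h i).2.2 = true).card := by
  simp [soldCount]

theorem card_sold_after_le {t : ℕ} (B : ℕ) (h : History X t) :
    (Finset.univ.filter fun i : Fin t => (h i).2.2 = true ∧ B < salesUpTo h i).card ≤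
      (Finset.univ.filter fun i : Fin t => (h i).2.2 = true).card - B := by
  rw [← Nat.card_Ioc]
  refine Finset.card_le_card_of_injOn (salesUpTo h) (fun i hi => ?_) fun i hi j hj => ?_
  · simp only [Finset.coe_filter, Finset.mem_univ, true_and, Set.mem_ofPred_eq] at hi
    refine Finset.mem_coe.2 (Finset.mem_Ioc.2 ⟨hi.2, Finset.card_le_card fun k hk => ?_⟩)
    simp only [Finset.mem_filter] at hk ⊢
    exact ⟨hk.1, hk.2.2⟩
  · simp only [Finset.coe_filter, Finset.mem_univ, true_and, Set.mem_ofPred_eq] at hi hj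
    exact salesUpTo_injOn h hi.1 hj.1

theorem card_sold_before_le {t : ℕ} (B : ℕ) (h : History X t) :
    (Finset.univ.filter fun i : Fin t => (h i).2.2 = true ∧ salesUpTo h i ≤ B).card ≤ B := by
  have : (Finset.Ioc 0 B).card = B := by simp
  refine le_trans ?_ this.le
  refine Finset.card_le_card_of_injOn (salesUpTo h) (fun i hi => ?_) fun i hi j hj => ?_
  · simp only [Finset.coe_filter, Finset.mem_univ, true_and, Set.mem_ofPred_eq] at hi
    refine Finset.mem_coe.2 (Finset.mem_Ioc.2 ⟨Finset.card_pos.2 ⟨i, ?_⟩, hi.2⟩)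
    simp [hi.1]
  · simp only [Finset.coe_filter, Finset.mem_univ, true_and, Set.mem_ofPred_eq] at hi hj
    exact salesUpTo_injOn h hi.1 hj.1

/-- At most one unit of revenue is lost for every sale beyond the supply. -/
theorem sum_revenue_sub_le_totalReward {t : ℕ} (B : ℕ) (h : History X t) :
    ∑ i, revenue (h i) - max 0 (∑ i, soldCount (h i) - B) ≤ totalReward B h := by
  have h1 : ∑ i, revenue (h i) ≤ totalReward B h +
      ∑ i, if (h i).2.2 = true ∧ B < salesUpTo h i then (1 : ℝ) else 0 := by
    rw [totalReward, ← Finset.sum_add_distrib]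
    refine Finset.sum_le_sum fun i _ => ?_
    unfold revenue
    have := price_le_one (h i).2.1
    have := price_nonneg (h i).2.1
    by_cases hs : (h i).2.2 = true
    · rcases le_or_gt (salesUpTo h i) B with hle | hlt
      · simp [hs, hle, not_lt.2 hle]
      · simpa [hs, hlt, not_le.2 hlt] using price_le_one (h i).2.1
    · simp [hs]
  have h2 : (∑ i, if (h i).2.2 = true ∧ B < salesUpTo h i then (1 : ℝ) else 0) ≤
      max 0 (∑ i, soldCount (h i) - B) := by
    rw [sum_soldCount, Finset.sum_boole]
    refine le_trans (Nat.cast_le.2 (card_sold_after_le B h)) ?_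
    rcases le_total B (Finset.univ.filter fun i : Fin t => (h i).2.2 = true).card with hle | hle
    · rw [Nat.cast_sub hle]
      exact le_max_right _ _
    · rw [Nat.sub_eq_zero_of_le hle, Nat.cast_zero]
      exact le_max_left _ _
  linarith

theorem totalReward_nonneg {t : ℕ} (B : ℕ) (h : History X t) : 0 ≤ totalReward B h :=
  Finset.sum_nonneg fun i _ => by
    split_ifs
    · exact price_nonneg _
    · exact le_rfl

theorem totalReward_le_card {t : ℕ} (B : ℕ) (h : History X t) : totalReward B h ≤ B := by
  calc totalReward B h ≤ ∑ i, if (h i).2.2 = true ∧ salesUpTo h i ≤ B then (1 : ℝ) else 0 :=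
        Finset.sum_le_sum fun i _ => by
          split_ifs
          · exact price_le_one _
          · exact le_rfl
    _ ≤ B := by
        rw [Finset.sum_boole]
        exact_mod_cast card_sold_before_le B h

theorem totalReward_le_rounds {t : ℕ} (B : ℕ) (h : History X t) : totalReward B h ≤ t := by
  calc totalReward B h ≤ ∑ _i : Fin t, (1 : ℝ) :=
        Finset.sum_le_sum fun i _ => by
          split_ifs
          · exact price_le_one _
          · exact zero_le_one
    _ = t := by simp

end Paths

theorem measurable_bool_round : Measurable fun o : Round X => o.2.2 := by fun_prop

theorem measurableSet_sold (t : ℕ) (i : Fin t) :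
    MeasurableSet {h : History X t | (h i).2.2 = true} :=
  measurableSet_eq_fun (measurable_bool_round.comp (measurable_pi_apply i)) measurable_const

theorem measurable_salesUpTo (t : ℕ) (i : Fin t) :
    Measurable fun h : History X t => salesUpTo h i := by
  simp only [salesUpTo, Finset.card_filter]
  refine Finset.measurable_fun_sum _ fun j _ => Measurable.ite ?_ measurable_const measurable_const
  exact (MeasurableSet.const _).inter (measurableSet_sold t j)

theorem measurable_totalReward (B t : ℕ) : Measurable fun h : History X t => totalReward B h := by
  refine Finset.measurable_fun_sum _ fun i _ => Measurable.ite ?_ ?_ measurable_const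
  · exact (measurableSet_sold t i).inter (measurableSet_le (measurable_salesUpTo t i)
      measurable_const)
  · exact measurable_price.comp ((by fun_prop : Measurable fun o : Round X => o.2.1).comp
      (measurable_pi_apply i))

theorem abs_totalReward_le {X : Type*} {t : ℕ} (B : ℕ) (h : History X t) :
    |totalReward B h| ≤ t := by
  rw [abs_of_nonneg (totalReward_nonneg B h)]
  exact totalReward_le_rounds B h

namespace Input

variable {I : Input X} {S : Demand X} {ρ : I.MixtureRule}

/-! ### The reward of the algorithm -/

/-- The payoff `g` of the action, counted when an item is sold. -/
def soldPayoff {X : Type*} (g : Act → ℝ) (o : Round X) : ℝ := if o.2.2 = true then g o.2.1 else 0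

theorem measurable_soldPayoff {g : Act → ℝ} (hg : Measurable g) :
    Measurable (soldPayoff (X := X) g) :=
  Measurable.ite (measurableSet_eq_fun measurable_bool_round measurable_const)
    (hg.comp (by fun_prop)) measurable_const

theorem soldPayoff_mem {X : Type*} {g : Act → ℝ} (hg0 : ∀ a, 0 ≤ g a) (hg1 : ∀ a, g a ≤ 1)
    (o : Round X) : soldPayoff g o ∈ Set.Icc (0 : ℝ) 1 := by
  unfold soldPayoff
  split_ifs
  · exact ⟨hg0 _, hg1 _⟩
  · exact ⟨le_rfl, zero_le_one⟩

theorem abs_soldPayoff_le {X : Type*} {g : Act → ℝ} (hg0 : ∀ a, 0 ≤ g a) (hg1 : ∀ a, g a ≤ 1)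
    (o : Round X) : |soldPayoff g o| ≤ 1 := by
  have := soldPayoff_mem hg0 hg1 o
  rw [abs_of_nonneg this.1]
  exact this.2

/-- The exploration noise changes the expected payoffs by at most `q₀`. -/
theorem Proper.abs_integral_soldPayoff_sub_le (hI : I.Proper)
    (hS : Measurable fun q : X × Act => saleProb S q.1 q.2) {P : I.cands → ℝ}
    (hP : P ∈ stdSimplex ℝ I.cands) {g : Act → ℝ} (hg : Measurable g) (hg0 : ∀ a, 0 ≤ g a)
    (hg1 : ∀ a, g a ≤ 1) :
    |∫ o, soldPayoff g o ∂(I.noisyLaw S P) - ∑ π, P π * I.policyMean S g π| ≤ I.noise := by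
  classical
  have := hI.isProbabilityMeasure
  have hK := I.numActs_pos
  rw [hI.integral_noisyLaw hS hP (measurable_soldPayoff hg) (abs_soldPayoff_le hg0 hg1)]
  let F : X → Act → ℝ := fun x a => saleProb S x a * g a
  have hF : ∀ x a, F x a ∈ Set.Icc (0 : ℝ) 1 := fun x a =>
    ⟨mul_nonneg (saleProb_nonneg _ _ _) (hg0 _),
      mul_le_one₀ (saleProb_le_one _ _ _) (hg0 _) (hg1 _)⟩
  have hFm : ∀ a, Measurable fun x => F x a := fun a =>
    (hS.comp (f := fun x => (x, a)) measurable_prodMk_right).mul measurable_const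
  let U : X → ℝ := fun x => (∑ a ∈ I.acts, F x a) / I.numActs
  have hU : ∀ x, U x ∈ Set.Icc (0 : ℝ) 1 := fun x => by
    refine ⟨div_nonneg (Finset.sum_nonneg fun a _ => (hF x a).1) hK.le, ?_⟩
    rw [div_le_one hK]
    refine (Finset.sum_le_card_nsmul _ _ 1 fun a _ => (hF x a).2).trans ?_
    simp [numActs]
  have hUm : Measurable U := (Finset.measurable_fun_sum _ fun a _ => hFm a).div_const _
  have hpt : ∀ x, ∑ a ∈ I.acts, I.noisy P x a * outcomeMean S (soldPayoff g) x a =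
      (1 - I.noise) * ∑ π : I.cands, P π * F x (π.1 x) + I.noise * U x := fun x => by
    rw [← hI.sum_acts_mul_ite P x (F x), Finset.mul_sum]
    simp only [U]
    rw [Finset.sum_div, Finset.mul_sum, ← Finset.sum_add_distrib]
    refine Finset.sum_congr rfl fun a _ => ?_
    simp only [noisy, outcomeMean, soldPayoff, F]
    simp only [if_true, Bool.false_eq_true, if_false, mul_zero, add_zero]
    ring
  have hi1 : ∀ π : I.cands, Integrable (fun x => P π * F x (π.1 x)) I.contextLaw := fun π =>
    (hI.integrable_policyMean hS hg hg0 hg1 π).const_mul _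
  have hiU : Integrable U I.contextLaw := integrable_of_measurable_of_abs_le hUm (C := 1)
    fun x => by rw [abs_of_nonneg (hU x).1]; exact (hU x).2
  have hA : ∫ x, ∑ π : I.cands, P π * F x (π.1 x) ∂I.contextLaw =
      ∑ π, P π * I.policyMean S g π := by
    rw [integral_finsetSum _ fun π _ => hi1 π]
    simp only [integral_const_mul]
    rfl
  simp only [hpt]
  rw [integral_add ((integrable_finsetSum _ fun π _ => hi1 π).const_mul _) (hiU.const_mul _),
    integral_const_mul, integral_const_mul, hA]
  have hU0 : 0 ≤ ∫ x, U x ∂I.contextLaw := integral_nonneg fun x => (hU x).1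
  have hU1 : ∫ x, U x ∂I.contextLaw ≤ 1 := by
    simpa using integral_mono hiU (integrable_const (1 : ℝ)) fun x => (hU x).2
  have hA0 : 0 ≤ ∑ π, P π * I.policyMean S g π :=
    sum_mul_nonneg_of_mem hP fun π => (hI.policyMean_mem hS hg hg0 hg1 π).1
  have hA1 : ∑ π, P π * I.policyMean S g π ≤ 1 :=
    sum_mul_le_of_mem hP fun π => (hI.policyMean_mem hS hg hg0 hg1 π).2
  have hq := hI.noise_pos
  rw [abs_le]
  constructor <;> nlinarith

/-- A bound on the loss in round `t` outside the failure event. In round `0` nothing is known, and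
`avgRadius` would divide by zero. -/
noncomputable def roundLoss (I : Input X) (t : ℕ) : ℝ :=
  if t = 0 then 1 else min 1 (6 * I.avgRadius t)

theorem roundLoss_nonneg (hI : I.Proper) (t : ℕ) : 0 ≤ I.roundLoss t := by
  unfold roundLoss
  split_ifs
  · exact zero_le_one
  · exact le_min zero_le_one (mul_nonneg (by norm_num) (avgRadius_nonneg hI t))

theorem Proper.reward_le_sales (hI : I.Proper)
    (hS : Measurable fun q : X × Act => saleProb S q.1 q.2) (π : I.cands) :
    (I.trueOutcomes S).reward π ≤ (I.trueOutcomes S).sales π :=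
  integral_mono
    (hI.integrable_policyMean hS measurable_price price_nonneg price_le_one π)
    (hI.integrable_policyMean hS measurable_const (fun _ => zero_le_one) (fun _ => le_rfl) π)
    fun _ => mul_le_mul_of_nonneg_left (price_le_one _) (saleProb_nonneg _ _ _)

open Classical in
theorem Proper.round_bounds (hI : I.Proper) (hκ : I.radConst = 32) (hB : 0 < I.B)
    (hS : Measurable fun q : X × Act => saleProb S q.1 q.2) (hρ : IsCBalance ρ)
    {Q : I.cands → ℝ} (hQ : (I.trueOutcomes S).LPPerfect Q) (h : History X I.T) (i : Fin I.T) :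
    ∑ π, Q π * (I.trueOutcomes S).reward π - I.roundLoss i -
        (if h ∈ failure S ρ then 1 else 0) ≤
      ∑ π, ρ i (h.take i i.2.le) π * (I.trueOutcomes S).reward π ∧
    ∑ π, ρ i (h.take i i.2.le) π * (I.trueOutcomes S).sales π ≤
      I.B / I.T + I.roundLoss i + (if h ∈ failure S ρ then 1 else 0) := by
  have hfe := hI.trueOutcomes_feasible hS
  have hP := hρ.mem_stdSimplex i (h.take i i.2.le)
  have a1 := sum_mul_nonneg_of_mem hP fun π => (hfe π).1.1
  have a2 := sum_mul_le_of_mem hP fun π => (hfe π).2.1.2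
  have a3 := sum_mul_le_of_mem hQ.1.1 fun π => (hfe π).1.2
  have hβ := hI.supplyRate_pos hB
  have hl := roundLoss_nonneg hI i
  by_cases hh : h ∈ failure S ρ
  · rw [if_pos hh]
    constructor <;> linarith
  rw [if_neg hh]
  by_cases hi : (i : ℕ) = 0
  · have : I.roundLoss i = 1 := by simp [roundLoss, hi]
    constructor <;> linarith
  have hn := hI.near_optimal hB hρ (Nat.pos_of_ne_zero hi)
    (hI.trueOutcomes_mem_confRegion hκ hS hρ.mem_stdSimplex hh i.2.le) (hI.reward_le_sales hS) hQ
  have hr := avgRadius_nonneg hI i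
  have : I.roundLoss i = min 1 (6 * I.avgRadius i) := by simp [roundLoss, hi]
  rcases min_cases 1 (6 * I.avgRadius i) with hm | hm
  · constructor <;> linarith
  · constructor <;> linarith [hn.1, hn.2]

/-- The regret of CBalance against the optimum of the linear program. -/
theorem Proper.expectedReward_ge (hI : I.Proper) (hκ : I.radConst = 32) (hB : 0 < I.B)
    (hS : Measurable fun q : X × Act => saleProb S q.1 q.2) (hρ : IsCBalance ρ)
    {Q : I.cands → ℝ} (hQ : (I.trueOutcomes S).LPPerfect Q) :
    I.T * ∑ π, Q π * (I.trueOutcomes S).reward π -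
        (2 * ((∑ i : Fin I.T, I.roundLoss i) + I.T * I.noise + 1) + √I.T) ≤
      expectedReward I.contextLaw S I.B I.T ρ.strategy := by
  classical
  have hT := hI.one_le_T'
  have hσ := hI.regular_strategy hS hρ.measurable hρ.mem_stdSimplex
  have hlaw := hσ.isProbabilityMeasure_historyLaw I.T
  set ν := historyLaw I.contextLaw S ρ.strategy I.T
  set R := ∑ π, Q π * (I.trueOutcomes S).reward π
  set E := ∑ i : Fin I.T, I.roundLoss i
  let bad : History X I.T → ℝ := (failure S ρ).indicator 1
  have hbad : ∀ h, bad h = if h ∈ failure S ρ then 1 else 0 := fun h => rfl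
  have hfail := hI.measurableSet_failure (S := S) hρ.measurable
  have hbadi : Integrable bad ν := (integrable_indicator_iff hfail).2 (integrable_const _).integrableOn
  have hbadE : I.T * ∫ h, bad h ∂ν ≤ 1 := by
    rw [integral_indicator_one hfail]
    have := hI.measureReal_failure_le hS hρ.measurable hρ.mem_stdSimplex
    rwa [le_div_iff₀' (by linarith)] at this
  -- conditional expectations of the payoffs
  let cond : (Act → ℝ) → (i : ℕ) → History X i → Round X → ℝ :=
    fun g i h _ => ∫ o, soldPayoff g o ∂(roundLaw I.contextLaw S (ρ.strategy i h))
  have hcond : ∀ g, Measurable g → (∀ a, 0 ≤ g a) → (∀ a, g a ≤ 1) →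
      ∀ (i : ℕ) (h : History X i) (o : Round X),
      |cond g i h o - ∑ π, ρ i h π * I.policyMean S g π| ≤ I.noise :=
    fun g hg hg0 hg1 i h o =>
      hI.abs_integral_soldPayoff_sub_le hS (hρ.mem_stdSimplex i h) hg hg0 hg1
  have hcm : ∀ g, Measurable g → ∀ i, Measurable (Function.uncurry (cond g i)) :=
    fun g hg i => (measurable_integral_of_abs_le (hσ.measurable_roundLaw i)
      (hσ.isProbabilityMeasure i) (F := fun _ => soldPayoff g) ((measurable_soldPayoff hg).comp measurable_snd)).comp
      measurable_fst
  have hc01 : ∀ g, Measurable g → (∀ a, 0 ≤ g a) → (∀ a, g a ≤ 1) →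
      ∀ (i : ℕ) (h : History X i) (o : Round X), cond g i h o ∈ Set.Icc (0 : ℝ) 1 := by
    intro g hg hg0 hg1 i h o
    have := hσ.isProbabilityMeasure i h
    refine ⟨integral_nonneg fun o => (soldPayoff_mem hg0 hg1 o).1, ?_⟩
    exact (le_abs_self _).trans (abs_integral_le_of_abs_le (abs_soldPayoff_le hg0 hg1))
  have hcabs : ∀ g, Measurable g → (∀ a, 0 ≤ g a) → (∀ a, g a ≤ 1) →
      ∀ (i : ℕ) (h : History X i) (o : Round X), |cond g i h o| ≤ 1 := by
    intro g hg hg0 hg1 i h o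
    have := hc01 g hg hg0 hg1 i h o
    rw [abs_of_nonneg this.1]
    exact this.2
  have hone0 : ∀ a : Act, (0 : ℝ) ≤ (fun _ => 1 : Act → ℝ) a := fun _ => zero_le_one
  have hone1 : ∀ a : Act, (fun _ => 1 : Act → ℝ) a ≤ (1 : ℝ) := fun _ => le_rfl
  -- the expected revenue without the supply constraint
  have hrev : I.T * R - E - I.T * I.noise - 1 ≤
      ∫ h, pathSum (fun _ _ o => soldPayoff price o) h ∂ν := by
    rw [hσ.integral_pathSum (G := fun _ _ o => soldPayoff price o)
      (fun _ => (measurable_soldPayoff measurable_price).comp measurable_snd)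
      (fun _ _ o => abs_soldPayoff_le price_nonneg price_le_one o)]
    have hpt : ∀ h : History X I.T, I.T * R - E - I.T * I.noise - I.T * bad h ≤
        pathSum (cond price) h := by
      intro h
      have : I.T * R - E - I.T * I.noise - I.T * bad h =
          ∑ i : Fin I.T, (R - I.roundLoss i - I.noise - bad h) := by
        simp only [Finset.sum_sub_distrib, Finset.sum_const, Finset.card_univ, Fintype.card_fin,
          nsmul_eq_mul, E]
      rw [this]
      refine Finset.sum_le_sum fun i _ => ?_
      have h1 := (hI.round_bounds hκ hB hS hρ hQ h i).1
      have h2 := (abs_le.1 (hcond price measurable_price price_nonneg price_le_one i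
        (h.take i i.2.le) (h i))).1
      rw [← hbad] at h1
      change R - I.roundLoss i - bad h ≤ ∑ π, ρ i (h.take i i.2.le) π * I.policyMean S price π
        at h1
      linarith
    have hint : Integrable (fun h : History X I.T => pathSum (cond price) h) ν :=
      integrable_of_measurable_of_abs_le (measurable_pathSum (hcm price measurable_price) _)
        (abs_pathSum_le (hcabs price measurable_price price_nonneg price_le_one))
    have hm := integral_mono ((integrable_const (I.T * R - E - I.T * I.noise)).sub
      (hbadi.const_mul (I.T : ℝ))) hint hpt
    have hlhs : ∫ h, (I.T * R - E - I.T * I.noise - I.T * bad h) ∂ν =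
        I.T * R - E - I.T * I.noise - I.T * ∫ h, bad h ∂ν := by
      rw [integral_sub (integrable_const _) (hbadi.const_mul _), integral_const_mul]
      simp
    have hm' : ∫ h, (I.T * R - E - I.T * I.noise - I.T * bad h) ∂ν ≤
      ∫ h, pathSum (cond price) h ∂ν := hm
    rw [hlhs] at hm'
    linarith
  -- the expected number of sales beyond the supply
  let G : (i : ℕ) → History X i → Round X → ℝ :=
    fun i h o => soldPayoff (fun _ => 1) o - cond (fun _ => 1) i h o
  have hGm : ∀ i, Measurable (Function.uncurry (G i)) := fun i =>
    ((measurable_soldPayoff measurable_const).comp measurable_snd).sub (hcm _ measurable_const i)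
  have hG1 : ∀ i h o, |G i h o| ≤ 1 := fun i h o => by
    have h1 := soldPayoff_mem hone0 hone1 o
    have h2 := hc01 _ measurable_const hone0 hone1 i h o
    rw [abs_le]
    constructor
    · have := h1.1; have := h2.2; simp only [G]; linarith
    · have := h1.2; have := h2.1; simp only [G]; linarith
  have hG0 : ∀ i h, ∫ o, G i h o ∂(roundLaw I.contextLaw S (ρ.strategy i h)) = 0 := fun i h => by
    have := hσ.isProbabilityMeasure i h
    simp only [G, cond]
    rw [integral_sub (integrable_of_measurable_of_abs_le (measurable_soldPayoff measurable_const)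
      (abs_soldPayoff_le hone0 hone1)) (integrable_const _)]
    simp
  have hover : ∀ h : History X I.T, max 0 (∑ i, soldCount (h i) - I.B) ≤
      |pathSum G h| + (E + I.T * I.noise + I.T * bad h) := by
    intro h
    have hnoise := hI.noise_pos
    have hb0 : 0 ≤ bad h := Set.indicator_nonneg (fun _ _ => zero_le_one) h
    have hE0 : 0 ≤ E := Finset.sum_nonneg fun i _ => roundLoss_nonneg hI i
    refine max_le (by positivity) ?_
    have hsum : ∑ i, soldCount (h i) = pathSum G h + pathSum (cond fun _ => 1) h := by
      simp only [pathSum, G, ← Finset.sum_add_distrib, sub_add_cancel]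
      rfl
    have hc : pathSum (cond fun _ => 1) h ≤ I.B + E + I.T * I.noise + I.T * bad h := by
      have : I.B + E + I.T * I.noise + I.T * bad h =
          ∑ i : Fin I.T, ((I.B / I.T : ℝ) + I.roundLoss i + bad h + I.noise) := by
        simp only [Finset.sum_add_distrib, Finset.sum_const, Finset.card_univ, Fintype.card_fin,
          nsmul_eq_mul, E]
        field_simp
        ring
      rw [this]
      refine Finset.sum_le_sum fun i _ => ?_
      have h1 := (hI.round_bounds hκ hB hS hρ hQ h i).2
      have h2 := (abs_le.1 (hcond _ measurable_const hone0 hone1 i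
        (h.take i i.2.le) (h i))).2
      rw [← hbad] at h1
      change ∑ π, ρ i (h.take i i.2.le) π * I.policyMean S (fun _ => 1) π ≤ _ at h1
      linarith
    rw [hsum]
    linarith [le_abs_self (pathSum G h)]
  have habs := hσ.integral_abs_pathSum_le hGm hG1 hG0 I.T
  have hiG : Integrable (fun h : History X I.T => |pathSum G h|) ν :=
    (integrable_of_measurable_of_abs_le (measurable_pathSum hGm _) (abs_pathSum_le hG1)).abs
  have hirev : Integrable (fun h : History X I.T => pathSum (fun _ _ o => soldPayoff price o) h) ν :=
    integrable_of_measurable_of_abs_le (measurable_pathSum (G := fun _ _ o => soldPayoff price o)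
      (fun _ => (measurable_soldPayoff measurable_price).comp measurable_snd) _)
      (abs_pathSum_le (fun _ _ o => abs_soldPayoff_le price_nonneg price_le_one o))
  have hirew : Integrable (fun h : History X I.T => totalReward I.B h) ν :=
    integrable_of_measurable_of_abs_le (measurable_totalReward _ _) (abs_totalReward_le _)
  have hiE : Integrable (fun h => E + I.T * I.noise + I.T * bad h) ν :=
    (integrable_const (E + I.T * I.noise)).add (hbadi.const_mul (I.T : ℝ))
  have hiover : Integrable (fun h => |pathSum G h| + (E + I.T * I.noise + I.T * bad h)) ν :=
    hiG.add hiE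
  have hfin : ∫ h, (pathSum (fun _ _ o => soldPayoff price o) h -
      (|pathSum G h| + (E + I.T * I.noise + I.T * bad h))) ∂ν ≤ ∫ h, totalReward I.B h ∂ν :=
    integral_mono (hirev.sub hiover) hirew fun h => by
      have h1 := sum_revenue_sub_le_totalReward I.B h
      have h2 := hover h
      have h3 : ∑ i, revenue (h i) = pathSum (fun _ _ o => soldPayoff price o) h := rfl
      simp only
      linarith
  have hE : ∫ h, (E + I.T * I.noise + I.T * bad h) ∂ν =
      E + I.T * I.noise + I.T * ∫ h, bad h ∂ν := by
    rw [integral_add (integrable_const _) (hbadi.const_mul _), integral_const_mul]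
    simp
  rw [integral_sub hirev hiover, integral_add hiG hiE, hE] at hfin
  change _ ≤ ∫ h, totalReward I.B h ∂ν
  linarith

end Input

/-! ### The benchmark is bounded by the linear program -/

/-- The number of sales in a history. -/
def soldTotal {X : Type*} {t : ℕ} (h : History X t) : ℕ :=
  (Finset.univ.filter fun i : Fin t => (h i).2.2 = true).card

theorem salesUpTo_eq {X : Type*} {t : ℕ} (h : History X t) (i : Fin t)
    (hi : (h i).2.2 = true) : salesUpTo h i = soldTotal (h.take i i.2.le) + 1 := by
  have h1 : (Finset.univ.filter fun j : Fin t => j ≤ i ∧ (h j).2.2 = true) =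
      insert i ((Finset.univ.filter fun j : Fin i => (h.take i i.2.le j).2.2 = true).map
        (Fin.castLEEmb i.2.le)) := by
    ext j
    simp only [Finset.mem_filter, Finset.mem_univ, true_and, Finset.mem_insert, Finset.mem_map,
      Fin.castLEEmb_apply]
    constructor
    · rintro ⟨hji, hj⟩
      rcases hji.eq_or_lt with rfl | hlt
      · exact Or.inl rfl
      · exact Or.inr ⟨⟨j, hlt⟩, hj, rfl⟩
    · rintro (rfl | ⟨k, hk, rfl⟩)
      · exact ⟨le_rfl, hi⟩
      · exact ⟨Fin.le_def.2 k.2.le, hk⟩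
  rw [salesUpTo, h1, Finset.card_insert_of_notMem, Finset.card_map]
  · rfl
  · simp only [Finset.mem_map, Fin.castLEEmb_apply, not_exists, not_and]
    intro k _ hk
    have := congrArg Fin.val hk
    simp only [Fin.val_castLE] at this
    omega

/-- Whether supply is left after a history. -/
def supplyLeft {X : Type*} (B : ℕ) {t : ℕ} (h : History X t) : ℝ :=
  if soldTotal h < B then 1 else 0

theorem supplyLeft_mem {X : Type*} (B : ℕ) {t : ℕ} (h : History X t) :
    supplyLeft B h ∈ Set.Icc (0 : ℝ) 1 := by
  unfold supplyLeft
  split_ifs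
  · exact ⟨zero_le_one, le_rfl⟩
  · exact ⟨le_rfl, zero_le_one⟩

theorem measurable_supplyLeft (B t : ℕ) : Measurable fun h : History X t => supplyLeft B h := by
  have h1 : Measurable fun h : History X t => soldTotal h := by
    simp only [soldTotal, Finset.card_filter]
    exact Finset.measurable_fun_sum _ fun j _ =>
      Measurable.ite (measurableSet_sold t j) measurable_const measurable_const
  exact Measurable.ite (measurableSet_lt h1 measurable_const) measurable_const measurable_const

theorem counted_iff {X : Type*} (B : ℕ) {t : ℕ} (h : History X t) (i : Fin t) (v : ℝ) :
    (if (h i).2.2 = true ∧ salesUpTo h i ≤ B then v else 0) =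
      supplyLeft B (h.take i i.2.le) * (if (h i).2.2 = true then v else 0) := by
  by_cases hs : (h i).2.2 = true
  · simp only [hs, true_and, if_true, supplyLeft, salesUpTo_eq h i hs, Nat.succ_le_iff]
    split_ifs <;> simp
  · simp [hs]

theorem totalReward_eq_pathSum {X : Type*} (B : ℕ) {t : ℕ} (h : History X t) :
    totalReward B h =
      pathSum (fun _ g o => supplyLeft B g * Input.soldPayoff price o) h :=
  Finset.sum_congr rfl fun i _ => counted_iff B h i _

theorem pathSum_counted_le {X : Type*} (B : ℕ) {t : ℕ} (h : History X t) :
    pathSum (fun _ g o => supplyLeft B g * Input.soldPayoff (fun _ => 1) o) h ≤ B := by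
  have : pathSum (fun _ g o => supplyLeft B g * Input.soldPayoff (fun _ => 1) o) h =
      ∑ i, if (h i).2.2 = true ∧ salesUpTo h i ≤ B then (1 : ℝ) else 0 :=
    Finset.sum_congr rfl fun i _ => (counted_iff B h i _).symm
  rw [this, Finset.sum_boole]
  exact_mod_cast card_sold_before_le B h

/-- The expected value of `g` when prices are posted according to `π`, counted when an item is
sold. -/
noncomputable def priceMean (μ : Measure X) (S : Demand X) (g : Act → ℝ)
    (π : X → unitInterval) : ℝ :=
  ∫ x, saleProb S x (Sum.inl (π x)) * g (Sum.inl (π x)) ∂μ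

namespace BenchmarkRule

variable {Pol : Finset (X → unitInterval)} {μ : Measure X} [IsProbabilityMeasure μ] {S : Demand X}

theorem measurable_weight (β : BenchmarkRule Pol) (t : ℕ) (π : Pol) :
    Measurable fun h => β.weights t h π :=
  (measurable_pi_apply π).comp (β.measurable_weights t)

theorem isMixture (β : BenchmarkRule Pol) (t : ℕ) (h : History X t) :
    IsMixture Finset.univ fun π : Pol => β.weights t h π :=
  ⟨fun π _ => (β.mem_stdSimplex t h).1 π, (β.mem_stdSimplex t h).2⟩

theorem regular (β : BenchmarkRule Pol) (hPol : ∀ π ∈ Pol, Measurable π)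
    (hS : Measurable fun q : X × Act => saleProb S q.1 q.2) : Regular μ S β.strategy := by
  refine ⟨fun t => ?_, fun t h => ?_⟩
  · exact measurable_roundLaw_mixture (w := fun π h _ => β.weights t h π) Finset.univ
      (fun (π : Pol) x => Sum.inl (π.1 x)) μ hS
      (fun π _ => measurable_inl.comp (hPol π.1 π.2))
      fun π _ => (β.measurable_weight t π).comp measurable_fst
  · exact isProbabilityMeasure_roundLaw_mixture (w := fun π _ => β.weights t h π) Finset.univ
      (fun (π : Pol) x => Sum.inl (π.1 x)) μ hS
      (fun π _ => measurable_inl.comp (hPol π.1 π.2)) (fun _ _ => measurable_const)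
      fun _ => β.isMixture t h

theorem integrable_priceMean (hS : Measurable fun q : X × Act => saleProb S q.1 q.2)
    {g : Act → ℝ} (hg : Measurable g) (hg0 : ∀ a, 0 ≤ g a) (hg1 : ∀ a, g a ≤ 1)
    {π : X → unitInterval} (hπ : Measurable π) :
    Integrable (fun x => saleProb S x (Sum.inl (π x)) * g (Sum.inl (π x))) μ := by
  have hm : Measurable fun x => (Sum.inl (π x) : Act) := measurable_inl.comp hπ
  refine integrable_of_measurable_of_abs_le (C := 1) ?_ fun x => ?_
  · exact (hS.comp (f := fun x => (x, Sum.inl (π x))) (measurable_id.prodMk hm)).mul (hg.comp hm)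
  · rw [abs_of_nonneg (mul_nonneg (saleProb_nonneg _ _ _) (hg0 _))]
    exact mul_le_one₀ (saleProb_le_one _ _ _) (hg0 _) (hg1 _)

theorem integral_soldPayoff (β : BenchmarkRule Pol) (hPol : ∀ π ∈ Pol, Measurable π)
    (hS : Measurable fun q : X × Act => saleProb S q.1 q.2) {g : Act → ℝ} (hg : Measurable g)
    (hg0 : ∀ a, 0 ≤ g a) (hg1 : ∀ a, g a ≤ 1) (t : ℕ) (h : History X t) :
    ∫ o, Input.soldPayoff g o ∂(roundLaw μ S (β.strategy t h)) =
      ∑ π : Pol, β.weights t h π * priceMean μ S g π.1 := by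
  have h1 := integral_roundLaw_mixture (w := fun π _ => β.weights t h π) Finset.univ
      (fun (π : Pol) x => Sum.inl (π.1 x)) μ hS
      (fun π _ => measurable_inl.comp (hPol π.1 π.2)) (fun _ _ => measurable_const)
      (fun _ => β.isMixture t h) (Input.measurable_soldPayoff hg)
      (Input.abs_soldPayoff_le hg0 hg1)
  refine Eq.trans h1 ?_
  simp only [outcomeMean, Input.soldPayoff, if_true, Bool.false_eq_true, if_false, mul_zero,
    add_zero]
  rw [integral_finsetSum _ fun (π : Pol) _ =>
    (integrable_priceMean hS hg hg0 hg1 (hPol π.1 π.2)).const_mul _]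
  simp only [integral_const_mul, priceMean]

/-- The expected number of rounds in which `π` is chosen while supply is left. -/
noncomputable def occupation (β : BenchmarkRule Pol) (μ : Measure X) (S : Demand X) (B T : ℕ)
    (π : Pol) : ℝ :=
  ∫ h, pathSum (fun i g _ => supplyLeft B g * β.weights i g π) h ∂(historyLaw μ S β.strategy T)

theorem weight_mem (β : BenchmarkRule Pol) (t : ℕ) (h : History X t) (π : Pol) :
    β.weights t h π ∈ Set.Icc (0 : ℝ) 1 := by
  have hm := β.isMixture t h
  refine ⟨hm.nonneg π (Finset.mem_univ _), ?_⟩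
  rw [← hm.sum_eq_one]
  exact Finset.single_le_sum hm.nonneg (Finset.mem_univ _)

theorem integrable_occupation (β : BenchmarkRule Pol) (hPol : ∀ π ∈ Pol, Measurable π)
    (hS : Measurable fun q : X × Act => saleProb S q.1 q.2) (B T : ℕ) (π : Pol) :
    Integrable (fun h => pathSum (fun i g _ => supplyLeft B g * β.weights i g π) h)
      (historyLaw μ S β.strategy T) := by
  have := (β.regular (μ := μ) hPol hS).isProbabilityMeasure_historyLaw T
  refine integrable_of_measurable_of_abs_le
    (measurable_pathSum (G := fun i g _ => supplyLeft B g * β.weights i g π) (fun i =>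
      ((measurable_supplyLeft B i).mul (β.measurable_weight i π)).comp measurable_fst) T)
    (abs_pathSum_le (C := 1) fun i g _ => ?_)
  have h1 := supplyLeft_mem B g
  have h2 := β.weight_mem i g π
  rw [abs_of_nonneg (mul_nonneg h1.1 h2.1)]
  exact mul_le_one₀ h1.2 h2.1 h2.2

theorem occupation_nonneg {μ : Measure X} (β : BenchmarkRule Pol) (B T : ℕ) (π : Pol) :
    0 ≤ β.occupation μ S B T π :=
  integral_nonneg fun _ => Finset.sum_nonneg fun _ _ =>
    mul_nonneg (supplyLeft_mem _ _).1 (β.weight_mem _ _ _).1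

theorem sum_occupation_le (β : BenchmarkRule Pol) (hPol : ∀ π ∈ Pol, Measurable π)
    (hS : Measurable fun q : X × Act => saleProb S q.1 q.2) (B T : ℕ) :
    ∑ π, β.occupation μ S B T π ≤ T := by
  have := (β.regular (μ := μ) hPol hS).isProbabilityMeasure_historyLaw T
  simp only [occupation]
  rw [← integral_finsetSum _ fun π _ => β.integrable_occupation hPol hS B T π]
  refine (integral_mono (integrable_finsetSum _ fun π _ => β.integrable_occupation hPol hS B T π)
    (integrable_const (T : ℝ)) fun h => ?_).trans (by simp)
  simp only [pathSum]
  rw [Finset.sum_comm]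
  calc _ ≤ ∑ _i : Fin T, (1 : ℝ) := by
        refine Finset.sum_le_sum fun i _ => ?_
        rw [← Finset.mul_sum, (β.isMixture _ _).sum_eq_one, mul_one]
        exact (supplyLeft_mem _ _).2
    _ = T := by simp

/-- The expected payoff collected while supply is left, in terms of the occupation measure. -/
theorem integral_counted (β : BenchmarkRule Pol) (hPol : ∀ π ∈ Pol, Measurable π)
    (hS : Measurable fun q : X × Act => saleProb S q.1 q.2) {g : Act → ℝ} (hg : Measurable g)
    (hg0 : ∀ a, 0 ≤ g a) (hg1 : ∀ a, g a ≤ 1) (B T : ℕ) :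
    ∫ h, pathSum (fun _ g' o => supplyLeft B g' * Input.soldPayoff g o) h
        ∂(historyLaw μ S β.strategy T) =
      ∑ π, β.occupation μ S B T π * priceMean μ S g π.1 := by
  have hσ := β.regular (μ := μ) hPol hS
  rw [hσ.integral_pathSum (G := fun _ g' o => supplyLeft B g' * Input.soldPayoff g o)
    (fun i => ((measurable_supplyLeft B i).comp measurable_fst).mul
      ((Input.measurable_soldPayoff hg).comp measurable_snd)) (C := 1) fun i g' o => by
        have h1 := supplyLeft_mem B g'
        have h2 := Input.soldPayoff_mem hg0 hg1 o
        rw [abs_of_nonneg (mul_nonneg h1.1 h2.1)]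
        exact mul_le_one₀ h1.2 h2.1 h2.2]
  simp only [occupation, ← integral_mul_const]
  rw [← integral_finsetSum _ fun π _ => (β.integrable_occupation hPol hS B T π).mul_const _]
  congr 1
  funext h
  simp only [pathSum, Finset.sum_mul]
  rw [Finset.sum_comm]
  refine Finset.sum_congr rfl fun i _ => ?_
  rw [integral_const_mul, β.integral_soldPayoff hPol hS hg hg0 hg1, Finset.mul_sum]
  refine Finset.sum_congr rfl fun π _ => ?_
  ring

theorem expectedReward_eq (β : BenchmarkRule Pol) (hPol : ∀ π ∈ Pol, Measurable π)
    (hS : Measurable fun q : X × Act => saleProb S q.1 q.2) (B T : ℕ) :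
    expectedReward μ S B T β.strategy =
      ∑ π, β.occupation μ S B T π * priceMean μ S price π.1 := by
  rw [← β.integral_counted hPol hS measurable_price price_nonneg price_le_one]
  simp only [expectedReward, totalReward_eq_pathSum]

theorem sum_occupation_mul_sales_le (β : BenchmarkRule Pol) (hPol : ∀ π ∈ Pol, Measurable π)
    (hS : Measurable fun q : X × Act => saleProb S q.1 q.2) (B T : ℕ) :
    ∑ π, β.occupation μ S B T π * priceMean μ S (fun _ => 1) π.1 ≤ B := by
  have := (β.regular (μ := μ) hPol hS).isProbabilityMeasure_historyLaw T
  rw [← β.integral_counted hPol hS measurable_const (fun _ => zero_le_one) (fun _ => le_rfl)]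
  have hi : Integrable (fun h => pathSum
      (fun _ g' o => supplyLeft B g' * Input.soldPayoff (fun _ => 1) o) h)
      (historyLaw μ S β.strategy T) := by
    refine integrable_of_measurable_of_abs_le (measurable_pathSum
      (G := fun _ g' o => supplyLeft B g' * Input.soldPayoff (fun _ => 1) o)
      (fun i => ((measurable_supplyLeft B i).comp measurable_fst).mul
      ((Input.measurable_soldPayoff measurable_const).comp measurable_snd)) T)
      (abs_pathSum_le (C := 1) fun i g' o => ?_)
    have h1 := supplyLeft_mem B g'
    have h2 := Input.soldPayoff_mem (g := fun _ => 1) (fun _ => zero_le_one) (fun _ => le_rfl) o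
    rw [abs_of_nonneg (mul_nonneg h1.1 h2.1)]
    exact mul_le_one₀ h1.2 h2.1 h2.2
  refine (integral_mono hi (integrable_const (B : ℝ)) fun h => pathSum_counted_le B h).trans ?_
  simp

/-- A benchmark rule for `Pol` collects at most what the linear program for the algorithm's input
allows, if every policy of `Pol` is approximated by a candidate. -/
theorem expectedReward_le {I : Input X} (hI : I.Proper) (hB : 0 < I.B)
    (β : BenchmarkRule Pol) (hPol : ∀ π ∈ Pol, Measurable π)
    (hS : Measurable fun q : X × Act => saleProb S q.1 q.2) {Q : I.cands → ℝ}
    (hQ : (I.trueOutcomes S).LPPerfect Q) (φ : Pol → I.cands) {d e : ℝ} (hd : 0 ≤ d) (he : 0 ≤ e)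
    (hr : ∀ π, priceMean I.contextLaw S price π.1 - d ≤ (I.trueOutcomes S).reward (φ π))
    (hc : ∀ π, (I.trueOutcomes S).sales (φ π) ≤ priceMean I.contextLaw S (fun _ => 1) π.1 + e) :
    expectedReward I.contextLaw S I.B I.T β.strategy ≤
      I.T * (∑ π, Q π * (I.trueOutcomes S).reward π + d + e) := by
  classical
  have := hI.isProbabilityMeasure
  have hT := hI.one_le_T'
  have hT0 : (0 : ℝ) < I.T := by linarith
  have hβ := hI.supplyRate_pos hB
  have hfe := hI.trueOutcomes_feasible hS
  rw [β.expectedReward_eq hPol hS]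
  set m := I.trueOutcomes S
  set r : Pol → ℝ := fun π => priceMean I.contextLaw S price π.1
  set c : Pol → ℝ := fun π => priceMean I.contextLaw S (fun _ => 1) π.1
  have hrc : ∀ π, r π ≤ c π := fun π => integral_mono
    (integrable_priceMean hS measurable_price price_nonneg price_le_one (hPol π.1 π.2))
    (integrable_priceMean hS measurable_const (fun _ => zero_le_one) (fun _ => le_rfl)
      (hPol π.1 π.2))
    fun _ => mul_le_mul_of_nonneg_left (price_le_one _) (saleProb_nonneg _ _ _)
  set x : Pol → ℝ := fun π => β.occupation I.contextLaw S I.B I.T π / I.T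
  have hx0 : ∀ π, 0 ≤ x π := fun π => div_nonneg (β.occupation_nonneg _ _ π) hT0.le
  have hx1 : ∑ π, x π ≤ 1 := by
    rw [← Finset.sum_div, div_le_one hT0]
    exact β.sum_occupation_le hPol hS _ _
  have hxc : ∑ π, x π * c π ≤ I.B / I.T := by
    have : ∑ π, x π * c π = (∑ π, β.occupation I.contextLaw S I.B I.T π * c π) / I.T := by
      rw [Finset.sum_div]
      exact Finset.sum_congr rfl fun π _ => div_mul_eq_mul_div _ _ _
    rw [this]
    exact div_le_div_of_nonneg_right (β.sum_occupation_mul_sales_le hPol hS _ _) hT0.le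
  have hxr : ∑ π, β.occupation I.contextLaw S I.B I.T π * r π = I.T * ∑ π, x π * r π := by
    rw [Finset.mul_sum]
    refine Finset.sum_congr rfl fun π _ => ?_
    simp only [x]
    field_simp
  change ∑ π, β.occupation I.contextLaw S I.B I.T π * r π ≤ _
  rw [hxr]
  refine mul_le_mul_of_nonneg_left ?_ hT0.le
  have hRβ : ∑ π, x π * r π ≤ (I.B / I.T : ℝ) :=
    le_trans (Finset.sum_le_sum fun π _ => mul_le_mul_of_nonneg_left (hrc π) (hx0 π)) hxc
  -- transport the occupation measure to the candidates, completing it by the null policy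
  let P : I.cands → ℝ := (∑ π, x π • Pi.single (φ π) 1) +
    (1 - ∑ π, x π) • Pi.single I.nullPolicy 1
  have hPsum : ∀ f : I.cands → ℝ, ∑ π, P π * f π =
      ∑ π, x π * f (φ π) + (1 - ∑ π, x π) * f I.nullPolicy := fun f => by
    simp only [P, Pi.add_apply, Finset.sum_apply, Pi.smul_apply, smul_eq_mul, add_mul,
      Finset.sum_add_distrib, Finset.sum_mul]
    rw [Finset.sum_comm]
    simp [Pi.single_apply]
  have hPmem : P ∈ stdSimplex ℝ I.cands := by
    refine ⟨fun π => ?_, ?_⟩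
    · simp only [P, Pi.add_apply, Finset.sum_apply, Pi.smul_apply, smul_eq_mul]
      refine add_nonneg (Finset.sum_nonneg fun i _ => mul_nonneg (hx0 i) ?_)
        (mul_nonneg (by linarith) ?_) <;>
      · rw [Pi.single_apply]
        split_ifs
        · exact zero_le_one
        · exact le_rfl
    · have := hPsum fun _ => 1
      simpa using this
  have hle := hQ.mul_le hfe hβ hPmem
  have hPr : ∑ π, x π * r π - d ≤ ∑ π, P π * m.reward π := by
    rw [hPsum, hfe.null.1, mul_zero, add_zero]
    have : ∑ π, x π * (r π - d) ≤ ∑ π, x π * m.reward (φ π) :=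
      Finset.sum_le_sum fun π _ => mul_le_mul_of_nonneg_left (hr π) (hx0 π)
    simp only [mul_sub, Finset.sum_sub_distrib, ← Finset.sum_mul] at this
    nlinarith
  have hPc : ∑ π, P π * m.sales π ≤ I.B / I.T + e := by
    rw [hPsum, hfe.null.2, mul_zero, add_zero]
    have : ∑ π, x π * m.sales (φ π) ≤ ∑ π, x π * (c π + e) :=
      Finset.sum_le_sum fun π _ => mul_le_mul_of_nonneg_left (hc π) (hx0 π)
    simp only [mul_add, Finset.sum_add_distrib, ← Finset.sum_mul] at this
    nlinarith
  have hQ0 : 0 ≤ ∑ π, Q π * m.reward π := Input.sum_mul_nonneg_of_mem hQ.1.1 fun π => (hfe π).1.1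
  set b : ℝ := I.B / I.T
  set R := ∑ π, x π * r π
  set V := ∑ π, Q π * m.reward π
  have h1 : (R - d) * b ≤ V * (b + e) :=
    (mul_le_mul_of_nonneg_right hPr hβ.le).trans
      (hle.trans (mul_le_mul_of_nonneg_left (max_le (by linarith) hPc) hQ0))
  have h2 : (R - d - e) * (b + e) ≤ V * (b + e) := by
    refine le_trans ?_ h1
    nlinarith [mul_nonneg hd he, mul_nonneg he he]
  have h3 := le_of_mul_le_mul_right h2 (by linarith)
  linarith

end BenchmarkRule

/-! ### Discretization -/

theorem roundDown_mem_priceGrid {ε : ℝ} (hε : 0 < ε) (p : unitInterval) :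
    roundDown ε p ∈ priceGrid ε := by
  have h0 : 0 ≤ (p : ℝ) / ε := div_nonneg p.2.1 hε.le
  refine Finset.mem_image.2 ⟨⌊(p : ℝ) / ε⌋₊, Finset.mem_range.2 (Nat.lt_succ_of_le ?_), ?_⟩
  · exact Nat.floor_le_floor (div_le_div_of_nonneg_right p.2.2 hε.le)
  · unfold roundDown
    congr 1
    rw [mul_comm, ← natCast_floor_eq_intCast_floor h0]

theorem roundDown_le {ε : ℝ} (hε : 0 < ε) (p : unitInterval) : (roundDown ε p : ℝ) ≤ p := by
  rw [coe_roundDown hε]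
  calc ε * (⌊(p : ℝ) / ε⌋ : ℝ) ≤ ε * ((p : ℝ) / ε) :=
        mul_le_mul_of_nonneg_left (Int.floor_le _) hε.le
    _ = p := by field_simp

theorem le_roundDown_add {ε : ℝ} (hε : 0 < ε) (p : unitInterval) :
    (p : ℝ) ≤ roundDown ε p + ε := by
  rw [coe_roundDown hε]
  calc (p : ℝ) = ε * ((p : ℝ) / ε) := by field_simp
    _ ≤ ε * (⌊(p : ℝ) / ε⌋ + 1) :=
        mul_le_mul_of_nonneg_left (Int.lt_floor_add_one _).le hε.le
    _ = _ := by ring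

theorem measurable_roundDown (ε : ℝ) : Measurable (roundDown ε) := by
  unfold roundDown
  refine continuous_projIcc.measurable.comp (Measurable.const_mul ?_ _)
  exact (measurable_from_top (f := fun n : ℤ => (n : ℝ))).comp
    (Int.measurable_floor.comp (measurable_subtype_coe.div_const _))

theorem card_priceGrid_le {ε : ℝ} (hε : 0 < ε) : ((priceGrid ε).card : ℝ) ≤ 1 / ε + 1 := by
  have h1 : (priceGrid ε).card ≤ ⌊1 / ε⌋₊ + 1 := by
    refine Finset.card_image_le.trans ?_
    simp
  have h2 : (⌊1 / ε⌋₊ : ℝ) ≤ 1 / ε := Nat.floor_le (by positivity)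
  calc ((priceGrid ε).card : ℝ) ≤ ((⌊1 / ε⌋₊ + 1 : ℕ) : ℝ) := Nat.cast_le.2 h1
    _ ≤ _ := by push_cast; linarith

theorem mem_discretize {X : Type*} {ε : ℝ} {Pol : Finset (X → unitInterval)}
    {π : X → unitInterval} (hπ : π ∈ Pol) :
    (fun x => roundDown ε (π x)) ∈ discretize ε Pol := by
  classical
  exact Finset.mem_image_of_mem (fun (π : X → unitInterval) x => roundDown ε (π x)) hπ

theorem exists_of_mem_discretize {X : Type*} {ε : ℝ} {Pol : Finset (X → unitInterval)}
    {π : X → unitInterval} (hπ : π ∈ discretize ε Pol) :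
    ∃ π' ∈ Pol, (fun x => roundDown ε (π' x)) = π := by
  classical
  exact Finset.mem_image.1 hπ

section

variable {B T : ℕ} {ε : ℝ} {Pol : Finset (X → unitInterval)} {μ : Measure X} {κ : ℝ}

theorem discretizedInput_proper [hμ : IsProbabilityMeasure μ] (hT : 1 ≤ T) (hε : 0 < ε)
    (hPol : ∀ π ∈ Pol, Measurable π) (hκ : 0 < κ) :
    (discretizedInput B T ε Pol μ κ).Proper where
  isProbabilityMeasure := hμ
  one_le_T := hT
  measurable_policies π hπ := by
    obtain ⟨π', h', rfl⟩ := exists_of_mem_discretize hπ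
    exact (measurable_roundDown ε).comp (hPol π' h')
  mem_prices π hπ x := by
    obtain ⟨π', h', rfl⟩ := exists_of_mem_discretize hπ
    exact roundDown_mem_priceGrid hε _
  radConst_pos := hκ

theorem discretizedInput_numActs_le (hε : 0 < ε) :
    (discretizedInput B T ε Pol μ κ).numActs ≤ 1 / ε + 2 := by
  classical
  have h1 : (discretizedInput B T ε Pol μ κ).acts.card ≤ (priceGrid ε).card + 1 :=
    (Finset.card_insert_le _ _).trans (Nat.add_le_add_right Finset.card_image_le 1)
  have h2 := card_priceGrid_le hε
  calc (discretizedInput B T ε Pol μ κ).numActs ≤ (((priceGrid ε).card + 1 : ℕ) : ℝ) :=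
        Nat.cast_le.2 h1
    _ ≤ _ := by push_cast; linarith

theorem discretizedInput_card_cands_le :
    ((discretizedInput B T ε Pol μ κ).cands.card : ℝ) ≤ Pol.card + 1 := by
  classical
  have h1 : (discretizedInput B T ε Pol μ κ).cands.card ≤ Pol.card + 1 :=
    (Finset.card_insert_le _ _).trans (Nat.add_le_add_right
      (Finset.card_image_le.trans Finset.card_image_le) 1)
  exact_mod_cast h1

/-- The candidate obtained by rounding down a policy. -/
noncomputable def roundedCand (B T : ℕ) (ε : ℝ) (μ : Measure X) (κ : ℝ) (π : Pol) :
    (discretizedInput B T ε Pol μ κ).cands :=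
  ⟨fun x => Sum.inl (roundDown ε (π.1 x)),
    Input.inl_mem_cands (I := discretizedInput B T ε Pol μ κ) (mem_discretize π.2)⟩

/-- The optimum of the linear program for the rounded policies is at least the benchmark, up to
the discretization error. -/
theorem OPT_le [IsProbabilityMeasure μ] (hT : 1 ≤ T) (hB : 0 < B) (hε : 0 < ε)
    (hPol : ∀ π ∈ Pol, Measurable π) (hκ : 0 < κ) {S : Demand X}
    (hSm : ∀ p, Measurable fun x => S x p) {L : ℝ} (hL0 : 0 ≤ L) (hL : LipschitzDemand S L)
    {Q : (discretizedInput B T ε Pol μ κ).cands → ℝ}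
    (hQ : ((discretizedInput B T ε Pol μ κ).trueOutcomes S).LPPerfect Q) :
    OPT μ S B T Pol ≤ T * (∑ π, Q π * ((discretizedInput B T ε Pol μ κ).trueOutcomes S).reward π +
      (L + 1) * ε + L * ε) := by
  have hI := discretizedInput_proper (B := B) (μ := μ) hT hε hPol hκ
  have hS := measurable_saleProb hSm hL
  have hfe := hI.trueOutcomes_feasible hS
  have hd : ∀ p : unitInterval, |(p : ℝ) - roundDown ε p| ≤ ε := fun p => by
    rw [abs_le]
    constructor <;> linarith [roundDown_le hε p, le_roundDown_add hε p]
  have hmono : ∀ (g : Act → ℝ), Measurable g → (∀ a, 0 ≤ g a) → (∀ a, g a ≤ 1) →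
      ∀ {π : X → unitInterval}, Measurable π →
      Integrable (fun x => saleProb S x (Sum.inl (π x)) * g (Sum.inl (π x))) μ :=
    fun g hg hg0 hg1 π hπ => BenchmarkRule.integrable_priceMean hS hg hg0 hg1 hπ
  refine Real.iSup_le (fun β => ?_) ?_
  · refine BenchmarkRule.expectedReward_le (I := discretizedInput B T ε Pol μ κ) hI hB β hPol hS hQ
      (roundedCand B T ε μ κ) (by positivity) (by positivity) (fun π => ?_) fun π => ?_
    · have h1 := hmono price measurable_price price_nonneg price_le_one (hPol π.1 π.2)
      have h2 := hmono price measurable_price price_nonneg price_le_one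
        ((measurable_roundDown ε).comp (hPol π.1 π.2))
      have h3 := integral_mono (h1.sub (integrable_const ((L + 1) * ε))) h2 fun x => by
        have hp := abs_le.1 (hd (π.1 x))
        have hs := abs_le.1 (hL x (π.1 x) (roundDown ε (π.1 x)))
        have hLd := mul_le_mul_of_nonneg_left (hd (π.1 x)) hL0
        have a1 := (S x (π.1 x)).2
        have a2 := (roundDown ε (π.1 x)).2
        simp only [Pi.sub_apply, Function.comp, saleProb, price, Sum.elim_inl]
        -- `S(p) p - S(p') p' = (S(p) - S(p')) p' + S(p) (p - p')`
        have e1 : ((S x (π.1 x) : ℝ) - S x (roundDown ε (π.1 x))) * roundDown ε (π.1 x) ≤ L * ε := by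
          have : 0 ≤ L * ε := by positivity
          nlinarith [a2.1, a2.2]
        have e2 : (S x (π.1 x) : ℝ) * ((π.1 x : ℝ) - roundDown ε (π.1 x)) ≤ ε := by
          nlinarith [a1.1, a1.2]
        linarith
      have h4 : ∫ x, (saleProb S x (Sum.inl (π.1 x)) * price (Sum.inl (π.1 x)) - (L + 1) * ε) ∂μ =
          priceMean μ S price π.1 - (L + 1) * ε := by
        rw [integral_sub h1 (integrable_const _)]
        simp [priceMean]
      exact h4.symm.trans_le h3
    · have h1 := hmono (fun _ => 1) measurable_const (fun _ => zero_le_one) (fun _ => le_rfl)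
        (hPol π.1 π.2)
      have h2 := hmono (fun _ => 1) measurable_const (fun _ => zero_le_one) (fun _ => le_rfl)
        ((measurable_roundDown ε).comp (hPol π.1 π.2))
      have h3 := integral_mono h2 (h1.add (integrable_const (L * ε))) fun x => by
        have hs := abs_le.1 (hL x (π.1 x) (roundDown ε (π.1 x)))
        have hLd := mul_le_mul_of_nonneg_left (hd (π.1 x)) hL0
        simp only [Pi.add_apply, Function.comp, saleProb, Sum.elim_inl]
        linarith
      have h4 : ∫ x, (saleProb S x (Sum.inl (π.1 x)) * 1 + L * ε) ∂μ =
          priceMean μ S (fun _ => 1) π.1 + L * ε := by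
        rw [integral_add h1 (integrable_const _)]
        simp [priceMean]
      exact h3.trans_eq h4
  · have : 0 ≤ ∑ π, Q π * ((discretizedInput B T ε Pol μ κ).trueOutcomes S).reward π :=
      Input.sum_mul_nonneg_of_mem hQ.1.1 fun π => (hfe π).1.1
    positivity

theorem OPT_le_min [IsProbabilityMeasure μ] (hPol : ∀ π ∈ Pol, Measurable π) {S : Demand X}
    (hSm : ∀ p, Measurable fun x => S x p) {L : ℝ} (hL : LipschitzDemand S L) :
    OPT μ S B T Pol ≤ min (B : ℝ) T := by
  have hS := measurable_saleProb hSm hL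
  refine Real.iSup_le (fun β => ?_) (le_min (Nat.cast_nonneg _) (Nat.cast_nonneg _))
  have := (β.regular (μ := μ) hPol hS).isProbabilityMeasure_historyLaw T
  have hi : Integrable (fun h : History X T => totalReward B h) (historyLaw μ S β.strategy T) :=
    integrable_of_measurable_of_abs_le (measurable_totalReward _ _) (abs_totalReward_le _)
  refine le_min ?_ ?_
  · refine (integral_mono hi (integrable_const (B : ℝ)) fun h => totalReward_le_card B h).trans ?_
    simp
  · refine (integral_mono hi (integrable_const (T : ℝ)) fun h => totalReward_le_rounds B h).trans ?_
    simp

end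

/-! ### Measurable selection of maximizers -/

/-- A measurable selection theorem: if a closed relation `R` has compact target and a continuous
function `g` has at most one maximizer on each fiber, then the maximizer depends measurably on the
base point. -/
theorem exists_measurable_argmax {Y E : Type*} [TopologicalSpace Y] [MeasurableSpace Y]
    [OpensMeasurableSpace Y] [TopologicalSpace E] [CompactSpace E] [MeasurableSpace E]
    [BorelSpace E] {R : Set (Y × E)} (hR : IsClosed R) {g : E → ℝ} (hg : Continuous g)
    (huniq : ∀ y P P', (y, P) ∈ R → (y, P') ∈ R → (∀ Q, (y, Q) ∈ R → g Q ≤ g P) →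
      (∀ Q, (y, Q) ∈ R → g Q ≤ g P') → P = P') (e : E) :
    ∃ F : Y → E, Measurable F ∧ ∀ y, (∃ P, (y, P) ∈ R) →
      (y, F y) ∈ R ∧ ∀ Q, (y, Q) ∈ R → g Q ≤ g (F y) := by
  classical
  have hfib : ∀ y, IsCompact {P | (y, P) ∈ R} := fun y =>
    (hR.preimage (f := fun P : E => (y, P)) (by fun_prop)).isCompact
  have hmax : ∀ y, (∃ P, (y, P) ∈ R) → ∃ P, (y, P) ∈ R ∧ ∀ Q, (y, Q) ∈ R → g Q ≤ g P :=
    fun y hy => by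
      obtain ⟨P, hP, h⟩ := (hfib y).exists_isMaxOn hy hg.continuousOn
      exact ⟨P, hP, fun Q hQ => h hQ⟩
  let F : Y → E := fun y => if hy : ∃ P, (y, P) ∈ R then (hmax y hy).choose else e
  have hF : ∀ y, (∃ P, (y, P) ∈ R) → (y, F y) ∈ R ∧ ∀ Q, (y, Q) ∈ R → g Q ≤ g (F y) :=
    fun y hy => by
      simp only [F, dif_pos hy]
      exact (hmax y hy).choose_spec
  refine ⟨F, measurable_of_isClosed fun C hC => ?_, hF⟩
  -- projections of closed sets along the compact factor are closed
  have hproj : ∀ D : Set E, IsClosed D → MeasurableSet {y | ∃ P, (y, P) ∈ R ∧ P ∈ D} := by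
    intro D hD
    have h1 := isClosedMap_fst_of_compactSpace (X := Y) (Y := E) _
      (hR.inter (hD.preimage continuous_snd))
    have h2 : {y | ∃ P, (y, P) ∈ R ∧ P ∈ D} = Prod.fst '' (R ∩ Prod.snd ⁻¹' D) := by
      ext y
      constructor
      · rintro ⟨P, h⟩
        exact ⟨(y, P), h, rfl⟩
      · rintro ⟨⟨y', P⟩, h, rfl⟩
        exact ⟨P, h⟩
    rw [h2]
    exact h1.measurableSet
  have hlev : ∀ q : ℚ, IsClosed {P : E | (q : ℝ) ≤ g P} := fun q =>
    isClosed_le continuous_const hg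
  have hne := hproj Set.univ isClosed_univ
  have hpre : F ⁻¹' C = ({y | ∃ P, (y, P) ∈ R ∧ P ∈ Set.univ} ∩
      ⋂ q : ℚ, ({y | ∃ P, (y, P) ∈ R ∧ P ∈ {P : E | (q : ℝ) ≤ g P}}ᶜ ∪
        {y | ∃ P, (y, P) ∈ R ∧ P ∈ C ∩ {P : E | (q : ℝ) ≤ g P}})) ∪
      ({y | ∃ P, (y, P) ∈ R ∧ P ∈ Set.univ}ᶜ ∩ {_y | e ∈ C}) := by
    ext y
    by_cases hy : ∃ P, (y, P) ∈ R
    · have hy' : y ∈ {y | ∃ P, (y, P) ∈ R ∧ P ∈ Set.univ} := by simpa using hy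
      have hFy := hF y hy
      simp only [Set.mem_union, Set.mem_inter_iff, hy', true_and, Set.mem_compl_iff, not_true,
        false_and, or_false, Set.mem_iInter]
      constructor
      · intro hFC q
        by_cases hq : y ∈ {y | ∃ P, (y, P) ∈ R ∧ P ∈ {P : E | (q : ℝ) ≤ g P}}
        · obtain ⟨P, hP, hqP⟩ := hq
          exact Or.inr ⟨F y, hFy.1, hFC, le_trans hqP (hFy.2 P hP)⟩
        · exact Or.inl hq
      · intro hall
        have hex : ∀ q : ℚ, (q : ℝ) ≤ g (F y) →
            ∃ P, (y, P) ∈ R ∧ P ∈ C ∩ {P : E | (q : ℝ) ≤ g P} := fun q hq =>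
          (hall q).resolve_left fun h => h ⟨F y, hFy.1, hq⟩
        obtain ⟨q0, hq0⟩ := exists_rat_lt (g (F y))
        obtain ⟨P0, hP0, hP0C, -⟩ := hex q0 hq0.le
        obtain ⟨P1, hP1, h1⟩ := ((hfib y).inter_right hC).exists_isMaxOn ⟨P0, hP0, hP0C⟩
          hg.continuousOn
        have hge : g (F y) ≤ g P1 := by
          by_contra hlt
          obtain ⟨q, hq1, hq2⟩ := exists_rat_btwn (not_le.1 hlt)
          obtain ⟨P, hP, hPC, hqP⟩ := hex q hq2.le
          exact absurd (h1 ⟨hP, hPC⟩) (not_le.2 (hq1.trans_le hqP))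
        have : F y = P1 := huniq y _ _ hFy.1 hP1.1 hFy.2 fun Q hQ => (hFy.2 Q hQ).trans hge
        change F y ∈ C
        rw [this]
        exact hP1.2
    · have hy' : y ∉ {y | ∃ P, (y, P) ∈ R ∧ P ∈ Set.univ} := by simpa using hy
      have hFe : F y = e := by simp only [F, dif_neg hy]
      simp only [Set.mem_union, Set.mem_inter_iff, hy', false_and, false_or, Set.mem_compl_iff,
        not_false_eq_true, true_and]
      change F y ∈ C ↔ e ∈ C
      rw [hFe]
  rw [hpre]
  refine MeasurableSet.union (hne.inter (MeasurableSet.iInter fun q => ?_))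
    (hne.compl.inter (MeasurableSet.const _))
  exact (hproj _ (hlev q)).compl.union (hproj _ (hC.inter (hlev q)))

/-- Carathéodory's theorem with a fixed number of points, parametrized by a compact set. -/
theorem mem_convexHull_iff_exists_fin {ι : Type*} [Fintype ι] {s : Set (ι → ℝ)} {x : ι → ℝ} :
    x ∈ convexHull ℝ s ↔ ∃ (w : stdSimplex ℝ (Fin (Fintype.card ι + 1)))
      (p : Fin (Fintype.card ι + 1) → ι → ℝ), (∀ i, p i ∈ s) ∧ ∑ i, w.1 i • p i = x := by
  classical
  constructor
  · intro hx
    obtain ⟨κ, hκ, z, w, hz, haff, hw, hw1, hsum⟩ := eq_pos_convex_span_of_mem_convexHull hx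
    have hcard : Fintype.card κ ≤ Fintype.card (Fin (Fintype.card ι + 1)) := by
      rw [Fintype.card_fin]
      refine haff.card_le_finrank_succ.trans (Nat.succ_le_succ ?_)
      exact (Submodule.finrank_le _).trans (by simp)
    obtain ⟨e⟩ := Function.Embedding.nonempty_of_card_le hcard
    have hne : Nonempty κ := by
      by_contra h
      rw [not_nonempty_iff] at h
      simp at hw1
    obtain ⟨k⟩ := hne
    have hext : ∀ i, Function.extend e w (fun _ => 0) (e i) = w i := fun i => e.injective.extend_apply _ _ i
    have hextz : ∀ i, Function.extend e z (fun _ => z k) (e i) = z i := fun i =>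
      e.injective.extend_apply _ _ i
    have hnot : ∀ j, j ∉ Set.range e → Function.extend e w (fun _ => 0) j = 0 := fun j hj =>
      Function.extend_apply' _ _ _ fun ⟨i, hi⟩ => hj ⟨i, hi⟩
    refine ⟨⟨Function.extend e w (fun _ => 0), fun j => ?_, ?_⟩, Function.extend e z fun _ => z k,
      fun j => ?_, ?_⟩
    · by_cases hj : j ∈ Set.range e
      · obtain ⟨i, rfl⟩ := hj
        rw [hext]
        exact (hw i).le
      · rw [hnot j hj]
    · rw [← hw1]
      exact (Fintype.sum_of_injective e e.injective _ _ (fun j hj => hnot j hj)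
        fun i => (hext i).symm).symm
    · by_cases hj : j ∈ Set.range e
      · obtain ⟨i, rfl⟩ := hj
        rw [hextz]
        exact hz ⟨i, rfl⟩
      · rw [Function.extend_apply' _ _ _ fun ⟨i, hi⟩ => hj ⟨i, hi⟩]
        exact hz ⟨k, rfl⟩
    · rw [← hsum]
      refine (Fintype.sum_of_injective e e.injective _ _ (fun j hj => ?_) fun i => ?_).symm
      · change Function.extend e w (fun _ => 0) j • _ = _
        rw [hnot j hj, zero_smul]
      · change w i • z i = Function.extend e w (fun _ => 0) (e i) • _
        rw [hext, hextz]
  · rintro ⟨w, p, hp, rfl⟩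
    exact (convex_convexHull ℝ s).sum_mem (fun i _ => w.2.1 i) w.2.2
      fun i _ => subset_convexHull ℝ s (hp i)

/-- The convex hulls of the fibers of a closed relation form a closed relation. -/
theorem isClosed_convexHull_fibers {Y ι : Type*} [TopologicalSpace Y] [Fintype ι]
    {R : Set (Y × stdSimplex ℝ ι)} (hR : IsClosed R) :
    IsClosed {q : Y × stdSimplex ℝ ι |
      q.2.val ∈ convexHull ℝ (Subtype.val '' {P | (q.1, P) ∈ R})} := by
  let n := Fintype.card ι + 1
  have hc : CompactSpace (stdSimplex ℝ (Fin n)) :=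
    isCompact_iff_compactSpace.1 (isCompact_stdSimplex ℝ (Fin n))
  have hc' : CompactSpace (stdSimplex ℝ ι) :=
    isCompact_iff_compactSpace.1 (isCompact_stdSimplex ℝ ι)
  let D : Set ((Y × stdSimplex ℝ ι) × (stdSimplex ℝ (Fin n) × (Fin n → stdSimplex ℝ ι))) :=
    {q | (∀ i, (q.1.1, q.2.2 i) ∈ R) ∧
      ∑ i, q.2.1.val i • (q.2.2 i).val = q.1.2.val}
  have hD : IsClosed D := by
    have h0 : IsClosed {q : (Y × stdSimplex ℝ ι) × (stdSimplex ℝ (Fin n) × (Fin n → stdSimplex ℝ ι)) |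
        ∀ i, (q.1.1, q.2.2 i) ∈ R} := by
      rw [Set.ofPred_forall]
      exact isClosed_iInter fun i => hR.preimage (by fun_prop)
    refine h0.inter (isClosed_eq ?_ ?_)
    · refine continuous_finsetSum _ fun i _ => Continuous.fun_smul ?_ ?_
      · exact (continuous_apply i).comp (continuous_subtype_val.comp
          (continuous_fst.comp continuous_snd))
      · exact continuous_subtype_val.comp ((continuous_apply i).comp
          (continuous_snd.comp continuous_snd))
    · exact continuous_subtype_val.comp (continuous_snd.comp continuous_fst)
  have h1 := isClosedMap_fst_of_compactSpace (Y := stdSimplex ℝ (Fin n) × (Fin n → stdSimplex ℝ ι))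
    _ hD
  convert h1 using 1
  ext ⟨y, P⟩
  rw [Set.mem_ofPred_eq, mem_convexHull_iff_exists_fin]
  constructor
  · rintro ⟨w, p, hp, hsum⟩
    choose p' hp' hpp using hp
    refine ⟨((y, P), (w, p')), ⟨hp', ?_⟩, rfl⟩
    change ∑ i, w.1 i • (p' i).val = P.val
    simp only [hpp]
    exact hsum
  · rintro ⟨⟨⟨y', P'⟩, ⟨w, p⟩⟩, ⟨hp, hsum⟩, h⟩
    obtain ⟨rfl, rfl⟩ := Prod.ext_iff.1 h
    exact ⟨w, fun i => (p i).val, fun i => ⟨p i, hp i, rfl⟩, hsum⟩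

namespace Input

variable {I : Input X}

/-! ### Balanced distributions as maximizers of a potential -/

theorem noisy_combo (P Q : I.cands → ℝ) {a b : ℝ} (hab : a + b = 1) (x : X) (c : Act) :
    I.noisy (a • P + b • Q) x c = a * I.noisy P x c + b * I.noisy Q x c := by
  classical
  have h : ∀ π : I.cands, (if π.1 x = c then (a • P + b • Q) π else 0) =
      a * (if π.1 x = c then P π else 0) + b * (if π.1 x = c then Q π else 0) := fun π => by
    split_ifs <;> simp
  have hsum : (∑ π : I.cands, if π.1 x = c then (a • P + b • Q) π else 0) =
      a * (∑ π : I.cands, if π.1 x = c then P π else 0) +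
        b * (∑ π : I.cands, if π.1 x = c then Q π else 0) := by
    rw [Finset.sum_congr rfl fun π _ => h π, Finset.sum_add_distrib, Finset.mul_sum,
      Finset.mul_sum]
  have hb : b = 1 - a := by linarith
  have e : ∀ R : I.cands → ℝ, I.noisy R x c =
      (1 - I.noise) * (∑ π : I.cands, if π.1 x = c then R π else 0) + I.noise / I.numActs :=
    fun R => by unfold noisy; congr!
  rw [e, e, e, hsum, hb]
  ring

/-- The expected sum of the log-probabilities of all actions, made strictly concave by a small
quadratic term. Its maximizer over a convex set of distributions is balanced with respect to that
set. -/
noncomputable def potential (I : Input X) (P : I.cands → ℝ) : ℝ :=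
  ∫ x, ∑ a ∈ I.acts, Real.log (I.noisy P x a) ∂I.contextLaw - I.noise / 4 * ∑ π, P π ^ 2

variable {P Q : I.cands → ℝ}

theorem Proper.abs_log_noisy_le (hI : I.Proper) (hP : P ∈ stdSimplex ℝ I.cands) (x : X) {a : Act}
    (ha : a ∈ I.acts) : |Real.log (I.noisy P x a)| ≤ -Real.log (I.noise / I.numActs) := by
  have h1 := Real.log_le_log hI.floor_pos (hI.floor_le_noisy hP x a)
  have h2 := Real.log_nonpos (hI.noisy_pos hP x a).le (hI.noisy_le_one hP x ha)
  rw [abs_of_nonpos h2]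
  linarith

theorem Proper.measurable_sum_log (hI : I.Proper) (P : I.cands → ℝ) :
    Measurable fun x => ∑ a ∈ I.acts, Real.log (I.noisy P x a) :=
  Finset.measurable_fun_sum _ fun a _ => Real.measurable_log.comp (hI.measurable_noisy_left P a)

theorem Proper.abs_sum_log_le (hI : I.Proper) (hP : P ∈ stdSimplex ℝ I.cands) (x : X) :
    |∑ a ∈ I.acts, Real.log (I.noisy P x a)| ≤
      I.acts.card • -Real.log (I.noise / I.numActs) :=
  (Finset.abs_sum_le_sum_abs _ _).trans
    (Finset.sum_le_card_nsmul _ _ _ fun _ ha => hI.abs_log_noisy_le hP x ha)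

theorem Proper.integrable_sum_log (hI : I.Proper) (hP : P ∈ stdSimplex ℝ I.cands) :
    Integrable (fun x => ∑ a ∈ I.acts, Real.log (I.noisy P x a)) I.contextLaw := by
  have := hI.isProbabilityMeasure
  exact integrable_of_measurable_of_abs_le (hI.measurable_sum_log P) (hI.abs_sum_log_le hP)

theorem Proper.continuous_potential (hI : I.Proper) :
    Continuous fun P : stdSimplex ℝ I.cands => I.potential P.1 := by
  have := hI.isProbabilityMeasure
  refine Continuous.sub ?_ (by
    refine continuous_const.mul (continuous_finsetSum _ fun π _ => Continuous.pow ?_ 2)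
    exact (continuous_apply π).comp continuous_subtype_val)
  refine continuous_of_dominated
    (bound := fun _ => I.acts.card • -Real.log (I.noise / I.numActs)) (fun P =>
    (hI.measurable_sum_log P.1).aestronglyMeasurable)
    (fun P => Filter.Eventually.of_forall fun x => hI.abs_sum_log_le P.2 x)
    (integrable_const _) (Filter.Eventually.of_forall fun x => ?_)
  refine continuous_finsetSum _ fun a _ => Continuous.log ?_ fun P => (hI.noisy_pos P.2 x a).ne'
  unfold noisy
  refine (continuous_const.mul (continuous_finsetSum _ fun π _ => ?_)).add continuous_const
  split_ifs
  · exact (continuous_apply π).comp continuous_subtype_val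
  · exact continuous_const

/-- By strict concavity, the potential has at most one maximizer on a convex set. -/
theorem Proper.potential_maximizer_unique (hI : I.Proper) {D : Set (I.cands → ℝ)}
    (hD : Convex ℝ D) (hDs : D ⊆ stdSimplex ℝ I.cands) (hP : P ∈ D) (hQ : Q ∈ D)
    (hPm : ∀ R ∈ D, I.potential R ≤ I.potential P) (hQm : ∀ R ∈ D, I.potential R ≤ I.potential Q) :
    P = Q := by
  have hM : (1 / 2 : ℝ) • P + (1 / 2 : ℝ) • Q ∈ D :=
    hD hP hQ (by norm_num) (by norm_num) (by norm_num)
  have h1 := hPm _ hM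
  have h2 := hQm _ hM
  have hPs := hDs hP
  have hQs := hDs hQ
  have hlog : ∫ x, (1 / 2 * ∑ a ∈ I.acts, Real.log (I.noisy P x a) +
      1 / 2 * ∑ a ∈ I.acts, Real.log (I.noisy Q x a)) ∂I.contextLaw ≤
      ∫ x, ∑ a ∈ I.acts, Real.log (I.noisy ((1 / 2 : ℝ) • P + (1 / 2 : ℝ) • Q) x a)
        ∂I.contextLaw := by
    refine integral_mono (((hI.integrable_sum_log hPs).const_mul _).add
      ((hI.integrable_sum_log hQs).const_mul _)) (hI.integrable_sum_log (hDs hM)) fun x => ?_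
    simp only [Finset.mul_sum]
    rw [← Finset.sum_add_distrib]
    refine Finset.sum_le_sum fun a _ => ?_
    rw [noisy_combo P Q (by norm_num)]
    exact strictConcaveOn_log_Ioi.concaveOn.2 (hI.noisy_pos hPs x a) (hI.noisy_pos hQs x a)
      (by norm_num) (by norm_num) (by norm_num)
  rw [integral_add ((hI.integrable_sum_log hPs).const_mul _)
    ((hI.integrable_sum_log hQs).const_mul _), integral_const_mul, integral_const_mul] at hlog
  have hsq : ∑ π, ((1 / 2 : ℝ) • P + (1 / 2 : ℝ) • Q) π ^ 2 =
      1 / 2 * ∑ π, P π ^ 2 + 1 / 2 * ∑ π, Q π ^ 2 - 1 / 4 * ∑ π, (P π - Q π) ^ 2 := by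
    rw [Finset.mul_sum, Finset.mul_sum, Finset.mul_sum, ← Finset.sum_add_distrib,
      ← Finset.sum_sub_distrib]
    refine Finset.sum_congr rfl fun π _ => ?_
    simp only [Pi.add_apply, Pi.smul_apply, smul_eq_mul]
    ring
  simp only [potential, hsq] at h1 h2
  have hq := hI.noise_pos
  have h0 : ∑ π, (P π - Q π) ^ 2 ≤ 0 := by
    by_contra hcon
    push Not at hcon
    nlinarith [mul_pos hq hcon]
  have h3 := (Finset.sum_eq_zero_iff_of_nonneg fun π _ => sq_nonneg (P π - Q π)).1
    (le_antisymm h0 (Finset.sum_nonneg fun π _ => sq_nonneg _))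
  funext π
  have := h3 π (Finset.mem_univ _)
  have := pow_eq_zero_iff two_ne_zero |>.1 this
  linarith

/-- A first-order expansion of the logarithm with explicit remainder. -/
theorem log_combo_ge {f u v τ : ℝ} (hf : 0 < f) (hu : f ≤ u) (hv : f ≤ v) (hu1 : u ≤ 1)
    (hv1 : v ≤ 1) (hτ0 : 0 ≤ τ) (hτ1 : τ ≤ 1) :
    τ * (v / u - 1) - τ ^ 2 / f ^ 2 ≤ Real.log ((1 - τ) * u + τ * v) - Real.log u := by
  have hu0 : 0 < u := hf.trans_le hu
  set w := (1 - τ) * u + τ * v with hw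
  have hfw : f ≤ w := by nlinarith
  have hw0 : 0 < w := hf.trans_le hfw
  rw [← Real.log_div hw0.ne' hu0.ne']
  refine le_trans ?_ (Real.one_sub_inv_le_log_of_pos (div_pos hw0 hu0))
  have e : 1 - (w / u)⁻¹ = τ * (v / u - 1) - τ ^ 2 * ((v - u) ^ 2 / (u * w)) := by
    rw [inv_div]
    field_simp
    rw [hw]
    ring
  rw [e]
  have : (v - u) ^ 2 / (u * w) ≤ 1 / f ^ 2 := by
    rw [div_le_div_iff₀ (by positivity) (by positivity)]
    have h1 : (v - u) ^ 2 ≤ 1 := by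
      rw [sq_le_one_iff_abs_le_one, abs_le]
      constructor <;> linarith
    nlinarith [mul_le_mul hu hfw hf.le hu0.le, sq_nonneg f]
  have h2 := mul_le_mul_of_nonneg_left this (sq_nonneg τ)
  rw [mul_one_div] at h2
  linarith

/-- Moving from a maximizer `P` towards `Q` changes the potential to first order by
`E ∑ₐ Q'(a | x) / P'(a | x) - K`, up to the quadratic term, and this is not positive. -/
theorem Proper.balanced_of_maximizer (hI : I.Proper) {D : Set (I.cands → ℝ)}
    (hD : Convex ℝ D) (hDs : D ⊆ stdSimplex ℝ I.cands) (hP : P ∈ D)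
    (hPm : ∀ R ∈ D, I.potential R ≤ I.potential P) : I.Balanced D P := by
  intro Q hQ
  have := hI.isProbabilityMeasure
  have hPs := hDs hP
  have hQs := hDs hQ
  have hK := I.numActs_pos
  have hq := hI.noise_pos
  have hq2 := I.noise_le_half
  have hf := hI.floor_pos
  set f := I.noise / I.numActs with hfdef
  set Φ := ∫ x, ∑ π : I.cands, Q π / I.noisy P x (π.1 x) ∂I.contextLaw with hΦ
  have hΦ0 : 0 ≤ Φ := integral_nonneg fun x => Finset.sum_nonneg fun π _ =>
    div_nonneg (hQs.1 π) (hI.noisy_pos hPs _ _).le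
  have hint : Integrable (fun x => ∑ π : I.cands, Q π / I.noisy P x (π.1 x)) I.contextLaw := by
    simp only [div_eq_mul_one_div (Q _)]
    exact integrable_finsetSum _ fun π _ => (hI.integrable_inv_noisy hPs π).const_mul _
  have hfirst : ∀ τ : ℝ, 0 < τ → τ ≤ 1 →
      (1 - I.noise) * Φ ≤ I.numActs + τ * (I.numActs / f ^ 2) := by
    intro τ hτ0 hτ1
    have hM : (1 - τ) • P + τ • Q ∈ D := hD hP hQ (by linarith) hτ0.le (by ring)
    have hle := hPm _ hM
    -- the quadratic term changes by at most `4 τ`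
    have hsq : ∑ π, ((1 - τ) • P + τ • Q) π ^ 2 ≤ ∑ π, P π ^ 2 + 4 * τ := by
      have : ∑ π, ((1 - τ) • P + τ • Q) π ^ 2 ≤
          ∑ π, (P π ^ 2 + (2 * τ * Q π + τ * (P π + Q π))) := by
        refine Finset.sum_le_sum fun π _ => ?_
        simp only [Pi.add_apply, Pi.smul_apply, smul_eq_mul]
        have a1 := hPs.1 π
        have a2 := hQs.1 π
        have a3 : P π ≤ 1 := hPs.2 ▸ Finset.single_le_sum (fun π _ => hPs.1 π) (Finset.mem_univ π)
        have a4 : Q π ≤ 1 := hQs.2 ▸ Finset.single_le_sum (fun π _ => hQs.1 π) (Finset.mem_univ π)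
        have e : ((1 - τ) * P π + τ * Q π) ^ 2 = P π ^ 2 + 2 * τ * (P π * Q π) - 2 * τ * P π ^ 2 +
          τ ^ 2 * (Q π - P π) ^ 2 := by ring
        rw [e]
        have b1 : P π * Q π ≤ Q π := mul_le_of_le_one_left a2 a3
        have b2 : (Q π - P π) ^ 2 ≤ P π + Q π := by nlinarith [mul_nonneg a1 a2]
        have b3 : τ ^ 2 * (Q π - P π) ^ 2 ≤ τ * (P π + Q π) := by
          have : τ ^ 2 ≤ τ := by nlinarith
          exact mul_le_mul this b2 (sq_nonneg _) hτ0.le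
        nlinarith [sq_nonneg (P π), mul_le_mul_of_nonneg_left b1 hτ0.le]
      refine this.trans (le_of_eq ?_)
      rw [Finset.sum_add_distrib, Finset.sum_add_distrib, ← Finset.mul_sum, ← Finset.mul_sum,
        Finset.sum_add_distrib, hPs.2, hQs.2]
      ring
    have hpt : ∀ x, τ * ((1 - I.noise) * ∑ π : I.cands, Q π / I.noisy P x (π.1 x) + I.noise -
        I.numActs) - τ ^ 2 * (I.numActs / f ^ 2) ≤
        ∑ a ∈ I.acts, Real.log (I.noisy ((1 - τ) • P + τ • Q) x a) -
          ∑ a ∈ I.acts, Real.log (I.noisy P x a) := by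
      intro x
      rw [← Finset.sum_sub_distrib]
      have h1 : ∑ a ∈ I.acts, (τ * (I.noisy Q x a / I.noisy P x a - 1) - τ ^ 2 / f ^ 2) ≤
          ∑ a ∈ I.acts, (Real.log (I.noisy ((1 - τ) • P + τ • Q) x a) -
            Real.log (I.noisy P x a)) := by
        refine Finset.sum_le_sum fun a ha => ?_
        rw [noisy_combo P Q (by ring)]
        exact log_combo_ge hf (hI.floor_le_noisy hPs x a) (hI.floor_le_noisy hQs x a)
          (hI.noisy_le_one hPs x ha) (hI.noisy_le_one hQs x ha) hτ0.le hτ1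
      refine le_trans ?_ h1
      have hcard : (I.acts.card : ℝ) = I.numActs := rfl
      rw [Finset.sum_sub_distrib, ← Finset.mul_sum, Finset.sum_sub_distrib]
      simp only [Finset.sum_const, nsmul_eq_mul, hcard, mul_one]
      have hQn : (1 - I.noise) * ∑ π : I.cands, Q π / I.noisy P x (π.1 x) + I.noise ≤
          ∑ a ∈ I.acts, I.noisy Q x a / I.noisy P x a := by
        have e1 : ∑ a ∈ I.acts, I.noisy Q x a / I.noisy P x a =
            (1 - I.noise) * ∑ π : I.cands, Q π / I.noisy P x (π.1 x) +
              ∑ a ∈ I.acts, f * (1 / I.noisy P x a) := by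
          have := hI.sum_acts_mul_ite Q x fun a => 1 / I.noisy P x a
          simp only [mul_one_div] at this
          rw [← this, Finset.mul_sum, ← Finset.sum_add_distrib]
          refine Finset.sum_congr rfl fun a _ => ?_
          simp only [noisy, hfdef]
          ring
        have e2 : I.noise ≤ ∑ a ∈ I.acts, f * (1 / I.noisy P x a) := by
          calc I.noise = ∑ _a ∈ I.acts, f := by
                rw [Finset.sum_const, nsmul_eq_mul, hcard, hfdef, mul_div_cancel₀ _ hK.ne']
            _ ≤ _ := Finset.sum_le_sum fun a ha => le_mul_of_one_le_right hf.le
                ((one_le_div (hI.noisy_pos hPs x a)).2 (hI.noisy_le_one hPs x ha))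
        linarith
      have h2 := mul_le_mul_of_nonneg_left hQn hτ0.le
      have e3 : I.numActs * (τ ^ 2 / f ^ 2) = τ ^ 2 * (I.numActs / f ^ 2) := by ring
      rw [e3]
      linarith
    have hi1 := hI.integrable_sum_log (hDs hM)
    have hi2 := hI.integrable_sum_log hPs
    have hint1 : Integrable (fun x => (1 - I.noise) * ∑ π : I.cands, Q π / I.noisy P x (π.1 x))
      I.contextLaw := hint.const_mul _
    have hint2 : Integrable (fun x => (1 - I.noise) * ∑ π : I.cands, Q π / I.noisy P x (π.1 x) +
      I.noise) I.contextLaw := hint1.add (integrable_const _)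
    have hint3 : Integrable (fun x => (1 - I.noise) * ∑ π : I.cands, Q π / I.noisy P x (π.1 x) +
      I.noise - I.numActs) I.contextLaw := hint2.sub (integrable_const _)
    have hmono := integral_mono ((hint3.const_mul τ).sub
      (integrable_const (τ ^ 2 * (I.numActs / f ^ 2)))) (hi1.sub hi2) hpt
    have hl : ∫ x, (τ * ((1 - I.noise) * ∑ π : I.cands, Q π / I.noisy P x (π.1 x) + I.noise -
        I.numActs) - τ ^ 2 * (I.numActs / f ^ 2)) ∂I.contextLaw =
        τ * ((1 - I.noise) * Φ + I.noise - I.numActs) - τ ^ 2 * (I.numActs / f ^ 2) := by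
      rw [integral_sub (hint3.const_mul τ) (integrable_const _), integral_const_mul,
        integral_sub hint2 (integrable_const _), integral_add hint1 (integrable_const _),
        integral_const_mul]
      simp [hΦ]
    have hr : ∫ x, (∑ a ∈ I.acts, Real.log (I.noisy ((1 - τ) • P + τ • Q) x a) -
          ∑ a ∈ I.acts, Real.log (I.noisy P x a)) ∂I.contextLaw ≤ I.noise * τ := by
      rw [integral_sub hi1 hi2]
      unfold potential at hle
      nlinarith [mul_le_mul_of_nonneg_left hsq hq.le]
    have hfin := hl.symm.trans_le (le_trans hmono hr)
    have : τ * ((1 - I.noise) * Φ) ≤ τ * (I.numActs + τ * (I.numActs / f ^ 2)) := by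
      linarith
    exact le_of_mul_le_mul_left this hτ0
  -- let `τ` tend to zero
  have hlim : (1 - I.noise) * Φ ≤ I.numActs := by
    refine le_of_forall_pos_le_add fun δ hδ => ?_
    have hc : 0 < I.numActs / f ^ 2 := by positivity
    refine (hfirst (min 1 (δ / (I.numActs / f ^ 2))) (lt_min one_pos (by positivity))
      (min_le_left _ _)).trans ?_
    have := mul_le_mul_of_nonneg_right (min_le_right 1 (δ / (I.numActs / f ^ 2))) hc.le
    rw [div_mul_cancel₀ _ hc.ne'] at this
    linarith
  -- `1 - q₀ ≥ 1 / 2`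
  nlinarith

end Input

namespace Input

variable {I : Input X}

/-! ### Existence of the algorithm's choices -/

/-- The statistics that determine the confidence region after `t` rounds: reward estimates, sales
estimates and confidence radii after `s ≤ t` rounds. -/
abbrev Stats (I : Input X) (t : ℕ) : Type _ :=
  (Fin (t + 1) → I.cands → ℝ) × (Fin (t + 1) → I.cands → ℝ) × (Fin (t + 1) → I.cands → ℝ)

/-- The statistics of a history. -/
noncomputable def stats (ρ : I.MixtureRule) {t : ℕ} (h : History X t) : I.Stats t :=
  (fun s π => estReward ρ (h.take s (Nat.lt_succ_iff.1 s.2)) π,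
    fun s π => estSales ρ (h.take s (Nat.lt_succ_iff.1 s.2)) π,
    fun s π => radius ρ (h.take s (Nat.lt_succ_iff.1 s.2)) π)

/-- The confidence region determined by given statistics. -/
def region {t : ℕ} (b : I.Stats t) : Set I.Outcomes :=
  {m | m.Feasible ∧ ∀ s : Fin (t + 1), 0 < (s : ℕ) → ∀ π : I.cands,
    |b.1 s π - m.reward π| ≤ b.2.2 s π ∧ |b.2.1 s π - m.sales π| ≤ b.2.2 s π}

/-- The potentially perfect distributions determined by given statistics. -/
def perfect {t : ℕ} (b : I.Stats t) : Set (I.cands → ℝ) :=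
  {P | ∃ m ∈ region b, m.LPPerfect P}

theorem confRegion_eq (ρ : I.MixtureRule) {t : ℕ} (h : History X t) :
    confRegion ρ h = region (stats ρ h) := by
  ext m
  refine and_congr_right fun _ => ⟨fun H s hs => H s (Nat.lt_succ_iff.1 s.2) hs,
    fun H s hs hs0 => H ⟨s, Nat.lt_succ_iff.2 hs⟩ hs0⟩

theorem potentiallyPerfect_eq (ρ : I.MixtureRule) {t : ℕ} (h : History X t) :
    potentiallyPerfect ρ h = perfect (stats ρ h) := by
  unfold potentiallyPerfect perfect
  rw [confRegion_eq]

theorem perfect_subset {t : ℕ} (b : I.Stats t) : perfect b ⊆ stdSimplex ℝ I.cands := by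
  rintro P ⟨m, -, hP⟩
  exact hP.1.1

theorem stats_congr {ρ ρ' : I.MixtureRule} {t : ℕ} (hρ : ∀ i < t, ρ i = ρ' i)
    (h : History X t) : stats ρ h = stats ρ' h := by
  have hsum : ∀ (G : (I.cands → ℝ) → Round X → ℝ) (s : ℕ) (hs : s ≤ t),
      pathSum (fun i g o => G (ρ i g) o) (h.take s hs) =
        pathSum (fun i g o => G (ρ' i g) o) (h.take s hs) := fun G s hs =>
    Finset.sum_congr rfl fun i _ => by beta_reduce; rw [hρ i (i.2.trans_le hs)]
  have h1 : ∀ (s : Fin (t + 1)) π, estReward ρ (h.take s (Nat.lt_succ_iff.1 s.2)) π =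
      estReward ρ' (h.take s (Nat.lt_succ_iff.1 s.2)) π := fun s π => by
    rw [estReward_eq, estReward_eq, hsum (I.score price π)]
  have h2 : ∀ (s : Fin (t + 1)) π, estSales ρ (h.take s (Nat.lt_succ_iff.1 s.2)) π =
      estSales ρ' (h.take s (Nat.lt_succ_iff.1 s.2)) π := fun s π => by
    rw [estSales_eq, estSales_eq, hsum (I.score (fun _ => 1) π)]
  have h3 : ∀ (s : Fin (t + 1)) π, radius ρ (h.take s (Nat.lt_succ_iff.1 s.2)) π =
      radius ρ' (h.take s (Nat.lt_succ_iff.1 s.2)) π := fun s π => by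
    unfold radius
    rw [varProxy_eq, varProxy_eq, hsum fun P _ => I.scoreVar π P]
  exact Prod.ext (funext fun s => funext (h1 s))
    (Prod.ext (funext fun s => funext (h2 s)) (funext fun s => funext (h3 s)))

theorem Proper.measurable_stats (hI : I.Proper) {ρ : I.MixtureRule} (hρ : ∀ t, Measurable (ρ t))
    (t : ℕ) : Measurable fun h : History X t => stats ρ h := by
  have hsc : ∀ (g : Act → ℝ), Measurable g → ∀ (π : I.cands) (s : ℕ),
      Measurable fun h : History X s => pathSum (fun i g' o => I.score g π (ρ i g') o) h / s :=
    fun g hg π s => (measurable_pathSum (G := fun i g' o => I.score g π (ρ i g') o)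
      (fun i => (hI.measurable_score hg π).comp
        (f := fun q : History X i × Round X => (ρ i q.1, q.2))
        (((hρ i).comp measurable_fst).prodMk measurable_snd)) s).div_const _
  have hvar : ∀ (π : I.cands) (s : ℕ), Measurable fun h : History X s => varProxy ρ h π :=
    fun π s => (measurable_pathSum (G := fun i g' _ => I.scoreVar π (ρ i g'))
      (fun i => (hI.measurable_scoreVar_comp hρ π i).comp measurable_fst) s).div_const _
  have hrad : ∀ (π : I.cands) (s : ℕ), Measurable fun h : History X s => radius ρ h π :=
    fun π s => ((((hvar π s).const_mul _).div_const _).sqrt).add_const _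
  refine Measurable.prodMk ?_ (Measurable.prodMk ?_ ?_)
  · exact measurable_pi_lambda _ fun s => measurable_pi_lambda _ fun π =>
      (hsc price measurable_price π s).comp (measurable_take _ _)
  · exact measurable_pi_lambda _ fun s => measurable_pi_lambda _ fun π =>
      (hsc _ measurable_const π s).comp (measurable_take _ _)
  · exact measurable_pi_lambda _ fun s => measurable_pi_lambda _ fun π =>
      (hrad π s).comp (measurable_take _ _)

/-- The first `n` steps of the recursion that defines a mixture rule from a rule `Φ` based on the
statistics: from round `n` on, a fixed distribution is used. -/
noncomputable def ruleApprox (I : Input X) (Φ : (t : ℕ) → I.Stats t → stdSimplex ℝ I.cands)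
    (e : stdSimplex ℝ I.cands) : ℕ → I.MixtureRule
  | 0 => fun _ _ => e.1
  | n + 1 => Function.update (ruleApprox I Φ e n) n
      fun h => (Φ n (stats (ruleApprox I Φ e n) h)).1

/-- A measurable choice based on the statistics defines a mixture rule by recursion on the
rounds. -/
theorem Proper.exists_rule (hI : I.Proper) (Φ : (t : ℕ) → I.Stats t → stdSimplex ℝ I.cands)
    (hΦ : ∀ t, Measurable (Φ t)) (e : stdSimplex ℝ I.cands) :
    ∃ ρ : I.MixtureRule, (∀ t, Measurable (ρ t)) ∧
      ∀ t (h : History X t), ρ t h = (Φ t (stats ρ h)).1 := by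
  let R := ruleApprox I Φ e
  have hsucc : ∀ n, R (n + 1) = Function.update (R n) n fun h => (Φ n (stats (R n) h)).1 :=
    fun n => rfl
  have hR : ∀ n t, Measurable (R n t) := by
    intro n
    induction n with
    | zero => exact fun t => measurable_const
    | succ n ih =>
      intro t
      rw [hsucc]
      rcases eq_or_ne t n with rfl | hne
      · rw [Function.update_self]
        exact measurable_subtype_coe.comp ((hΦ t).comp (hI.measurable_stats ih t))
      · rw [Function.update_of_ne hne]
        exact ih t
  have hstab : ∀ t n, t < n → R n t = R (t + 1) t := by
    intro t n hn
    induction n, hn using Nat.le_induction with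
    | base => rfl
    | succ n hn ih =>
      rw [hsucc, Function.update_of_ne (by omega), ih]
  refine ⟨fun t => R (t + 1) t, fun t => hR _ _, fun t h => ?_⟩
  have h1 : stats (fun t => R (t + 1) t : I.MixtureRule) h = stats (R t) h :=
    stats_congr (fun i hi => (hstab i t hi).symm) h
  rw [h1]
  change R (t + 1) t h = _
  rw [hsucc, Function.update_self]

theorem isClosed_ofPred_forall {α : Sort*} {E : Type*} [TopologicalSpace E] {p : α → E → Prop}
    (h : ∀ a, IsClosed {z | p a z}) : IsClosed {z | ∀ a, p a z} := by
  rw [Set.ofPred_forall]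
  exact isClosed_iInter h

instance (t : ℕ) : OpensMeasurableSpace (I.Stats t) := by
  have h1 : SecondCountableTopology (I.cands → ℝ) := inferInstance
  have h2 : OpensMeasurableSpace (I.cands → ℝ) := Pi.opensMeasurableSpace
  have h3 : OpensMeasurableSpace (Fin (t + 1) → I.cands → ℝ) := Pi.opensMeasurableSpace
  have h4 : SecondCountableTopology (Fin (t + 1) → I.cands → ℝ) := inferInstance
  infer_instance

/-- The compact space of all outcome tuples with values in the unit interval: rewards and sales. -/
abbrev Cube (I : Input X) : Type _ := (I.cands → unitInterval) × (I.cands → unitInterval)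

/-- The outcome tuple with given coordinates in the unit interval. -/
def cubeOutcomes (I : Input X) (q : I.Cube) : I.Outcomes :=
  ⟨fun π => q.1 π, fun π => q.2 π⟩

/-- If the supply is positive, potential perfection is a closed condition on the statistics and the
distribution. -/
theorem isClosed_perfect (hB : 0 < (I.B : ℝ) / I.T) (t : ℕ) :
    IsClosed {q : I.Stats t × stdSimplex ℝ I.cands | q.2.1 ∈ perfect q.1} := by
  let D : Set ((I.Stats t × stdSimplex ℝ I.cands) × I.Cube) :=
    {z | ((I.cubeOutcomes z.2).reward I.nullPolicy = 0 ∧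
      (I.cubeOutcomes z.2).sales I.nullPolicy = 0) ∧
      (∀ s : Fin (t + 1), 0 < (s : ℕ) → ∀ π : I.cands,
        |z.1.1.1 s π - (I.cubeOutcomes z.2).reward π| ≤ z.1.1.2.2 s π ∧
        |z.1.1.2.1 s π - (I.cubeOutcomes z.2).sales π| ≤ z.1.1.2.2 s π) ∧
      ∑ π, z.1.2.1 π * (I.cubeOutcomes z.2).sales π ≤ I.B / I.T ∧
      ∀ Q ∈ stdSimplex ℝ I.cands,
        (∑ π, Q π * (I.cubeOutcomes z.2).reward π) * (I.B / I.T) ≤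
          (∑ π, z.1.2.1 π * (I.cubeOutcomes z.2).reward π) *
            max (I.B / I.T : ℝ) (∑ π, Q π * (I.cubeOutcomes z.2).sales π)}
  have cr : ∀ π, Continuous fun z : (I.Stats t × stdSimplex ℝ I.cands) × I.Cube =>
      (I.cubeOutcomes z.2).reward π := fun π => continuous_subtype_val.comp
    ((continuous_apply π).comp (continuous_fst.comp continuous_snd))
  have cs : ∀ π, Continuous fun z : (I.Stats t × stdSimplex ℝ I.cands) × I.Cube =>
      (I.cubeOutcomes z.2).sales π := fun π => continuous_subtype_val.comp
    ((continuous_apply π).comp (continuous_snd.comp continuous_snd))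
  have cP : ∀ π, Continuous fun z : (I.Stats t × stdSimplex ℝ I.cands) × I.Cube => z.1.2.1 π :=
    fun π => (continuous_apply π).comp (continuous_subtype_val.comp
      (continuous_snd.comp continuous_fst))
  have hD : IsClosed D := by
    refine IsClosed.inter ?_ (IsClosed.inter ?_ (IsClosed.inter ?_ ?_))
    · exact (isClosed_eq (cr _) continuous_const).inter (isClosed_eq (cs _) continuous_const)
    · refine isClosed_ofPred_forall fun s => isClosed_ofPred_forall fun _ =>
        isClosed_ofPred_forall fun π => ?_
      exact (isClosed_le (Continuous.abs (Continuous.sub (by fun_prop) (cr π))) (by fun_prop)).inter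
        (isClosed_le (Continuous.abs (Continuous.sub (by fun_prop) (cs π))) (by fun_prop))
    · exact isClosed_le (continuous_finsetSum _ fun π _ => (cP π).mul (cs π)) continuous_const
    · refine isClosed_ofPred_forall fun Q => isClosed_ofPred_forall fun _ => isClosed_le ?_ ?_
      · exact (continuous_finsetSum _ fun π _ => continuous_const.mul (cr π)).mul continuous_const
      · exact (continuous_finsetSum _ fun π _ => (cP π).mul (cr π)).mul
          (continuous_const.max (continuous_finsetSum _ fun π _ => continuous_const.mul (cs π)))
  convert isClosedMap_fst_of_compactSpace (Y := I.Cube) _ hD using 1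
  ext ⟨b, P⟩
  constructor
  · rintro ⟨m, ⟨hm, hreg⟩, hP⟩
    have hP' := (Outcomes.lpPerfect_iff hm hB).1 hP
    exact ⟨((b, P), (fun π => ⟨m.reward π, (hm π).1⟩, fun π => ⟨m.sales π, (hm π).2.1⟩)),
      ⟨hm.null, hreg, hP'.1.2, hP'.2⟩, rfl⟩
  · rintro ⟨⟨⟨b', P'⟩, q⟩, ⟨hnull, hreg, hPf, hPo⟩, h⟩
    obtain ⟨rfl, rfl⟩ := Prod.ext_iff.1 h
    have hm : (I.cubeOutcomes q).Feasible := fun π => ⟨(q.1 π).2, (q.2 π).2, fun h => by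
      have : π = I.nullPolicy := Subtype.ext h
      rw [this]
      exact hnull⟩
    exact ⟨I.cubeOutcomes q, ⟨hm, hreg⟩, (Outcomes.lpPerfect_iff hm hB).2 ⟨⟨P'.2, hPf⟩, hPo⟩⟩

/-- The distribution concentrated on the null policy. -/
noncomputable def nullDist (I : Input X) : stdSimplex ℝ I.cands :=
  ⟨fun π => open Classical in if π = I.nullPolicy then 1 else 0,
    fun π => by beta_reduce; split_ifs <;> simp, by simp⟩

theorem Proper.exists_isCBalance_of_pos (hI : I.Proper) (hB : 0 < I.B) :
    ∃ ρ : I.MixtureRule, IsCBalance ρ := by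
  have hβ := hI.supplyRate_pos hB
  have hc : CompactSpace (stdSimplex ℝ I.cands) :=
    isCompact_iff_compactSpace.1 (isCompact_stdSimplex ℝ I.cands)
  have himg : ∀ (t : ℕ) (b : I.Stats t),
      Subtype.val '' {P : stdSimplex ℝ I.cands | P.1 ∈ perfect b} = perfect b := fun t b => by
    ext P
    constructor
    · rintro ⟨P, hP, rfl⟩
      exact hP
    · intro hP
      exact ⟨⟨P, perfect_subset b hP⟩, hP, rfl⟩
  have hsub : ∀ (t : ℕ) (b : I.Stats t), convexHull ℝ (perfect b) ⊆ stdSimplex ℝ I.cands :=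
    fun t b => convexHull_min (perfect_subset b) (convex_stdSimplex ℝ _)
  have hsel : ∀ t : ℕ, ∃ Φ : I.Stats t → stdSimplex ℝ I.cands, Measurable Φ ∧
      ∀ b, (perfect b).Nonempty → (Φ b).1 ∈ convexHull ℝ (perfect b) ∧
        ∀ Q ∈ convexHull ℝ (perfect b), I.potential Q ≤ I.potential (Φ b).1 := by
    intro t
    have hcl := isClosed_convexHull_fibers (isClosed_perfect hβ t)
    simp only [Set.mem_ofPred_eq, himg] at hcl
    obtain ⟨Φ, hΦm, hΦ⟩ := exists_measurable_argmax hcl hI.continuous_potential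
      (fun b P P' hP hP' hPm hPm' => Subtype.ext
        (hI.potential_maximizer_unique (convex_convexHull ℝ (perfect b)) (hsub t b) hP hP'
          (fun R hR => hPm ⟨R, hsub t b hR⟩ hR) fun R hR => hPm' ⟨R, hsub t b hR⟩ hR)) I.nullDist
    refine ⟨Φ, hΦm, fun b hb => ?_⟩
    obtain ⟨P, hP⟩ := hb
    have := hΦ b ⟨⟨P, perfect_subset b hP⟩, subset_convexHull ℝ _ hP⟩
    exact ⟨this.1, fun Q hQ => this.2 ⟨Q, hsub t b hQ⟩ hQ⟩
  choose Φ hΦm hΦ using hsel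
  obtain ⟨ρ, hρm, hρ⟩ := hI.exists_rule Φ hΦm I.nullDist
  refine ⟨ρ, hρm, fun t h => ?_, fun t h hne => ?_, fun t h hne => ?_⟩
  · rw [hρ]
    exact (Φ t (stats ρ h)).2
  · rw [potentiallyPerfect_eq] at hne ⊢
    rw [hρ]
    exact (hΦ t _ hne).1
  · rw [potentiallyPerfect_eq] at hne ⊢
    rw [hρ]
    exact hI.balanced_of_maximizer (convex_convexHull ℝ _) (hsub t _) (hΦ t _ hne).1 (hΦ t _ hne).2

theorem half_le_noisy {P : I.cands → ℝ} (hI : I.Proper) (hP : P ∈ stdSimplex ℝ I.cands)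
    (π : I.cands) (x : X) : P π / 2 ≤ I.noisy P x (π.1 x) := by
  classical
  have h1 : P π ≤ ∑ π' : I.cands, if π'.1 x = π.1 x then P π' else 0 := by
    have := Finset.single_le_sum (f := fun π' : I.cands => if π'.1 x = π.1 x then P π' else 0)
      (fun π' _ => by
        split_ifs
        · exact hP.1 π'
        · exact le_rfl) (Finset.mem_univ π)
    simpa using this
  have h2 := hI.floor_pos
  have h3 := I.noise_le_half
  have h4 := hP.1 π
  have e : I.noisy P x (π.1 x) = (1 - I.noise) * (∑ π' : I.cands,
      if π'.1 x = π.1 x then P π' else 0) + I.noise / I.numActs := by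
    unfold noisy; congr!
  rw [e]
  nlinarith

/-- A distribution that puts weight at least `1 / 2` on the support of every `Q ∈ D` is balanced
with respect to `D`, if there are at least two actions. -/
theorem Proper.balanced_of_half_le (hI : I.Proper) (hK : 2 ≤ I.numActs) {D : Set (I.cands → ℝ)}
    (hD : D ⊆ stdSimplex ℝ I.cands) {P : I.cands → ℝ} (hP : P ∈ stdSimplex ℝ I.cands)
    (h : ∀ Q ∈ D, ∀ π, Q π ≠ 0 → 1 / 2 ≤ P π) : I.Balanced D P := by
  intro Q hQ
  have := hI.isProbabilityMeasure
  refine (le_abs_self _).trans (abs_integral_le_of_abs_le fun x => ?_)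
  rw [abs_of_nonneg (Finset.sum_nonneg fun π _ => div_nonneg ((hD hQ).1 π)
    (hI.noisy_pos hP _ _).le)]
  calc ∑ π : I.cands, Q π / I.noisy P x (π.1 x) ≤ ∑ π, Q π * 4 := by
        refine Finset.sum_le_sum fun π _ => ?_
        by_cases h0 : Q π = 0
        · simp [h0]
        · rw [div_le_iff₀ (hI.noisy_pos hP _ _)]
          have h1 := h Q hQ π h0
          have h2 := half_le_noisy hI hP π x
          nlinarith [(hD hQ).1 π]
    _ = 4 := by rw [← Finset.sum_mul, (hD hQ).2, one_mul]
    _ ≤ 2 * I.numActs := by linarith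

/-- Without supply and with price zero only, the algorithm's choices exist: if the zero tuple is in
the confidence region, then every distribution is potentially perfect, and the uniform distribution
on the null policy and the policy `z` that posts price zero is balanced; otherwise only the null
policy can be potentially perfect. (Closedness may fail here, which is why this case is separate.) -/
theorem Proper.exists_isCBalance_of_zero (hI : I.Proper) (hB : I.B = 0) (hK : 2 ≤ I.numActs)
    {z : I.cands} (hz : ∀ π : I.cands, π ≠ I.nullPolicy → π = z) (hzn : z ≠ I.nullPolicy)
    (hprice : ∀ x, price (z.1 x) = 0) : ∃ ρ : I.MixtureRule, IsCBalance ρ := by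
  classical
  let m₀ : I.Outcomes := ⟨fun _ => 0, fun _ => 0⟩
  let mid : stdSimplex ℝ I.cands := ⟨fun π => if π = I.nullPolicy ∨ π = z then 1 / 2 else 0,
    fun π => by beta_reduce; split_ifs <;> norm_num, by
      have : ∀ π : I.cands, (if π = I.nullPolicy ∨ π = z then (1 / 2 : ℝ) else 0) =
          (if π = I.nullPolicy then 1 / 2 else 0) + if π = z then 1 / 2 else 0 := by
        intro π
        by_cases h1 : π = I.nullPolicy
        · subst h1
          simp [hzn.symm]
        · simp [h1]
      rw [Finset.sum_congr rfl fun π _ => this π, Finset.sum_add_distrib]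
      simp only [Finset.sum_ite_eq', Finset.mem_univ, if_true]
      norm_num⟩
  have hm₀ : m₀.Feasible := fun π => ⟨⟨le_rfl, zero_le_one⟩, ⟨le_rfl, zero_le_one⟩,
    fun _ => ⟨rfl, rfl⟩⟩
  let Φ : (t : ℕ) → I.Stats t → stdSimplex ℝ I.cands := fun t b =>
    if m₀ ∈ region b then mid else I.nullDist
  have hΦ : ∀ t, Measurable (Φ t) := by
    intro t
    refine Measurable.ite (IsClosed.measurableSet ?_) measurable_const measurable_const
    refine IsClosed.inter isClosed_const ?_
    refine isClosed_ofPred_forall fun s => isClosed_ofPred_forall fun _ =>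
      isClosed_ofPred_forall fun π => ?_
    exact (isClosed_le (f := fun b : I.Stats t => |b.1 s π - 0|) (g := fun b => b.2.2 s π)
      (by fun_prop) (by fun_prop)).inter
      (isClosed_le (f := fun b : I.Stats t => |b.2.1 s π - 0|) (g := fun b => b.2.2 s π)
        (by fun_prop) (by fun_prop))
  obtain ⟨ρ, hρm, hρ⟩ := hI.exists_rule Φ hΦ I.nullDist
  have hBT : (I.B : ℝ) / I.T = 0 := by simp [hB]
  -- the reward estimates vanish
  have hest : ∀ (s : ℕ) (g : History X s) (π : I.cands), estReward ρ g π = 0 := by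
    intro s g π
    have hp : ∀ x, price (π.1 x) = 0 := fun x => by
      by_cases h : π = I.nullPolicy
      · rw [h]; rfl
      · rw [hz π h]; exact hprice x
    rw [estReward_eq]
    have : pathSum (fun i g' o => I.score price π (ρ i g') o) g = 0 := by
      refine Finset.sum_eq_zero fun i _ => ?_
      unfold score
      by_cases h : (g i).2.1 = π.1 (g i).1
      · beta_reduce
        rw [h, hp]
        simp
      · simp [h]
    rw [this, zero_div]
  have hpos : ∀ (t : ℕ) (h : History X t), m₀ ∈ region (stats ρ h) →
      ∀ P ∈ stdSimplex ℝ I.cands, P ∈ potentiallyPerfect ρ h := by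
    intro t h hm P hP
    rw [potentiallyPerfect_eq]
    refine ⟨m₀, hm, ⟨hP, ?_⟩, fun Q _ => ?_⟩
    · simp [m₀, hBT]
    · simp [m₀]
  have hneg : ∀ (t : ℕ) (h : History X t), m₀ ∉ region (stats ρ h) →
      potentiallyPerfect ρ h ⊆ {I.nullDist.1} := by
    rintro t h hm P ⟨m, hmr, hP⟩
    have hsz : m.sales z ≠ 0 := by
      intro h0
      refine hm ?_
      rw [← confRegion_eq]
      refine ⟨hm₀, fun s hs hs0 π => ?_⟩
      have hb := hmr.2 s hs hs0 π
      refine ⟨?_, ?_⟩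
      · rw [hest]
        simp only [m₀, sub_zero, abs_zero]
        exact (abs_nonneg _).trans hb.1
      · have : m.sales π = 0 := by
          by_cases hπ : π = I.nullPolicy
          · rw [hπ]; exact hmr.1.null.2
          · rw [hz π hπ, h0]
        rw [this] at hb
        exact hb.2
    have hPs := hP.1.1
    have hle := hP.1.2
    rw [hBT] at hle
    have hall := (Finset.sum_eq_zero_iff_of_nonneg fun π _ =>
      mul_nonneg (hPs.1 π) (hmr.1 π).2.1.1).1 (le_antisymm hle (sum_mul_nonneg_of_mem hPs
        fun π => (hmr.1 π).2.1.1))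
    have hPz : P z = 0 := (mul_eq_zero.1 (hall z (Finset.mem_univ _))).resolve_right hsz
    have hP0 : ∀ π, π ≠ I.nullPolicy → P π = 0 := fun π hπ => by rw [hz π hπ, hPz]
    have hP1 : P I.nullPolicy = 1 := by
      rw [← hPs.2]
      exact (Finset.sum_eq_single _ (fun π _ hπ => hP0 π hπ) (by simp)).symm
    rw [Set.mem_singleton_iff]
    funext π
    change P π = if π = I.nullPolicy then 1 else 0
    split_ifs with hπ
    · rw [hπ, hP1]
    · exact hP0 π hπ
  have hsub : ∀ (t : ℕ) (h : History X t),
      convexHull ℝ (potentiallyPerfect ρ h) ⊆ stdSimplex ℝ I.cands := fun t h =>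
    convexHull_min (potentiallyPerfect_subset ρ h) (convex_stdSimplex ℝ _)
  refine ⟨ρ, hρm, fun t h => ?_, fun t h hne => ?_, fun t h hne => ?_⟩
  · rw [hρ]
    exact (Φ t (stats ρ h)).2
  · by_cases hm : m₀ ∈ region (stats ρ h)
    · exact subset_convexHull ℝ _ (hpos t h hm _ (by rw [hρ]; exact (Φ t _).2))
    · obtain ⟨P, hP⟩ := hne
      have h1 := hneg t h hm hP
      have h2 : ρ t h = I.nullDist.1 := by rw [hρ]; simp only [Φ, if_neg hm]
      rw [h2, ← Set.mem_singleton_iff.1 h1]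
      exact subset_convexHull ℝ _ hP
  · refine hI.balanced_of_half_le hK (hsub t h) (by rw [hρ]; exact (Φ t _).2) fun Q hQ π hπ => ?_
    rw [hρ]
    by_cases hm : m₀ ∈ region (stats ρ h)
    · simp only [Φ, if_pos hm]
      change 1 / 2 ≤ if π = I.nullPolicy ∨ π = z then (1 / 2 : ℝ) else 0
      rw [if_pos (by
        by_cases h : π = I.nullPolicy
        · exact Or.inl h
        · exact Or.inr (hz π h))]
    · simp only [Φ, if_neg hm]
      have h1 := convexHull_min (hneg t h hm) (convex_singleton _) hQ
      rw [Set.mem_singleton_iff.1 h1] at hπ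
      have h2 : π = I.nullPolicy := by
        by_contra hne'
        exact hπ (if_neg hne')
      change 1 / 2 ≤ if π = I.nullPolicy then (1 : ℝ) else 0
      rw [if_pos h2]
      norm_num

end Input

namespace Input

variable {I : Input X}

/-! ### The size of the regret bound -/

theorem sum_inv_sqrt_le (n : ℕ) : ∑ t ∈ Finset.range (n + 1), 1 / √(t : ℝ) ≤ 2 * √(n : ℝ) := by
  induction n with
  | zero => simp
  | succ n ih =>
    rw [Finset.sum_range_succ]
    have h1 := Real.sq_sqrt (Nat.cast_nonneg n : (0 : ℝ) ≤ n)
    have h2 := Real.sq_sqrt (Nat.cast_nonneg (n + 1) : (0 : ℝ) ≤ (n + 1 : ℕ))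
    have h3 : 0 < √((n + 1 : ℕ) : ℝ) := Real.sqrt_pos.2 (by positivity)
    have h4 : 1 / √((n + 1 : ℕ) : ℝ) ≤ 2 * √((n + 1 : ℕ) : ℝ) - 2 * √(n : ℝ) := by
      rw [div_le_iff₀ h3]
      have e : ((n + 1 : ℕ) : ℝ) = n + 1 := by push_cast; ring
      nlinarith [sq_nonneg (√((n + 1 : ℕ) : ℝ) - √(n : ℝ))]
    linarith

/-- Outside the first `w T` rounds, the loss decays like the inverse square root of the time. (For
`t = 0` the last term is zero, by the conventions for division.) -/
theorem Proper.roundLoss_le (hI : I.Proper) (hκ : I.radConst = 32) {w : ℝ} (hw : 0 < w)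
    (hw4 : w < 1 / 4) (hy : I.numActs * I.logTerm / I.T ≤ w ^ 3) (t : ℕ) :
    I.roundLoss t ≤ (if (t : ℝ) ≤ w * I.T then 1 else 0) + 240 * w * √I.T * (1 / √t) := by
  have hT := hI.one_le_T'
  have hrest : 0 ≤ 240 * w * √I.T * (1 / √t) := by positivity
  by_cases ht : (t : ℝ) ≤ w * I.T
  · rw [if_pos ht]
    have : I.roundLoss t ≤ 1 := by
      unfold roundLoss
      split_ifs
      · exact le_rfl
      · exact min_le_left _ _
    linarith
  rw [if_neg ht, zero_add]
  push Not at ht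
  have ht0 : (0 : ℝ) < t := lt_of_le_of_lt (by positivity) ht
  have htn : t ≠ 0 := by
    rintro rfl
    simp at ht0
  have hl := hI.logTerm_pos
  have hK := I.numActs_pos
  set y := I.numActs * I.logTerm / I.T with hyd
  have hy0 : 0 < y := by positivity
  have hsy : √y ≤ w * √w := by
    refine (Real.sqrt_le_sqrt hy).trans_eq ?_
    rw [show w ^ 3 = w ^ 2 * w by ring, Real.sqrt_mul (sq_nonneg w), Real.sqrt_sq hw.le]
  have hsw : √w ≤ 1 / 2 := by
    rw [show (1 / 2 : ℝ) = √(1 / 4) by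
      rw [show (1 / 4 : ℝ) = (1 / 2) ^ 2 by norm_num, Real.sqrt_sq (by norm_num)]]
    exact Real.sqrt_le_sqrt hw4.le
  have hsw0 : 0 < √w := Real.sqrt_pos.2 hw
  have hsy0 : 0 < √y := Real.sqrt_pos.2 hy0
  have hnoise : I.noise = √y := by
    unfold noise
    exact min_eq_right (by nlinarith)
  have hsT : 0 < √(I.T : ℝ) := Real.sqrt_pos.2 (by linarith)
  have hst : 0 < √(t : ℝ) := Real.sqrt_pos.2 ht0
  have hKl : I.numActs * I.logTerm = √y * √y * (√I.T * √I.T) := by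
    rw [Real.mul_self_sqrt hy0.le, Real.mul_self_sqrt (by linarith), hyd]
    field_simp
  have e1 : √(I.radConst * I.logTerm * (2 * I.numActs) / t) = 8 * √y * √I.T * (1 / √t) := by
    rw [hκ, show 32 * I.logTerm * (2 * I.numActs) = 64 * (I.numActs * I.logTerm) by ring,
      Real.sqrt_div' _ ht0.le, hKl,
      show 64 * (√y * √y * (√(I.T : ℝ) * √I.T)) = (8 * √y * √I.T) ^ 2 by ring,
      Real.sqrt_sq (by positivity)]
    ring
  have e2 : I.radConst * I.logTerm * I.numActs / (I.noise * t) =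
      32 * √y * √I.T * (√I.T / √t) * (1 / √t) := by
    have e : (t : ℝ) = √t * √t := (Real.mul_self_sqrt ht0.le).symm
    rw [hκ, hnoise, show 32 * I.logTerm * I.numActs = 32 * (I.numActs * I.logTerm) by ring, hKl,
      show √y * (t : ℝ) = √y * (√t * √t) by rw [← e]]
    field_simp
  -- after time `w T`, one of the two factors `√(T / t)` is at most `1 / √w`
  have e3 : √I.T / √t ≤ 1 / √w := by
    rw [div_le_div_iff₀ hst hsw0, one_mul, mul_comm, ← Real.sqrt_mul hw.le]
    exact Real.sqrt_le_sqrt ht.le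
  have e4 : √y * (√I.T / √t) ≤ w := by
    calc √y * (√I.T / √t) ≤ (w * √w) * (1 / √w) := by gcongr
      _ = w := by field_simp
  have e5 : √y ≤ w := by nlinarith
  unfold roundLoss avgRadius
  rw [if_neg htn, e1, e2]
  refine (min_le_right _ _).trans ?_
  have h1 : √y * (√I.T * (1 / √t)) ≤ w * (√I.T * (1 / √t)) := by gcongr
  have h2 : √y * (√I.T / √t) * (√I.T * (1 / √t)) ≤ w * (√I.T * (1 / √t)) := by gcongr
  nlinarith

/-- If `K ℓ / T ≤ w³`, then the regret against the linear program is of order `w T`. -/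
theorem Proper.regret_le (hI : I.Proper) (hκ : I.radConst = 32) {w : ℝ} (hw : 0 < w)
    (hy : I.numActs * I.logTerm / I.T ≤ w ^ 3) :
    2 * ((∑ i : Fin I.T, I.roundLoss i) + I.T * I.noise + 1) + √I.T ≤ 1000 * w * I.T := by
  have hT := hI.one_le_T'
  have hl := hI.half_le_logTerm
  have hK := I.one_le_numActs
  rcases le_or_gt (1 / 4) w with hw4 | hw4
  · have h1 : ∑ i : Fin I.T, I.roundLoss i ≤ I.T := by
      refine (Finset.sum_le_sum (g := fun _ => (1 : ℝ)) fun i _ => ?_).trans (by simp)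
      unfold roundLoss
      split_ifs
      · exact le_rfl
      · exact min_le_left _ _
    have h2 : I.T * I.noise ≤ I.T * 1 :=
      mul_le_mul_of_nonneg_left (I.noise_le_half.trans (by norm_num)) (by linarith)
    have h3 : √(I.T : ℝ) ≤ I.T := Real.sqrt_le_iff.2 ⟨by linarith, by nlinarith⟩
    nlinarith
  have hsw : √w ≤ 1 := Real.sqrt_le_one.2 (by linarith)
  have hnoise : I.noise ≤ w := by
    unfold noise
    refine (min_le_right _ _).trans ((Real.sqrt_le_sqrt hy).trans ?_)
    refine Real.sqrt_le_iff.2 ⟨hw.le, ?_⟩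
    nlinarith [sq_nonneg w]
  have hTw : 1 / 2 ≤ w ^ 3 * I.T := by
    refine le_trans ?_ ((div_le_iff₀ (by linarith)).1 hy)
    nlinarith
  have hTw2 : 1 / 2 ≤ w ^ 2 * I.T := by nlinarith [sq_nonneg w]
  have hTw1 : 1 / 2 ≤ w * I.T := by nlinarith
  have hsT : √(I.T : ℝ) ≤ 2 * (w * I.T) := by
    refine Real.sqrt_le_iff.2 ⟨by positivity, ?_⟩
    nlinarith
  have hcount : ∑ t ∈ Finset.range I.T, (if (t : ℝ) ≤ w * I.T then (1 : ℝ) else 0) ≤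
      w * I.T + 1 := by
    rw [Finset.sum_boole]
    have h1 : (Finset.range I.T).filter (fun t : ℕ => (t : ℝ) ≤ w * I.T) ⊆
        Finset.range (⌊w * I.T⌋₊ + 1) := fun t ht =>
      Finset.mem_range.2 (Nat.lt_succ_of_le (Nat.le_floor (Finset.mem_filter.1 ht).2))
    have h2 := Finset.card_le_card h1
    rw [Finset.card_range] at h2
    calc (((Finset.range I.T).filter fun t : ℕ => (t : ℝ) ≤ w * I.T).card : ℝ) ≤
        ((⌊w * I.T⌋₊ + 1 : ℕ) : ℝ) := Nat.cast_le.2 h2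
      _ ≤ w * I.T + 1 := by
        push_cast
        linarith [Nat.floor_le (show 0 ≤ w * I.T by positivity)]
  have hsum : ∑ i : Fin I.T, I.roundLoss i ≤ w * I.T + 1 + 480 * w * I.T := by
    rw [Fin.sum_univ_eq_sum_range I.roundLoss]
    calc ∑ t ∈ Finset.range I.T, I.roundLoss t ≤ ∑ t ∈ Finset.range I.T,
          ((if (t : ℝ) ≤ w * I.T then 1 else 0) + 240 * w * √I.T * (1 / √t)) :=
          Finset.sum_le_sum fun t _ => hI.roundLoss_le hκ hw hw4 hy t
      _ ≤ w * I.T + 1 + 240 * w * √I.T * (2 * √I.T) := by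
          rw [Finset.sum_add_distrib, ← Finset.mul_sum]
          gcongr
          refine (Finset.sum_le_sum_of_subset_of_nonneg (Finset.range_mono (Nat.le_succ _))
            fun t _ _ => by positivity).trans (sum_inv_sqrt_le I.T)
      _ = _ := by
          rw [show 240 * w * √(I.T : ℝ) * (2 * √I.T) = 480 * w * (√I.T * √I.T) by ring,
            Real.mul_self_sqrt (by linarith)]
  have h2 : I.T * I.noise ≤ I.T * w := mul_le_mul_of_nonneg_left hnoise (by linarith)
  nlinarith

end Input

/-! ### Parameters of the discretized problem -/

theorem le_rpow_bound {a T B Y : ℝ} (hT : 0 ≤ T) (hB : 0 ≤ B) (hY : 0 ≤ Y)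
    (h : a ^ 5 ≤ T ^ 3 * B * Y) :
    a ≤ T ^ (3 / 5 : ℝ) * B ^ (1 / 5 : ℝ) * Y ^ (1 / 5 : ℝ) := by
  have hr : (T ^ (3 / 5 : ℝ) * B ^ (1 / 5 : ℝ) * Y ^ (1 / 5 : ℝ)) ^ 5 = T ^ 3 * B * Y := by
    rw [mul_pow, mul_pow, ← Real.rpow_natCast, ← Real.rpow_natCast, ← Real.rpow_natCast,
      ← Real.rpow_mul hT, ← Real.rpow_mul hB, ← Real.rpow_mul hY]
    norm_num
  rw [← hr] at h
  exact le_of_pow_le_pow_left₀ (by norm_num) (by positivity) h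

/-- A bound on the ratio of the logarithmic factor `ℓ` in the confidence radius and
`log (T |Π|)`. -/
noncomputable def logConst (L₀ : ℝ) : ℝ := 3 + 2 * Real.log (8 + 16 / L₀)

theorem one_le_logConst {L₀ : ℝ} (h : 0 < L₀) : 1 ≤ logConst L₀ := by
  have h1 : 0 ≤ Real.log (8 + 16 / L₀) := Real.log_nonneg (by
    have : 0 < 16 / L₀ := by positivity
    linarith)
  unfold logConst
  linarith

/-- The grid width: it balances the loss from discretization against the number of prices. Without
supply, or for degenerate arguments, only the price zero is kept. -/
noncomputable def gridWidth (B T : ℕ) (L : ℝ) (N : ℕ) : ℝ :=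
  if 0 < B ∧ 0 < (L * Real.log (T * N) / T) ^ (1 / 4 : ℝ) / L then
    (L * Real.log (T * N) / T) ^ (1 / 4 : ℝ) / L
  else 2

theorem gridWidth_pos (B T : ℕ) (L : ℝ) (N : ℕ) : 0 < gridWidth B T L N := by
  unfold gridWidth
  split_ifs with h
  · exact h.2
  · exact two_pos

section

variable {B T : ℕ} {Pol : Finset (X → unitInterval)} {μ : Measure X} {κ L L₀ v : ℝ}

/-- In the nontrivial regime, where `v = (L log (T |Π|) / T)^(1/4) ≤ 1`, the grid of width `v / L`
makes `K ℓ / T` of order `v³`. -/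
theorem discretizedInput_exploration_le (hT : 1 ≤ T) (hN : 1 ≤ Pol.card)
    (hTN : 2 ≤ T * Pol.card) (hL₀ : 0 < L₀) (hL : L₀ ≤ L) (hv : 0 < v) (hv1 : v ≤ 1)
    (hvz : v ^ 4 * T = L * Real.log (T * Pol.card)) :
    (discretizedInput B T (v / L) Pol μ κ).numActs *
        (discretizedInput B T (v / L) Pol μ κ).logTerm / T ≤
      logConst L₀ * (1 + 2 / L₀) * v ^ 3 := by
  set I := discretizedInput B T (v / L) Pol μ κ
  have hL' : 0 < L := hL₀.trans_le hL
  have hT' : (1 : ℝ) ≤ T := by exact_mod_cast hT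
  have hN' : (1 : ℝ) ≤ Pol.card := by exact_mod_cast hN
  have hTN' : (2 : ℝ) ≤ T * Pol.card := by exact_mod_cast hTN
  set Λ := Real.log (T * Pol.card) with hΛd
  have hΛ : 1 / 2 ≤ Λ := by
    have h1 := Real.log_le_log two_pos hTN'
    have h2 := Real.log_two_gt_d9
    linarith
  have hK : I.numActs ≤ L / v + 2 := by
    have := discretizedInput_numActs_le (B := B) (T := T) (Pol := Pol) (μ := μ) (κ := κ)
      (div_pos hv hL')
    rwa [one_div_div] at this
  have hK1 := I.one_le_numActs
  have hM : (I.cands.card : ℝ) ≤ 2 * Pol.card :=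
    discretizedInput_card_cands_le.trans (by linarith)
  have hM1 := I.one_le_card_cands
  have hv4 : v ^ 4 ≤ 1 := pow_le_one₀ hv.le hv1
  have hLT : L ≤ 2 * T := by nlinarith
  have hvinv : 1 / v ≤ 2 * T / L₀ := by
    rw [div_le_div_iff₀ hv hL₀, one_mul]
    have h3 : v ^ 4 ≤ v := by
      calc v ^ 4 ≤ v ^ 1 := pow_le_pow_of_le_one hv.le hv1 (by norm_num)
        _ = v := pow_one v
    have h1 : v ^ 4 * T ≤ v * T := by gcongr
    have h2 : L₀ * (1 / 2) ≤ L * Λ := by gcongr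
    linarith
  have hKT : I.numActs ≤ (2 + 4 / L₀) * T ^ 2 := by
    have h1 : L / v ≤ 2 * T * (2 * T / L₀) := by
      rw [div_eq_mul_one_div]
      gcongr
    have h2 : (2 : ℝ) ≤ 2 * T ^ 2 := by nlinarith
    calc I.numActs ≤ 2 * T * (2 * T / L₀) + 2 * T ^ 2 := by linarith
      _ = _ := by ring
  have hl : I.logTerm ≤ logConst L₀ * Λ := by
    have h1 : 2 * I.numActs * T * I.cands.card ≤ (8 + 16 / L₀) * (T * Pol.card) ^ 3 := by
      calc 2 * I.numActs * T * I.cands.card ≤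
          2 * ((2 + 4 / L₀) * T ^ 2) * T * (2 * Pol.card) := by gcongr
        _ = (8 + 16 / L₀) * (T ^ 3 * Pol.card) := by ring
        _ ≤ (8 + 16 / L₀) * (T ^ 3 * Pol.card ^ 3) := by
            gcongr
            exact le_self_pow₀ hN' (by norm_num)
        _ = _ := by ring
    have h2 := Real.log_le_log (by positivity) h1
    rw [Real.log_mul (x := 8 + 16 / L₀) (by positivity) (by positivity), Real.log_pow] at h2
    have h3 : 0 ≤ Real.log (8 + 16 / L₀) := Real.log_nonneg (by
      have : 0 < 16 / L₀ := by positivity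
      linarith)
    calc I.logTerm ≤ Real.log (8 + 16 / L₀) + (3 : ℕ) * Λ := h2
      _ ≤ logConst L₀ * Λ := by
        unfold logConst
        push_cast
        nlinarith
  have hc := one_le_logConst hL₀
  have hΛe : Λ = v ^ 4 * T / L := by
    rw [hvz]
    field_simp
  have hl0 : 0 ≤ I.logTerm := Real.log_nonneg (by
    have h1 := one_le_mul_of_one_le_of_one_le (one_le_mul_of_one_le_of_one_le hK1 hT') hM1
    change 1 ≤ 2 * I.numActs * (T : ℝ) * I.cands.card
    linarith)
  rw [div_le_iff₀ (by linarith)]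
  calc I.numActs * I.logTerm ≤ (L / v + 2) * (logConst L₀ * Λ) := by gcongr
    _ = logConst L₀ * ((1 + 2 * v / L) * v ^ 3) * T := by
        rw [hΛe]
        field_simp
    _ ≤ logConst L₀ * ((1 + 2 * 1 / L₀) * v ^ 3) * T := by gcongr
    _ = _ := by ring

/-- The regret bound in the nontrivial regime `v ≤ 1`. (It becomes weaker than the trivial bound
when `B < T v`.) -/
theorem OPT_sub_le_expectedReward [IsProbabilityMeasure μ] (hT : 1 ≤ T) (hN : 1 ≤ Pol.card)
    (hTN : 2 ≤ T * Pol.card) (hB : 0 < B) (hPol : ∀ π ∈ Pol, Measurable π) (hL₀ : 0 < L₀)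
    (hL : L₀ ≤ L) (hv : 0 < v) (hv1 : v ≤ 1) (hvz : v ^ 4 * T = L * Real.log (T * Pol.card))
    {ε : ℝ} (hε : ε = v / L)
    {ρ : (discretizedInput B T ε Pol μ 32).MixtureRule} (hρ : Input.IsCBalance ρ)
    {S : Demand X} (hSm : ∀ p, Measurable fun x => S x p) (hSL : LipschitzDemand S L) :
    OPT μ S B T Pol - (2 + 1 / L₀ + 1000 * (logConst L₀ * (1 + 2 / L₀))) * (T * v) ≤
      expectedReward μ S B T ρ.strategy := by
  have hL' : 0 < L := hL₀.trans_le hL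
  have hT' : (1 : ℝ) ≤ T := by exact_mod_cast hT
  subst hε
  have hε : 0 < v / L := div_pos hv hL'
  have hI := discretizedInput_proper (B := B) (μ := μ) hT hε hPol (κ := 32) (by norm_num)
  have hS := measurable_saleProb hSm hSL
  obtain ⟨Q, hQ⟩ := Input.Outcomes.exists_lpPerfect (hI.trueOutcomes_feasible hS)
  have h1 := hI.expectedReward_ge rfl hB hS hρ hQ
  have h2 := OPT_le hT hB hε hPol (by norm_num) hSm hL'.le hSL hQ
  set c := logConst L₀ * (1 + 2 / L₀) with hc
  have hc1 : 1 ≤ c := by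
    have h3 := one_le_logConst hL₀
    have h4 : 0 < 2 / L₀ := by positivity
    nlinarith
  have h3 := hI.regret_le rfl (w := c * v) (by positivity) (by
    refine (discretizedInput_exploration_le hT hN hTN hL₀ hL hv hv1 hvz).trans ?_
    rw [mul_pow]
    gcongr
    exact le_self_pow₀ hc1 (by norm_num))
  have h4 : (L + 1) * (v / L) + L * (v / L) ≤ (2 + 1 / L₀) * v := by
    have h5 : 1 / L ≤ 1 / L₀ := one_div_le_one_div_of_le hL₀ hL
    calc (L + 1) * (v / L) + L * (v / L) = (2 + 1 / L) * v := by
          field_simp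
          ring
      _ ≤ _ := by gcongr
  have h5 : (T : ℝ) * ((L + 1) * (v / L) + L * (v / L)) ≤ T * ((2 + 1 / L₀) * v) := by gcongr
  change (T : ℝ) * _ - _ ≤ expectedReward μ S B T ρ.strategy at h1
  change _ ≤ 1000 * (c * v) * (T : ℝ) at h3
  linarith

theorem roundDown_two (p : unitInterval) : roundDown 2 p = 0 := by
  have h : ⌊(p : ℝ) / 2⌋ = 0 := by
    rw [Int.floor_eq_zero_iff]
    have h0 := p.2.1
    have h1 := p.2.2
    constructor <;> linarith
  apply Subtype.ext
  rw [coe_roundDown two_pos, h]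
  simp

/-- The algorithm's choices exist without supply, where the grid consists of the price zero only. -/
theorem exists_isCBalance_discretizedInput_zero [IsProbabilityMeasure μ] (hT : 1 ≤ T)
    (hN : 1 ≤ Pol.card) (hPol : ∀ π ∈ Pol, Measurable π) (hκ : 0 < κ)
    {ε : ℝ} (hε : ε = 2) :
    ∃ ρ : (discretizedInput 0 T ε Pol μ κ).MixtureRule, Input.IsCBalance ρ := by
  classical
  subst hε
  have hI := discretizedInput_proper (B := 0) (μ := μ) hT two_pos hPol hκ
  obtain ⟨π₀, hπ₀⟩ := Finset.card_pos.1 hN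
  have hzero : ∀ π ∈ (discretizedInput 0 T 2 Pol μ κ).policies, π = fun _ => 0 := by
    intro π hπ
    obtain ⟨π', -, rfl⟩ := exists_of_mem_discretize hπ
    exact funext fun x => roundDown_two _
  have hmem : (fun _ => 0) ∈ (discretizedInput 0 T 2 Pol μ κ).policies := by
    have := mem_discretize (ε := 2) hπ₀
    simp only [roundDown_two] at this
    exact this
  have hne : Nonempty X := nonempty_of_isProbabilityMeasure μ
  obtain ⟨x₀⟩ := hne
  refine hI.exists_isCBalance_of_zero rfl ?_ (z := ⟨fun _ => Sum.inl 0, Input.inl_mem_cands hmem⟩)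
    (fun π hπ => ?_) (fun h => ?_) fun x => rfl
  · have h2 : 1 < (discretizedInput 0 T 2 Pol μ κ).acts.card :=
      Finset.one_lt_card.2 ⟨_, Input.inl_mem_acts (hI.mem_prices _ hmem x₀), _,
        Input.skip_mem_acts _, by simp⟩
    exact Nat.ofNat_le_cast.2 h2
  · rcases Input.cands_cases π with h | ⟨π', h', h⟩
    · exact absurd (Subtype.ext h) hπ
    · exact Subtype.ext (by rw [h, hzero π' h'])
  · have := congrFun (congrArg Subtype.val h) x₀
    cases this

end

end Pricing

theorem theorem3 :
    ∃ κ : ℝ, 0 < κ ∧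
    ∃ ε : ℕ → ℕ → ℝ → ℕ → ℝ, (∀ B T L N, 0 < ε B T L N) ∧
    ∀ L₀ : ℝ, 0 < L₀ →
    ∃ C : ℝ, 0 < C ∧
    ∀ (X : Type*) [MeasurableSpace X] (μ : MeasureTheory.Measure X)
      [MeasureTheory.IsProbabilityMeasure μ]
      (B T : ℕ) (L : ℝ) (_ : L₀ ≤ L)
      (Pol : Finset (X → unitInterval)) (_ : ∀ π ∈ Pol, Measurable π) (_ : 2 ≤ T * Pol.card),
      let I := Pricing.discretizedInput B T (ε B T L Pol.card) Pol μ κ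
      (∃ ρ : I.MixtureRule, Pricing.Input.IsCBalance ρ) ∧
      ∀ ρ : I.MixtureRule, Pricing.Input.IsCBalance ρ →
        ∀ S : Pricing.Demand X, (∀ p, Measurable fun x => S x p) → Pricing.LipschitzDemand S L →
          Pricing.expectedReward μ S B T ρ.strategy ≥
            Pricing.OPT μ S B T Pol -
              C * ((T : ℝ) ^ (3 / 5 : ℝ) * (B : ℝ) ^ (1 / 5 : ℝ)) *
                (L * Real.log (T * Pol.card)) ^ (1 / 5 : ℝ) := by
  refine ⟨32, by norm_num, Pricing.gridWidth, Pricing.gridWidth_pos, fun L₀ hL₀ => ?_⟩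
  have hlc := Pricing.one_le_logConst hL₀
  have hC : 1 ≤ 2 + 1 / L₀ + 1000 * (Pricing.logConst L₀ * (1 + 2 / L₀)) := by
    have h1 : 0 < 1 / L₀ := by positivity
    have h2 : 0 < Pricing.logConst L₀ * (1 + 2 / L₀) := by positivity
    linarith
  refine ⟨2 + 1 / L₀ + 1000 * (Pricing.logConst L₀ * (1 + 2 / L₀)), by linarith, ?_⟩
  set C := 2 + 1 / L₀ + 1000 * (Pricing.logConst L₀ * (1 + 2 / L₀)) with hCd
  intro X _ μ _ B T L hL Pol hPol hTN I
  have hT : 1 ≤ T := Nat.pos_of_ne_zero fun h => by simp [h] at hTN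
  have hN : 1 ≤ Pol.card := Nat.pos_of_ne_zero fun h => by simp [h] at hTN
  have hT' : (1 : ℝ) ≤ T := by exact_mod_cast hT
  have hL' : 0 < L := hL₀.trans_le hL
  have hTN' : (2 : ℝ) ≤ T * Pol.card := by exact_mod_cast hTN
  have hΛ : 0 < Real.log (T * Pol.card) := Real.log_pos (by linarith)
  have hI : I.Proper := Pricing.discretizedInput_proper hT (Pricing.gridWidth_pos _ _ _ _) hPol
    (by norm_num)
  have hY : 0 < L * Real.log (T * Pol.card) := mul_pos hL' hΛ
  constructor
  · rcases Nat.eq_zero_or_pos B with rfl | hB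
    · exact Pricing.exists_isCBalance_discretizedInput_zero hT hN hPol (by norm_num)
        (if_neg fun h => lt_irrefl 0 h.1)
    · exact hI.exists_isCBalance_of_pos hB
  intro ρ hρ S hSm hSL
  have hopt := Pricing.OPT_le_min (μ := μ) (B := B) (T := T) hPol hSm hSL
  have hrew : 0 ≤ Pricing.expectedReward μ S B T ρ.strategy :=
    MeasureTheory.integral_nonneg fun h => Pricing.totalReward_nonneg _ _
  have hB0 : (0 : ℝ) ≤ B := Nat.cast_nonneg _
  set G := (T : ℝ) ^ (3 / 5 : ℝ) * (B : ℝ) ^ (1 / 5 : ℝ) *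
    (L * Real.log (T * Pol.card)) ^ (1 / 5 : ℝ) with hG
  have hG0 : 0 ≤ G := by positivity
  have hCG : G ≤ C * G := le_mul_of_one_le_left hG0 hC
  rw [ge_iff_le, mul_assoc, ← hG]
  -- it suffices to bound the optimum where the trivial bound `min B T` is good enough
  have htriv : min (B : ℝ) T ^ 5 ≤ (T : ℝ) ^ 3 * B * (L * Real.log (T * Pol.card)) →
      Pricing.OPT μ S B T Pol - C * G ≤ Pricing.expectedReward μ S B T ρ.strategy := fun h => by
    have := Pricing.le_rpow_bound (by linarith) hB0 hY.le h
    linarith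
  have hm0 : 0 ≤ min (B : ℝ) T := le_min hB0 (by linarith)
  have hmB : min (B : ℝ) T ≤ B := min_le_left _ _
  have hmT : min (B : ℝ) T ≤ T := min_le_right _ _
  rcases lt_or_ge (T : ℝ) (L * Real.log (T * Pol.card)) with hbig | hsmall
  · refine htriv ?_
    calc min (B : ℝ) T ^ 5 = min (B : ℝ) T ^ 3 * min (B : ℝ) T * min (B : ℝ) T := by ring
      _ ≤ (T : ℝ) ^ 3 * B * (L * Real.log (T * Pol.card)) := by
        gcongr
        exact hmT.trans hbig.le
  set v := (L * Real.log (T * Pol.card) / T) ^ (1 / 4 : ℝ) with hvd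
  have hz0 : 0 < L * Real.log (T * Pol.card) / T := by positivity
  have hv : 0 < v := Real.rpow_pos_of_pos hz0 _
  have hv4 : v ^ 4 = L * Real.log (T * Pol.card) / T := by
    rw [hvd, ← Real.rpow_natCast, ← Real.rpow_mul hz0.le]
    norm_num
  have hvz : v ^ 4 * T = L * Real.log (T * Pol.card) := by
    rw [hv4]
    field_simp
  have hv1 : v ≤ 1 := Real.rpow_le_one hz0.le ((div_le_one (by linarith)).2 hsmall) (by norm_num)
  rcases lt_or_ge (B : ℝ) (T * v) with hlow | hhigh
  · refine htriv ?_
    rw [← hvz]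
    calc min (B : ℝ) T ^ 5 = min (B : ℝ) T ^ 4 * min (B : ℝ) T := by ring
      _ ≤ (T * v) ^ 4 * B := by
        gcongr
        exact hmB.trans hlow.le
      _ = _ := by ring
  have hB : 0 < B := by
    have : (0 : ℝ) < B := lt_of_lt_of_le (by positivity) hhigh
    exact_mod_cast this
  have hε : Pricing.gridWidth B T L Pol.card = v / L := if_pos ⟨hB, div_pos hv hL'⟩
  have key : Pricing.OPT μ S B T Pol - C * (T * v) ≤
      Pricing.expectedReward μ S B T ρ.strategy :=
    Pricing.OPT_sub_le_expectedReward hT hN hTN hB hPol hL₀ hL hv hv1 hvz hε hρ hSm hSL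
  have hTv : T * v ≤ G := by
    refine Pricing.le_rpow_bound (by linarith) hB0 hY.le ?_
    rw [← hvz]
    calc (T * v) ^ 5 = (T : ℝ) ^ 3 * (T * v) * (v ^ 4 * T) := by ring
      _ ≤ _ := by gcongr
  have : C * (T * v) ≤ C * G := mul_le_mul_of_nonneg_left hTv (by linarith)
  linarith
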